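/- Fix an integer $b\ge 2$ and let $\lambda\ge 0$. Consider the following splitting operation on a rooted connected countable (loopless) multigraph with root $o$: replace each vertex $v$ by $b$ vertices $v_1,\dots,v_b$ and join each pair $v_i,v_j$ ($i\ne j$) by a Poisson($\lambda/b$) number of edges; replace each edge $uv$ by one of the $b^2$ edges $u_iv_j$, chosen uniformly at random; choose the new root uniformly among $o_1,\dots,o_b$; discard all components not containing the new root. All random choices are independent. Let $G(\lambda)$ denote a rooted connected random multigraph with finite expected root degree whose law (up to isomorphism of rooted multigraphs) is invariant under this operation. Let $T_\infty$ be the $b$-ary canopy tree: the infinite tree with vertices $(h,x)$, $h,x\in\{0,1,2,\dots\}$, in which $(h,x)$ is joined to its parent $(h+1,\lfloor x/b\rfloor)$; its leaves are the vertices $(0,x)$. In the Poisson edge model, distinct leaves $x,y$ of $T_\infty$ are joined by a number of edges that is Poisson with mean $\lambda b^{1-d(x,y)}$, where $d$ is the distance in $T_\infty$, independently for all pairs. Let $C_\infty(\lambda)$ be the connected component of the leaf $(0,0)$, rooted at that leaf. **Theorem.** For every $\lambda\ge0$, $C_\infty(\lambda)$ is such a graph $G(\lambda)$, and every such $G(\lambda)$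 has the same law as $C_\infty(\lambda)$ up to isomorphism of rooted multigraphs. It is almost surely finite, and there are constants $c,C>0$, depending only on $b$, such that its expected number of vertices $\chi(\lambda)$ satisfies $$\chi(\lambda)<e^{e^{C\lambda}}\quad\text{for all }\lambda\ge0,\qquad e^{c\lambda}<\chi(\lambda)\quad\text{for all }\lambda>0 .$$ Moreover $\log\chi(\lambda)=O(e^{\lambda}\log\lambda)$ as $\lambda\to\infty$. -/

import Mathlib

open MeasureTheory ProbabilityTheory
open scoped NNReal ENNReal

noncomputable section

namespace CanopyGraph

/-! ### Loopless multigraphs and rooted multigraphs up to isomorphism -/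

/-- Unordered pairs of distinct elements of `V`. -/
abbrev VPair (V : Type*) := {e : Sym2 V // ¬ e.IsDiag}

/-- A loopless multigraph on the vertex set `V`: the number of parallel edges for each pair. -/
abbrev MGraph (V : Type*) := VPair V → ℕ

/-- The multigraph with `f u v` edges between distinct `u` and `v`. -/
def MGraph.ofFun {V : Type*} (f : V → V → ℕ) (hf : ∀ u v, f u v = f v u) : MGraph V :=
  fun e => Sym2.lift ⟨f, hf⟩ e.1

/-- The number of edges between `u` and `v`. -/
def mult {V : Type*} [DecidableEq V] (G : MGraph V) (u v : V) : ℕ :=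
  if h : u = v then 0 else G ⟨s(u, v), by simpa using h⟩

theorem mult_comm {V : Type*} [DecidableEq V] (G : MGraph V) (u v : V) :
    mult G u v = mult G v u := by
  unfold mult
  by_cases h : u = v
  · simp [h]
  · have h' : ¬ v = u := fun e => h e.symm
    simp only [h, h', dif_neg, not_false_eq_true]
    congr 2
    exact Sym2.eq_swap

/-- The simple graph obtained by forgetting multiplicities. -/
def toSimple {V : Type*} [DecidableEq V] (G : MGraph V) : SimpleGraph V where
  Adj u v := mult G u v ≠ 0
  symm := ⟨fun u v h => by rwa [mult_comm]⟩
  loopless := ⟨fun u h => h (by simp [mult])⟩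

/-- A code for a rooted connected countable multigraph: a multigraph on `ℕ` together with a root.
The graph that is meant is the connected component of the root; all other components are
discarded, see `cluster` and `Iso`. -/
abbrev RGraph := MGraph ℕ × ℕ

/-- The vertex set of the rooted connected multigraph coded by `X`. -/
def cluster (X : RGraph) : Set ℕ := {v | (toSimple X.1).Reachable X.2 v}

/-- Isomorphism of the rooted connected multigraphs coded by `X` and `Y`. -/
def Iso (X Y : RGraph) : Prop :=
  ∃ φ : cluster X ≃ cluster Y,
    (∀ x : cluster X, (x : ℕ) = X.2 → (φ x : ℕ) = Y.2) ∧
    ∀ x x' : cluster X, mult Y.1 (φ x) (φ x') = mult X.1 x x'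

/-- Two laws of rooted connected multigraphs agree (up to isomorphism of rooted multigraphs): they
give the same mass to every isomorphism-invariant event. -/
def SameLaw (μ ν : Measure RGraph) : Prop :=
  ∀ A : Set RGraph, MeasurableSet A → (∀ X Y, Iso X Y → (X ∈ A ↔ Y ∈ A)) → μ A = ν A

/-- The number of edges at the root. -/
def rootDegree (X : RGraph) : ℝ≥0∞ := ∑' v : ℕ, (mult X.1 X.2 v : ℝ≥0∞)

/-- The expected number of vertices (possibly infinite). -/
def meanSize (μ : Measure RGraph) : ℝ≥0∞ := ∫⁻ X, ((cluster X).encard : ℝ≥0∞) ∂μ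

/-! ### The splitting operation -/

/-- The multigraph obtained from `G` by splitting every vertex `u` into the `b` vertices
`b * u + i`, `i < b`. The `k`-th edge between `u` and `v` becomes an edge between the
vertices `b * u + half (u, v, k)` and `b * v + half (v, u, k)`, and `new (u, {i, j})` edges are put
between `b * u + i` and `b * u + j`. -/
def split (b : ℕ) [NeZero b] (G : MGraph ℕ) (half : ℕ × ℕ × ℕ → Fin b)
    (new : ℕ × VPair (Fin b) → ℕ) : MGraph ℕ :=
  MGraph.ofFun
    (fun x y =>
      if (Nat.divModEquiv b x).1 = (Nat.divModEquiv b y).1 then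
        mult (fun e => new ((Nat.divModEquiv b x).1, e))
          (Nat.divModEquiv b x).2 (Nat.divModEquiv b y).2
      else
        ((Finset.range (mult G (Nat.divModEquiv b x).1 (Nat.divModEquiv b y).1)).filter
          (fun k =>
            half ((Nat.divModEquiv b x).1, (Nat.divModEquiv b y).1, k)
                = (Nat.divModEquiv b x).2 ∧
            half ((Nat.divModEquiv b y).1, (Nat.divModEquiv b x).1, k)
                = (Nat.divModEquiv b y).2)).card)
    (fun x y => by
      by_cases h : (Nat.divModEquiv b x).1 = (Nat.divModEquiv b y).1
      · simp only [h, if_true]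
        exact mult_comm _ _ _
      · have h' : ¬ (Nat.divModEquiv b y).1 = (Nat.divModEquiv b x).1 := fun e => h e.symm
        simp only [h, h', if_false]
        rw [mult_comm]
        congr 1
        ext k
        simp only [Finset.mem_filter, and_comm])

/-- The split rooted multigraph, rooted at the child number `i` of the old root. -/
def splitRooted (b : ℕ) [NeZero b]
    (ω : RGraph × (ℕ × ℕ × ℕ → Fin b) × (ℕ × VPair (Fin b) → ℕ) × Fin b) : RGraph :=
  (split b ω.1.1 ω.2.1 ω.2.2.1, b * ω.1.2 + (ω.2.2.2 : ℕ))

/-- The uniform distribution on `Fin b`. -/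
def unif (b : ℕ) [NeZero b] : Measure (Fin b) := (PMF.uniformOfFintype (Fin b)).toMeasure

instance (b : ℕ) [NeZero b] : IsProbabilityMeasure (unif b) := by
  unfold unif; infer_instance

/-- The law of the result of the splitting operation applied to a random rooted multigraph with
law `μ`: the end-vertices of old edges and the new root are chosen uniformly, the numbers
of new edges are Poisson with mean `lam / b`, and all choices are independent. -/
def splitLaw (b : ℕ) [NeZero b] (lam : ℝ≥0) (μ : Measure RGraph) : Measure RGraph :=
  (μ.prod ((Measure.infinitePi (fun _ : ℕ × ℕ × ℕ => unif b)).prod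
    ((Measure.infinitePi (fun _ : ℕ × VPair (Fin b) => poissonMeasure (lam / b))).prod
      (unif b)))).map (splitRooted b)

/-- `μ` is the law of a rooted connected random multigraph with finite expected root degree that
is invariant under the splitting operation. -/
structure IsSplitInvariant (b : ℕ) [NeZero b] (lam : ℝ≥0) (μ : Measure RGraph) : Prop where
  isProbability : IsProbabilityMeasure μ
  finite_degree : ∫⁻ X, rootDegree X ∂μ < ∞
  invariant : SameLaw (splitLaw b lam μ) μ

/-! ### The Poisson edge model on the leaves of the canopy tree -/

/-- The `b`-ary canopy tree: the vertex `(h, x)` has height `h` and parent `(h + 1, x / b)`.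
The leaves are the vertices `(0, x)`, and `(0, 0)` is the origin. -/
def canopyTree (b : ℕ) : SimpleGraph (ℕ × ℕ) :=
  SimpleGraph.fromRel (fun p q => q = (p.1 + 1, p.2 / b))

/-- The mean number `lam * b ^ (1 - d(x, y))` of edges between two distinct leaves. -/
def edgeRate (b : ℕ) (lam : ℝ≥0) (e : VPair ℕ) : ℝ≥0 :=
  Sym2.lift ⟨fun x y => lam * (b : ℝ≥0) ^ (1 - ((canopyTree b).dist (0, x) (0, y) : ℤ)),
    fun x y => by simp only [SimpleGraph.dist_comm]⟩ e.1

/-- The law of the Poisson edge model, rooted at the origin: independent Poisson numbers of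
edges between the leaves of the canopy tree. As a rooted connected multigraph it is the cluster
of the origin. -/
def edgeModel (b : ℕ) (lam : ℝ≥0) : Measure RGraph :=
  (Measure.infinitePi (fun e : VPair ℕ => poissonMeasure (edgeRate b lam e))).map
    (fun G => (G, 0))

end CanopyGraph

end

open MeasureTheory ProbabilityTheory
open scoped NNReal ENNReal

noncomputable section

namespace CanopyGraph

/-! ### Basic facts on multigraphs -/

section Basic

variable {V : Type*} [DecidableEq V]

/-! Invariance is Poisson thinning. Passing from two non-sibling leaves to their parents shortens
the distance by two, so the rate between children is the rate between the parents divided by `b ^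
2`. This is what a uniform choice among the `b ^ 2` pairs of children produces, while siblings get
exactly the rate `lam / b` of the new edges (`rate_parent`, `map_split_edgeMeasure`). The new root
is one of the leaves below `b`, and all leaves are equivalent under automorphisms of the hierarchy
(`exists_preservesBlocks`).

Uniqueness is a coupling. An invariant random graph and its bare root are split repeatedly with the
same choices, so the second graph stays nested in the first. An edge present only in the larger
graph lands on a given child of its end-vertex with probability `1 / b`, independently of the
smaller graph (`ExcessBound.split`). After `n` splittings, the probability that some surplus edge
meets the small cluster is at most the mean root degree times `b ^ (-n)` times the mean size of that
cluster (`measure_excess_le`). By nesting, the last factor is at most the mean size under any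
invariant law, in particular under the canopy model, where it is finite. Hence all invariant laws
are the limit of the iterated splittings of a single vertex.

For the upper bound, a leaf has total rate at most `lam / b ^ n` out of its block of size `b ^ n`.
Exploring the cluster from its part in that block gives the branching inequality `blockMean_le`.
Thus the mean size is at most `2 * b ^ n` as soon as the mean cluster size within the block, times
`lam / b ^ n`, is at most `1 / 2`. To find such a scale, observe that the total rate out of a block
is at most `lam` at every scale, so a block is isolated with probability at least `exp (-lam)`,
almost independently for distant scales. A Bonferroni estimate gives an isolated block among about
`exp lam` scales with probability bounded below (`real_window_ge`). About `log lam` consecutive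
windows make failure rare enough (`real_entangled_le`), so that `n` is of order `exp lam * log lam`.

For the lower bound, two sibling sub-blocks are joined with total rate `lam / b` at every scale, so
a block whose size is a small multiple of `exp (lam / b)` is entirely connected with probability at
least `1 / 2` (`real_fullBlock_compl_le`). For small `lam` a single possible edge suffices. -/

@[simp] theorem mult_self (G : MGraph V) (u : V) : mult G u u = 0 := by simp [mult]

theorem mult_of_ne (G : MGraph V) {u v : V} (h : u ≠ v) :
    mult G u v = G ⟨s(u, v), by simpa using h⟩ := by simp [mult, h]

theorem mult_ofFun (f : V → V → ℕ) (hf : ∀ u v, f u v = f v u) {u v : V} (h : u ≠ v) :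
    mult (MGraph.ofFun f hf) u v = f u v := by
  simp [mult_of_ne _ h, MGraph.ofFun]

theorem measurable_mult (u v : V) : Measurable fun G : MGraph V => mult G u v := by
  by_cases h : u = v
  · simp [h]
  · simp only [mult_of_ne _ h]
    fun_prop

theorem mult_mono {G H : MGraph V} (h : H ≤ G) (u v : V) : mult H u v ≤ mult G u v := by
  by_cases huv : u = v
  · simp [huv]
  · simpa only [mult_of_ne _ huv] using h _

theorem toSimple_adj (G : MGraph V) (u v : V) : (toSimple G).Adj u v ↔ mult G u v ≠ 0 := Iff.rfl

theorem reachable_iff (G : MGraph V) (u v : V) :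
    (toSimple G).Reachable u v ↔ Relation.ReflTransGen (fun x y => mult G x y ≠ 0) u v :=
  SimpleGraph.reachable_iff_reflTransGen u v

theorem reachable_mono {G H : MGraph V} (h : H ≤ G) {u v : V}
    (huv : (toSimple H).Reachable u v) : (toSimple G).Reachable u v := by
  refine huv.mono fun x y hxy => ?_
  rw [toSimple_adj] at *
  have := mult_mono h x y
  omega

end Basic

/-! ### Measurability of connection events and cluster sizes. -/

theorem measurableSet_reflTransGen {Ω V : Type*} [MeasurableSpace Ω] [Countable V]
    (r : Ω → V → V → Prop) (h : ∀ u v, MeasurableSet {ω | r ω u v}) (u v : V) :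
    MeasurableSet {ω | Relation.ReflTransGen (r ω) u v} := by
  -- `S n v` is the event that a path of length `n` leads from `u` to `v`; only countable unions are
  -- needed.
  let S : ℕ → V → Set Ω := fun n => n.rec (fun v => {_ω | u = v})
    (fun _ T v => ⋃ w, (T w ∩ {ω | r ω w v}))
  have hS : ∀ n v, MeasurableSet (S n v) := by
    intro n
    induction n with
    | zero => intro v; exact MeasurableSet.const _
    | succ n ih => intro v; exact MeasurableSet.iUnion fun w => (ih w).inter (h w v)
  have : {ω | Relation.ReflTransGen (r ω) u v} = ⋃ n, S n v := by
    ext ω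
    simp only [Set.mem_ofPred_eq, Set.mem_iUnion]
    constructor
    · intro huv
      induction huv with
      | refl => exact ⟨0, rfl⟩
      | tail _ hbc ih =>
        obtain ⟨n, hn⟩ := ih
        exact ⟨n + 1, Set.mem_iUnion.2 ⟨_, hn, hbc⟩⟩
    · rintro ⟨n, hn⟩
      induction n generalizing v with
      | zero => rw [show u = v from hn]
      | succ n ih =>
        obtain ⟨w, hw, hwv⟩ := Set.mem_iUnion.1 hn
        exact (ih w hw).tail hwv
  rw [this]
  exact MeasurableSet.iUnion fun n => hS n v

theorem measurableSet_reachable (u v : ℕ) :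
    MeasurableSet {G : MGraph ℕ | (toSimple G).Reachable u v} := by
  simp only [reachable_iff]
  refine measurableSet_reflTransGen (fun (G : MGraph ℕ) x y => mult G x y ≠ 0) (fun x y => ?_) u v
  exact (measurable_mult x y) (.of_discrete : MeasurableSet {n : ℕ | n ≠ 0})

theorem measurableSet_rgraph {p : MGraph ℕ → ℕ → Prop} (h : ∀ r, MeasurableSet {G | p G r}) :
    MeasurableSet {X : RGraph | p X.1 X.2} := by
  have : {X : RGraph | p X.1 X.2} = ⋃ r, ({G | p G r} ×ˢ {r}) := by
    ext X; simp
  rw [this]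
  exact MeasurableSet.iUnion fun r => (h r).prod (measurableSet_singleton r)

theorem measurable_rgraph {β : Type*} [MeasurableSpace β] {f : RGraph → β}
    (h : ∀ r, Measurable fun G => f (G, r)) : Measurable f :=
  measurable_from_prod_countable_left h

theorem measurableSet_mem_cluster (v : ℕ) : MeasurableSet {X : RGraph | v ∈ cluster X} :=
  measurableSet_rgraph (p := fun G r => (toSimple G).Reachable r v)
    fun r => measurableSet_reachable r v

theorem root_mem_cluster (X : RGraph) : X.2 ∈ cluster X := SimpleGraph.Reachable.refl _

theorem mem_cluster_of_mult {X : RGraph} {x y : ℕ} (hx : x ∈ cluster X) (h : mult X.1 x y ≠ 0) :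
    y ∈ cluster X :=
  SimpleGraph.Reachable.trans hx (SimpleGraph.Adj.reachable (G := toSimple X.1) h)

theorem encard_eq_tsum (S : Set ℕ) : (S.encard : ℝ≥0∞) = ∑' v, S.indicator 1 v := by
  rw [← ENNReal.tsum_set_one, tsum_subtype S (fun _ => (1 : ℝ≥0∞))]
  rfl

theorem measurable_card_cluster : Measurable fun X : RGraph => ((cluster X).encard : ℝ≥0∞) := by
  simp only [encard_eq_tsum]
  refine Measurable.tsum fun v => ?_
  exact (measurable_const (a := (1 : ℝ≥0∞))).indicator (measurableSet_mem_cluster v)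

theorem measurable_rootDegree : Measurable rootDegree := by
  refine measurable_rgraph fun r => Measurable.tsum fun v => ?_
  exact (measurable_of_countable (fun n : ℕ => (n : ℝ≥0∞))).comp (measurable_mult r v)

/-! ### Isomorphism-invariant functions -/

/-- Induction along paths shows that `φ` carries one cluster onto the other. The hypothesis
`hclosed` prevents edges from leaving the image, which gives surjectivity. -/
theorem iso_of_map {X Y : RGraph} (φ : ℕ → ℕ) (hroot : φ X.2 = Y.2)
    (hinj : Set.InjOn φ (cluster X))
    (hmult : ∀ x ∈ cluster X, ∀ x' ∈ cluster X, mult Y.1 (φ x) (φ x') = mult X.1 x x')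
    (hclosed : ∀ x ∈ cluster X, ∀ y, mult Y.1 (φ x) y ≠ 0 → ∃ x' ∈ cluster X, φ x' = y) :
    Iso X Y := by
  have himage : φ '' cluster X = cluster Y := by
    apply Set.Subset.antisymm
    · rintro _ ⟨x, hx, rfl⟩
      have hx' := (reachable_iff _ _ _).1 hx
      induction hx' with
      | refl => rw [hroot]; exact root_mem_cluster Y
      | tail hab hbc ih =>
        have hb := (reachable_iff _ _ _).2 hab
        refine mem_cluster_of_mult (ih hb) ?_
        rw [hmult _ hb _ (mem_cluster_of_mult hb hbc)]
        exact hbc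
    · intro y hy
      have hy' := (reachable_iff _ _ _).1 hy
      induction hy' with
      | refl => exact ⟨X.2, root_mem_cluster X, hroot⟩
      | tail hab hbc ih =>
        obtain ⟨x, hx, rfl⟩ := ih ((reachable_iff _ _ _).2 hab)
        obtain ⟨x', hx', rfl⟩ := hclosed x hx _ hbc
        exact ⟨x', hx', rfl⟩
  refine ⟨(Equiv.Set.imageOfInjOn φ _ hinj).trans (Equiv.setCongr himage), ?_, ?_⟩
  · intro x hx
    simp only [Equiv.trans_apply, Equiv.setCongr_apply]
    change φ x = _
    rw [hx, hroot]
  · intro x x'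
    exact hmult x x.2 x' x'.2

/-- The σ-algebra of isomorphism-invariant events. -/
@[reducible]
def isoSpace : MeasurableSpace RGraph where
  MeasurableSet' A := MeasurableSet A ∧ ∀ X Y, Iso X Y → (X ∈ A ↔ Y ∈ A)
  measurableSet_empty := ⟨MeasurableSet.empty, by simp⟩
  measurableSet_compl A hA := ⟨hA.1.compl, fun X Y h => not_congr (hA.2 X Y h)⟩
  measurableSet_iUnion f hf := ⟨MeasurableSet.iUnion fun i => (hf i).1, fun X Y h => by
    simp only [Set.mem_iUnion]
    exact exists_congr fun i => (hf i).2 X Y h⟩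

theorem isoSpace_le : isoSpace ≤ (inferInstance : MeasurableSpace RGraph) := fun _ h => h.1

theorem measurable_isoSpace {f : RGraph → ℝ≥0∞} (hf : Measurable f)
    (hiso : ∀ X Y, Iso X Y → f X = f Y) : Measurable[isoSpace] f := fun s hs =>
  ⟨hf hs, fun X Y h => by simp [hiso X Y h]⟩

/-- Both measures have the same trim to the invariant σ-algebra, for which invariant functions are
measurable. -/
theorem SameLaw.lintegral_eq {μ ν : Measure RGraph} (h : SameLaw μ ν) {f : RGraph → ℝ≥0∞}
    (hf : Measurable f) (hiso : ∀ X Y, Iso X Y → f X = f Y) : ∫⁻ X, f X ∂μ = ∫⁻ X, f X ∂ν := by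
  have hf' := measurable_isoSpace hf hiso
  rw [← lintegral_trim isoSpace_le hf', ← lintegral_trim isoSpace_le hf']
  congr 1
  refine @Measure.ext _ isoSpace _ _ fun s hs => ?_
  rw [trim_measurableSet_eq isoSpace_le hs, trim_measurableSet_eq isoSpace_le hs]
  exact h s hs.1 hs.2

theorem SameLaw.trans {μ ν ρ : Measure RGraph} (h : SameLaw μ ν) (h' : SameLaw ν ρ) :
    SameLaw μ ρ := fun A hA hi => (h A hA hi).trans (h' A hA hi)

theorem Iso.encard_eq {X Y : RGraph} (h : Iso X Y) : (cluster X).encard = (cluster Y).encard :=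
  Set.encard_congr h.choose

theorem SameLaw.meanSize_eq {μ ν : Measure RGraph} (h : SameLaw μ ν) : meanSize μ = meanSize ν :=
  h.lintegral_eq measurable_card_cluster fun X Y hXY => by rw [hXY.encard_eq]

theorem ae_finite_of_meanSize {μ : Measure RGraph} (h : meanSize μ < ∞) :
    ∀ᵐ X ∂μ, (cluster X).Finite := by
  filter_upwards [ae_lt_top measurable_card_cluster h.ne] with X hX
  rw [← Set.encard_lt_top_iff]
  simpa using hX

/-! ### Distances in the canopy tree -/

theorem canopyTree_adj (b : ℕ) (p q : ℕ × ℕ) :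
    (canopyTree b).Adj p q ↔ q = (p.1 + 1, p.2 / b) ∨ p = (q.1 + 1, q.2 / b) := by
  rw [canopyTree, SimpleGraph.fromRel_adj, and_iff_right_iff_imp]
  rintro (h | h) rfl
  all_goals
    have := congrArg Prod.fst h
    simp at this

theorem div_pow_succ (b x n : ℕ) : x / b ^ (n + 1) = x / b / b ^ n := by
  rw [Nat.div_div_eq_div_mul, pow_succ']

theorem exists_walk_ancestor (b x n : ℕ) :
    ∃ p : (canopyTree b).Walk (0, x) (n, x / b ^ n), p.length = n := by
  induction n with
  | zero => exact ⟨SimpleGraph.Walk.nil.copy rfl (by simp), by rw [SimpleGraph.Walk.length_copy]; rfl⟩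
  | succ n ih =>
    obtain ⟨p, hp⟩ := ih
    refine ⟨p.concat ((canopyTree_adj _ _ _).2 (Or.inl ?_)), by simp [hp]⟩
    simp [pow_succ, Nat.div_div_eq_div_mul]

/-- Before it descends to the leaf `q`, a walk must reach a common ancestor, at some height `m`.
This costs `m - p.1` steps up and `m` steps down, whence the length bound. -/
theorem ancestor_of_walk {b : ℕ} {p q : ℕ × ℕ} (w : (canopyTree b).Walk p q) (hq : q.1 = 0) :
    ∃ m, p.1 ≤ m ∧ q.2 / b ^ m = p.2 / b ^ (m - p.1) ∧ 2 * m ≤ w.length + p.1 := by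
  induction w with
  | nil => exact ⟨_, le_rfl, by simp [hq], by simp [hq]⟩
  | @cons u v t hadj w ih =>
    obtain ⟨m, h1, h2, h3⟩ := ih hq
    rw [SimpleGraph.Walk.length_cons]
    rcases (canopyTree_adj _ _ _).1 hadj with h | h
    · subst h
      refine ⟨m, by simp at h1; omega, ?_, by simp at h3; omega⟩
      rw [h2]
      simp only at h1 ⊢
      rw [show m - u.1 = (m - (u.1 + 1)) + 1 by omega, div_pow_succ]
    · subst h
      simp only at *
      rcases Nat.lt_or_ge v.1 m with hm | hm
      -- A step down keeps `m`, unless `m` is the height of the new vertex; then the higher starting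
      -- vertex becomes the common ancestor.
      · refine ⟨m, by omega, ?_, by omega⟩
        rw [h2, show m - v.1 = (m - (v.1 + 1)) + 1 by omega, div_pow_succ]
      · obtain rfl : m = v.1 := by omega
        refine ⟨v.1 + 1, by omega, ?_, by omega⟩
        rw [pow_succ, ← Nat.div_div_eq_div_mul, h2]
        simp

theorem canopyTree_dist {b x y k : ℕ} (hk : x / b ^ k = y / b ^ k)
    (hmin : ∀ j < k, x / b ^ j ≠ y / b ^ j) : (canopyTree b).dist (0, x) (0, y) = 2 * k := by
  obtain ⟨p, hp⟩ := exists_walk_ancestor b x k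
  obtain ⟨q, hq⟩ := exists_walk_ancestor b y k
  let w := p.append (q.reverse.copy (by rw [hk]) rfl)
  have hw : w.length = 2 * k := by simp [w, hp, hq]; omega
  refine le_antisymm (hw ▸ SimpleGraph.dist_le w) ?_
  obtain ⟨r, hr⟩ := w.reachable.exists_walk_length_eq_dist
  obtain ⟨m, -, h2, h3⟩ := ancestor_of_walk r rfl
  rw [← hr]
  have : k ≤ m := by
    by_contra hlt
    exact hmin m (by omega) (by simpa using h2.symm)
  simp at h3
  omega

/-! ### Edge rates -/

/-- The mean number of edges between the leaves `x ≠ y`. -/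
def rate (b : ℕ) (lam : ℝ≥0) (x y : ℕ) : ℝ≥0 :=
  lam * (b : ℝ≥0) ^ (1 - ((canopyTree b).dist (0, x) (0, y) : ℤ))

theorem edgeRate_mk (b : ℕ) (lam : ℝ≥0) (x y : ℕ) (h) :
    edgeRate b lam ⟨s(x, y), h⟩ = rate b lam x y := rfl

theorem rate_siblings {b : ℕ} (lam : ℝ≥0) {x y : ℕ} (hxy : x ≠ y) (h : x / b = y / b) :
    rate b lam x y = lam / b := by
  rw [rate, canopyTree_dist (k := 1) (by simpa using h)
    (by intro j hj; obtain rfl : j = 0 := by omega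
        simpa using hxy)]
  norm_num [zpow_neg, div_eq_mul_inv]

theorem exists_common_ancestor {b : ℕ} (hb : 2 ≤ b) (x y : ℕ) : ∃ k, x / b ^ k = y / b ^ k := by
  refine ⟨x + y, ?_⟩
  have := Nat.lt_pow_self (n := x + y) (show 1 < b by omega)
  rw [Nat.div_eq_of_lt (by omega), Nat.div_eq_of_lt (by omega)]

/-- Each generation adds two to the distance, hence a factor `b ^ 2`, the number of pairs of
children among which an edge is distributed. This identity is the reason for invariance under
splitting. -/
theorem rate_parent {b : ℕ} (hb : 2 ≤ b) (lam : ℝ≥0) {x y : ℕ} (h : x / b ≠ y / b) :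
    rate b lam x y = rate b lam (x / b) (y / b) / b ^ 2 := by
  classical
  have hex := exists_common_ancestor hb (x / b) (y / b)
  have hk := Nat.find_spec hex
  have hmin : ∀ j < Nat.find hex, _ := fun j hj => Nat.find_min hex hj
  have hne : x ≠ y := by rintro rfl; exact h rfl
  have hb0 : (b : ℝ≥0) ≠ 0 := by positivity
  rw [rate, rate, canopyTree_dist hk hmin, canopyTree_dist (k := Nat.find hex + 1)]
  · rw [mul_div_assoc]
    congr 1
    rw [← zpow_natCast, ← zpow_sub₀ hb0]
    congr 1
    push_cast
    ring
  · simpa only [div_pow_succ] using hk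
  · intro j hj
    cases j with
    | zero => simpa using hne
    | succ j => simpa only [div_pow_succ] using hmin j (by omega)

set_option linter.unusedSectionVars false

section Sums

variable {b : ℕ} [NeZero b]

theorem tsum_divMod (f : ℕ → ℝ≥0∞) : ∑' y, f y = ∑' v, ∑ j : Fin b, f (b * v + j) := by
  rw [← (Nat.divModEquiv b).symm.tsum_eq, ENNReal.tsum_prod']
  refine tsum_congr fun v => ?_
  rw [tsum_fintype]
  refine Finset.sum_congr rfl fun j _ => ?_
  simp [Nat.divModEquiv, mul_comm]

theorem mul_add_div_fin (v : ℕ) (j : Fin b) : (b * v + j) / b = v := by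
  rw [Nat.mul_add_div (Nat.pos_of_neZero b), Nat.div_eq_of_lt j.2, add_zero]

theorem mul_add_mod_fin (v : ℕ) (j : Fin b) : (b * v + j) % b = j := by
  rw [Nat.mul_add_mod, Nat.mod_eq_of_lt j.2]

/-- The total rate of the edges from `x` that leave its block of size `b ^ n` but not its block
of size `b ^ N`. -/
def annulusRate (b : ℕ) (lam : ℝ≥0) (n N x : ℕ) : ℝ≥0∞ :=
  ∑' y, if y / b ^ N = x / b ^ N ∧ y / b ^ n ≠ x / b ^ n then (rate b lam x y : ℝ≥0∞) else 0

/-- Each parent in the annulus has `b` children, and each of them carries the parental rate divided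
by `b ^ 2`. -/
theorem annulusRate_succ_succ (hb : 2 ≤ b) (lam : ℝ≥0) (n N x : ℕ) :
    annulusRate b lam (n + 1) (N + 1) x = annulusRate b lam n N (x / b) / b := by
  have hb0 : (b : ℝ≥0) ≠ 0 := by positivity
  rw [annulusRate, tsum_divMod (b := b), annulusRate, div_eq_mul_inv, ← ENNReal.tsum_mul_right]
  refine tsum_congr fun v => ?_
  have : ∀ j : Fin b, (if (b * v + j) / b ^ (N + 1) = x / b ^ (N + 1) ∧
      (b * v + j) / b ^ (n + 1) ≠ x / b ^ (n + 1) then (rate b lam x (b * v + j) : ℝ≥0∞) else 0)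
      = if v / b ^ N = x / b / b ^ N ∧ v / b ^ n ≠ x / b / b ^ n then
        ((rate b lam (x / b) v / b ^ 2 : ℝ≥0) : ℝ≥0∞) else 0 := by
    intro j
    simp only [div_pow_succ, mul_add_div_fin]
    split_ifs with h
    · have : x / b ≠ (b * v + j) / b := by
        rw [mul_add_div_fin]
        rintro e
        exact h.2 (by rw [e])
      rw [rate_parent hb lam this, mul_add_div_fin]
    · rfl
  rw [Finset.sum_congr rfl fun j _ => this j, Finset.sum_const, Finset.card_univ, Fintype.card_fin]
  split_ifs
  · rw [nsmul_eq_mul, ← ENNReal.coe_natCast, ← ENNReal.coe_mul, ← ENNReal.coe_inv hb0,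
      ← ENNReal.coe_mul]
    congr 1
    field_simp
  · simp

theorem annulusRate_zero_one (hb : 2 ≤ b) (lam : ℝ≥0) (x : ℕ) :
    annulusRate b lam 0 1 x = ((b - 1 : ℕ) * (lam / b) : ℝ≥0) := by
  have hx : x = b * (x / b) + (⟨x % b, Nat.mod_lt _ (by omega)⟩ : Fin b) := (Nat.div_add_mod x b).symm
  set i : Fin b := ⟨x % b, Nat.mod_lt _ (by omega)⟩
  rw [annulusRate, tsum_divMod (b := b), tsum_eq_single (x / b)]
  · have : ∀ j : Fin b, (if (b * (x / b) + j) / b ^ 1 = x / b ^ 1 ∧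
        (b * (x / b) + j) / b ^ 0 ≠ x / b ^ 0 then (rate b lam x (b * (x / b) + j) : ℝ≥0∞) else 0)
        = if j ≠ i then ((lam / b : ℝ≥0) : ℝ≥0∞) else 0 := by
      intro j
      simp only [pow_one, mul_add_div_fin, pow_zero, Nat.div_one, true_and]
      have : b * (x / b) + j ≠ x ↔ j ≠ i := by
        rw [not_iff_not, Fin.ext_iff]
        conv_lhs => rhs; rw [hx]
        omega
      simp only [this]
      split_ifs with h
      · rw [rate_siblings lam (this.2 h).symm (by rw [mul_add_div_fin])]
      · rfl
    rw [Finset.sum_congr rfl fun j _ => this j, ← Finset.sum_filter, Finset.sum_const]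
    rw [Finset.filter_ne' , Finset.card_erase_of_mem (Finset.mem_univ _), Finset.card_univ,
      Fintype.card_fin, nsmul_eq_mul]
    push_cast
    rfl
  · intro v hv
    refine Finset.sum_eq_zero fun j _ => if_neg ?_
    rw [pow_one, mul_add_div_fin]
    exact fun h => hv h.1

theorem annulusRate_add {n m N : ℕ} (hnm : n ≤ m) (hmN : m ≤ N) (lam : ℝ≥0) (x : ℕ) :
    annulusRate b lam n N x = annulusRate b lam n m x + annulusRate b lam m N x := by
  have key : ∀ {k l y : ℕ}, k ≤ l → y / b ^ k = x / b ^ k → y / b ^ l = x / b ^ l := by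
    intro k l y hkl h
    obtain ⟨d, rfl⟩ := Nat.exists_eq_add_of_le hkl
    rw [pow_add, ← Nat.div_div_eq_div_mul, ← Nat.div_div_eq_div_mul, h]
  rw [annulusRate, annulusRate, annulusRate, ← ENNReal.tsum_add]
  refine tsum_congr fun y => ?_
  have h1 := @key n m y hnm
  have h2 := @key m N y hmN
  by_cases p : y / b ^ n = x / b ^ n <;> by_cases q : y / b ^ m = x / b ^ m <;>
    by_cases r : y / b ^ N = x / b ^ N <;> simp_all

theorem annulusRate_self (lam : ℝ≥0) (n x : ℕ) : annulusRate b lam n n x = 0 := by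
  rw [annulusRate]
  simp

/-- A telescoping sum: the annulus between levels `m` and `m + 1` has rate `(b - 1) * lam / b ^ (m +
1)`, which is `lam / b ^ m - lam / b ^ (m + 1)`. The additive form avoids truncated subtraction. -/
theorem annulusRate_eq (hb : 2 ≤ b) (lam : ℝ≥0) {n N : ℕ} (hnN : n ≤ N) (x : ℕ) :
    annulusRate b lam n N x + (lam / b ^ N : ℝ≥0) = (lam / b ^ n : ℝ≥0) := by
  have hb0 : (b : ℝ≥0) ≠ 0 := by positivity
  have step : ∀ n x, annulusRate b lam n (n + 1) x =
      ((b - 1 : ℕ) * (lam / b ^ (n + 1)) : ℝ≥0) := by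
    intro n
    induction n with
    | zero => intro x; rw [annulusRate_zero_one hb, zero_add, pow_one]
    | succ n ih =>
      intro x
      rw [annulusRate_succ_succ hb, ih, ← ENNReal.coe_natCast b, ← ENNReal.coe_div hb0]
      congr 1
      field_simp
      ring
  induction N, hnN using Nat.le_induction with
  | base => rw [annulusRate_self, zero_add]
  | succ N hN ih =>
    rw [annulusRate_add hN (Nat.le_succ N), ← ih, add_assoc, step, ← ENNReal.coe_add]
    congr 2
    have : (b : ℝ≥0) = (b - 1 : ℕ) + 1 := by
      rw [← Nat.cast_add_one, Nat.sub_add_cancel (by omega)]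
    rw [eq_div_iff (by positivity), add_mul, pow_succ]
    conv_rhs => rw [← mul_one lam]
    field_simp
    rw [← this]

theorem annulusRate_le (hb : 2 ≤ b) (lam : ℝ≥0) (n N x : ℕ) :
    annulusRate b lam n N x ≤ (lam / b ^ n : ℝ≥0) := by
  rcases le_total n N with h | h
  · rw [← annulusRate_eq hb lam h x]
    exact le_self_add
  · rw [annulusRate]
    refine (ENNReal.tsum_eq_zero.2 fun y => if_neg ?_).trans_le zero_le
    rintro ⟨h1, h2⟩
    obtain ⟨d, rfl⟩ := Nat.exists_eq_add_of_le h
    exact h2 (by rw [pow_add, ← Nat.div_div_eq_div_mul, ← Nat.div_div_eq_div_mul, h1])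

theorem tsum_rate (hb : 2 ≤ b) (lam : ℝ≥0) (x : ℕ) :
    ∑' y, (if y ≠ x then (rate b lam x y : ℝ≥0∞) else 0) ≤ lam := by
  rw [ENNReal.tsum_eq_iSup_sum]
  refine iSup_le fun s => ?_
  -- A finite set of leaves lies with `x` in one block, so each finite partial sum is part of an
  -- annulus.
  obtain ⟨N, hN⟩ : ∃ N, ∀ y ∈ s, y / b ^ N = x / b ^ N := by
    induction s using Finset.induction with
    | empty => simp
    | insert a s _ ih =>
      obtain ⟨N, hN⟩ := ih
      obtain ⟨k, hk⟩ := exists_common_ancestor hb a x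
      refine ⟨N + k, fun y hy => ?_⟩
      rcases Finset.mem_insert.1 hy with rfl | hy
      · rw [add_comm, pow_add, ← Nat.div_div_eq_div_mul, hk, Nat.div_div_eq_div_mul]
      · rw [pow_add, ← Nat.div_div_eq_div_mul, hN y hy, Nat.div_div_eq_div_mul]
  calc _ ≤ ∑ y ∈ s, if y / b ^ N = x / b ^ N ∧ y / b ^ 0 ≠ x / b ^ 0 then
        (rate b lam x y : ℝ≥0∞) else 0 := by
        refine Finset.sum_le_sum fun y hy => ?_
        simp [hN y hy]
    _ ≤ annulusRate b lam 0 N x := ENNReal.sum_le_tsum _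
    _ ≤ _ := by simpa using annulusRate_le hb lam 0 N x

end Sums

/-! ### Automorphisms of the hierarchy -/

/-- A permutation of the leaves that preserves blocks of all sizes. -/
def PreservesBlocks (b : ℕ) (σ : Equiv.Perm ℕ) : Prop :=
  ∀ n x y, σ x / b ^ n = σ y / b ^ n ↔ x / b ^ n = y / b ^ n

theorem PreservesBlocks.rate_eq {b : ℕ} {σ : Equiv.Perm ℕ} (h : PreservesBlocks b σ)
    (lam : ℝ≥0) (hb : 2 ≤ b) (x y : ℕ) : rate b lam (σ x) (σ y) = rate b lam x y := by
  classical
  have hex := exists_common_ancestor hb x y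
  rw [rate, rate, canopyTree_dist (Nat.find_spec hex) fun j hj => Nat.find_min hex hj,
    canopyTree_dist ((h _ _ _).2 (Nat.find_spec hex)) fun j hj => (h _ _ _).not.2 (Nat.find_min hex hj)]

/-- Transitivity on the leaves, by recursion on base `b` digits: a permutation of the parents that
moves `0` to `v / b` is combined with the swap of the residues `0` and `v % b` in every sibling
family. -/
theorem exists_preservesBlocks {b : ℕ} [NeZero b] (hb : 2 ≤ b) (v : ℕ) :
    ∃ σ : Equiv.Perm ℕ, PreservesBlocks b σ ∧ σ 0 = v := by
  induction v using Nat.strong_induction_on with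
  | _ v ih =>
    obtain ⟨τ, hτ, hτ0⟩ : ∃ τ : Equiv.Perm ℕ, PreservesBlocks b τ ∧ τ 0 = v / b := by
      -- For `v = 0` the recursion would not descend, since `0 / b = 0`.
      rcases Nat.eq_zero_or_pos v with rfl | hv
      · exact ⟨1, fun n x y => Iff.rfl, by simp⟩
      · exact ih _ (Nat.div_lt_self hv (by omega))
    let i : Fin b := ⟨v % b, Nat.mod_lt _ (by omega)⟩
    let σ : Equiv.Perm ℕ := (Nat.divModEquiv b).trans
      ((Equiv.prodCongr τ (Equiv.swap 0 i)).trans (Nat.divModEquiv b).symm)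
    have hσ : ∀ x, σ x = b * τ (x / b) + (Equiv.swap 0 i (Fin.ofNat b x)) := by
      intro x
      simp [σ, Nat.divModEquiv, mul_comm]
    refine ⟨σ, ?_, ?_⟩
    · intro n x y
      cases n with
      | zero => simp
      | succ n =>
        rw [div_pow_succ, div_pow_succ, div_pow_succ, div_pow_succ, hσ, hσ, mul_add_div_fin,
          mul_add_div_fin]
        exact hτ n _ _
    · rw [hσ]
      simp only [Nat.zero_div, hτ0]
      have : Fin.ofNat b 0 = 0 := rfl
      rw [this, Equiv.swap_apply_left]
      exact Nat.div_add_mod v b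

/-! ### Independence in infinite product measures -/

section InfinitePi

variable {ι : Type*} {Ω : ι → Type*} [∀ i, MeasurableSpace (Ω i)] (P : ∀ i, Measure (Ω i))
  [∀ i, IsProbabilityMeasure (P i)]

theorem indepFun_domRestrict {S T : Set ι} (h : Disjoint S T) :
    IndepFun (S.domRestrict (π := Ω)) (T.domRestrict (π := Ω)) (Measure.infinitePi P) := by
  have hi : iIndepFun (fun i (ω : ∀ i, Ω i) => ω i) (Measure.infinitePi P) :=
    iIndepFun_infinitePi (X := fun i x => x) (fun i => measurable_id)
  have := indep_iSup_of_disjoint (fun i => (measurable_pi_apply i).comap_le) hi.iIndep h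
  rw [IndepFun_iff_Indep]
  have key : ∀ U : Set ι, MeasurableSpace.comap (U.domRestrict (π := Ω)) MeasurableSpace.pi
      ≤ ⨆ i ∈ U, MeasurableSpace.comap (fun ω : ∀ i, Ω i => ω i) inferInstance := by
    intro U
    rw [MeasurableSpace.pi, MeasurableSpace.comap_iSup]
    refine iSup_le fun i => ?_
    rw [MeasurableSpace.comap_comp]
    exact le_iSup₂_of_le i.1 i.2 le_rfl
  exact indep_of_indep_of_le_left (indep_of_indep_of_le_right this (key T)) (key S)

theorem exists_eq_comp_domRestrict {β : Type*} [MeasurableSpace β] {f : (∀ i, Ω i) → β}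
    (hf : Measurable f) {S : Set ι} (hS : DependsOn f S) [hΩ : ∀ i, Nonempty (Ω i)] :
    ∃ F : (∀ i : S, Ω i) → β, Measurable F ∧ f = F ∘ S.domRestrict := by
  classical
  refine ⟨fun z => f fun i => if h : i ∈ S then z ⟨i, h⟩ else (hΩ i).some, ?_, ?_⟩
  · refine hf.comp (measurable_pi_lambda _ fun i => ?_)
    by_cases h : i ∈ S
    · simp only [h, dif_pos]
      fun_prop
    · simp [h]
  · ext ω
    refine hS fun i hi => ?_
    simp [hi]

theorem indepFun_of_dependsOn {β γ : Type*} [MeasurableSpace β] [MeasurableSpace γ]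
    {f : (∀ i, Ω i) → β} {g : (∀ i, Ω i) → γ} (hf : Measurable f) (hg : Measurable g)
    {S T : Set ι} (hS : DependsOn f S) (hT : DependsOn g T) (h : Disjoint S T) :
    IndepFun f g (Measure.infinitePi P) := by
  have hΩ : ∀ i, Nonempty (Ω i) := fun i => (P i).nonempty_of_neZero
  obtain ⟨F, hF, rfl⟩ := exists_eq_comp_domRestrict hf hS
  obtain ⟨G, hG, rfl⟩ := exists_eq_comp_domRestrict hg hT
  exact (indepFun_domRestrict P h).comp hF hG

theorem lintegral_mul_of_dependsOn {f g : (∀ i, Ω i) → ℝ≥0∞} (hf : Measurable f)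
    (hg : Measurable g) {S T : Set ι} (hS : DependsOn f S) (hT : DependsOn g T)
    (h : Disjoint S T) : ∫⁻ ω, f ω * g ω ∂Measure.infinitePi P =
      (∫⁻ ω, f ω ∂Measure.infinitePi P) * ∫⁻ ω, g ω ∂Measure.infinitePi P :=
  lintegral_mul_eq_lintegral_mul_lintegral_of_indepFun hf hg
    (indepFun_of_dependsOn P hf hg hS hT h)

theorem measure_inter_of_dependsOn {A B : Set (∀ i, Ω i)} (hA : MeasurableSet A)
    (hB : MeasurableSet B) {S T : Set ι} (hS : DependsOn (· ∈ A) S) (hT : DependsOn (· ∈ B) T)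
    (h : Disjoint S T) : Measure.infinitePi P (A ∩ B) =
      Measure.infinitePi P A * Measure.infinitePi P B := by
  have := (indepFun_of_dependsOn P (measurable_mem.2 hA) (measurable_mem.2 hB) hS hT
    h).measure_inter_preimage_eq_mul {True} {True} (by measurability) (by measurability)
  simpa [Set.preimage] using this

end InfinitePi

/-! ### Subgraphs with edges restricted by a relation -/

/-- The pairs that satisfy a relation. -/
def pairs (q : ℕ → ℕ → Prop) : Set (VPair ℕ) := {e | ∀ u v, e.1 = s(u, v) → q u v}

theorem mk_mem_pairs {q : ℕ → ℕ → Prop} (hq : ∀ u v, q u v → q v u) {u v : ℕ} (h) :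
    (⟨s(u, v), h⟩ : VPair ℕ) ∈ pairs q ↔ q u v := by
  constructor
  · intro hm
    exact hm u v rfl
  · intro huv x y hxy
    rcases Sym2.eq_iff.1 hxy with ⟨rfl, rfl⟩ | ⟨rfl, rfl⟩
    exacts [huv, hq _ _ huv]

theorem disjoint_pairs {q q' : ℕ → ℕ → Prop} (h : ∀ u v, q u v → ¬ q' u v) :
    Disjoint (pairs q) (pairs q') := by
  rw [Set.disjoint_left]
  rintro ⟨⟨u, v⟩, he⟩ h1 h2
  exact h u v (h1 u v rfl) (h2 u v rfl)

theorem mult_congr {G G' : MGraph ℕ} {q : ℕ → ℕ → Prop} (hq : ∀ u v, q u v → q v u)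
    (h : ∀ e ∈ pairs q, G e = G' e) {u v : ℕ} (huv : q u v) : mult G u v = mult G' u v := by
  by_cases e : u = v
  · simp [e]
  · rw [mult_of_ne _ e, mult_of_ne _ e]
    exact h _ ((mk_mem_pairs hq _).2 huv)

/-- Connection by edges that satisfy a relation. -/
def Conn (q : ℕ → ℕ → Prop) (G : MGraph ℕ) : ℕ → ℕ → Prop :=
  Relation.ReflTransGen fun x y => q x y ∧ mult G x y ≠ 0

theorem measurableSet_conn (q : ℕ → ℕ → Prop) (u v : ℕ) :
    MeasurableSet {G : MGraph ℕ | Conn q G u v} := by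
  refine measurableSet_reflTransGen (fun (G : MGraph ℕ) x y => q x y ∧ mult G x y ≠ 0)
    (fun x y => ?_) u v
  exact (MeasurableSet.const _).inter
    ((measurable_mult x y) (.of_discrete : MeasurableSet {n : ℕ | n ≠ 0}))

theorem Conn.mono {q q' : ℕ → ℕ → Prop} (h : ∀ u v, q u v → q' u v) {G : MGraph ℕ} {u v : ℕ}
    (huv : Conn q G u v) : Conn q' G u v :=
  Relation.ReflTransGen.mono (fun x y hxy => ⟨h x y hxy.1, hxy.2⟩) _ _ huv

theorem conn_congr {q : ℕ → ℕ → Prop} (hq : ∀ u v, q u v → q v u) {G G' : MGraph ℕ}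
    (h : ∀ e ∈ pairs q, G e = G' e) (u v : ℕ) : Conn q G u v ↔ Conn q G' u v := by
  have : (fun x y => q x y ∧ mult G x y ≠ 0) = fun x y => q x y ∧ mult G' x y ≠ 0 := by
    ext x y
    exact and_congr_right fun hxy => by rw [mult_congr hq h hxy]
  rw [Conn, Conn, this]

/-- The cluster of `x` in the graph with edges restricted by a relation. -/
def connSet (q : ℕ → ℕ → Prop) (G : MGraph ℕ) (x : ℕ) : Set ℕ := {y | Conn q G x y}

theorem measurable_card_connSet (q : ℕ → ℕ → Prop) (x : ℕ) :
    Measurable fun G : MGraph ℕ => ((connSet q G x).encard : ℝ≥0∞) := by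
  simp only [encard_eq_tsum]
  refine Measurable.tsum fun v => ?_
  exact (measurable_const (a := (1 : ℝ≥0∞))).indicator (measurableSet_conn q x v)

/-! ### The law of the edges -/

/-- The law of the Poisson edge model without the root. -/
def edgeMeasure (b : ℕ) (lam : ℝ≥0) : Measure (MGraph ℕ) :=
  Measure.infinitePi fun e : VPair ℕ => poissonMeasure (edgeRate b lam e)

instance (b : ℕ) (lam : ℝ≥0) : IsProbabilityMeasure (edgeMeasure b lam) := by
  unfold edgeMeasure; infer_instance

theorem edgeMeasure_forall_eq_zero (b : ℕ) (lam : ℝ≥0) (S : Finset (VPair ℕ)) :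
    edgeMeasure b lam {G | ∀ e ∈ S, G e = 0} =
      ENNReal.ofReal (Real.exp (-(∑ e ∈ S, edgeRate b lam e : ℝ≥0))) := by
  have : {G : MGraph ℕ | ∀ e ∈ S, G e = 0} = Set.pi S (fun _ => {0}) := by
    ext G; simp [Set.mem_pi]
  rw [this, edgeMeasure, Measure.infinitePi_pi _ (fun _ _ => measurableSet_singleton _)]
  simp only [poissonMeasure_singleton, pow_zero, Nat.factorial_zero, Nat.cast_one, div_one, mul_one]
  rw [← ENNReal.ofReal_prod_of_nonneg (fun _ _ => (Real.exp_pos _).le), ← Real.exp_sum]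
  push_cast
  rw [Finset.sum_neg_distrib]

theorem edgeMeasure_no_edges (b : ℕ) (lam : ℝ≥0) {A B : Finset ℕ} (h : Disjoint A B) :
    edgeMeasure b lam {G | ∀ x ∈ A, ∀ y ∈ B, mult G x y = 0} =
      ENNReal.ofReal (Real.exp (-(∑ x ∈ A, ∑ y ∈ B, rate b lam x y : ℝ≥0))) := by
  classical
  have hne : ∀ p ∈ A ×ˢ B, p.1 ≠ p.2 := by
    intro p hp e
    rw [Finset.mem_product] at hp
    exact Finset.disjoint_left.1 h hp.1 (e ▸ hp.2)
  -- Disjointness of `A` and `B` makes the passage from ordered to unordered pairs injective.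
  let S : Finset (VPair ℕ) := (A ×ˢ B).attach.map
    ⟨fun p => ⟨s(p.1.1, p.1.2), by simpa using hne p.1 p.2⟩, by
      rintro ⟨⟨x, y⟩, hp⟩ ⟨⟨x', y'⟩, hp'⟩ e
      rw [Finset.mem_product] at hp hp'
      rcases Sym2.eq_iff.1 (congrArg Subtype.val e) with ⟨h1, h2⟩ | ⟨h1, h2⟩
      · simp only at h1 h2
        subst h1 h2
        rfl
      · simp only at h1 h2
        subst h1 h2
        exact absurd hp'.2 (Finset.disjoint_left.1 h hp.1)⟩
  have hS : {G : MGraph ℕ | ∀ x ∈ A, ∀ y ∈ B, mult G x y = 0} = {G | ∀ e ∈ S, G e = 0} := by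
    ext G
    simp only [S, Set.mem_ofPred_eq, Finset.mem_map, Finset.mem_attach, true_and,
      forall_exists_index]
    constructor
    · rintro hG _ ⟨⟨x, y⟩, hp⟩ rfl
      rw [Finset.mem_product] at hp
      have := hG x hp.1 y hp.2
      rwa [mult_of_ne _ (hne (x, y) (Finset.mem_product.2 hp))] at this
    · intro hG x hx y hy
      have hp : (x, y) ∈ A ×ˢ B := Finset.mem_product.2 ⟨hx, hy⟩
      rw [mult_of_ne _ (hne _ hp)]
      exact hG _ ⟨(x, y), hp⟩ rfl
  rw [hS, edgeMeasure_forall_eq_zero, Finset.sum_map, ← Finset.sum_product']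
  rw [← Finset.sum_attach (A ×ˢ B)]
  rfl

theorem edgeMeasure_mult_ne_zero_le (b : ℕ) (lam : ℝ≥0) {x y : ℕ} (h : x ≠ y) :
    edgeMeasure b lam {G | mult G x y ≠ 0} ≤ rate b lam x y := by
  have h0 : edgeMeasure b lam {G | mult G x y = 0} =
      ENNReal.ofReal (Real.exp (-(rate b lam x y))) := by
    have := edgeMeasure_no_edges b lam (A := {x}) (B := {y}) (by simpa using h)
    simpa using this
  have hm : MeasurableSet {G : MGraph ℕ | mult G x y = 0} :=
    measurable_mult x y (measurableSet_singleton 0)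
  have : {G : MGraph ℕ | mult G x y ≠ 0} = {G | mult G x y = 0}ᶜ := rfl
  rw [this, prob_compl_eq_one_sub hm, h0, ← ENNReal.ofReal_one,
    ← ENNReal.ofReal_sub _ (Real.exp_pos _).le]
  refine (ENNReal.ofReal_le_ofReal ?_).trans ENNReal.ofReal_coe_nnreal.le
  have := Real.add_one_le_exp (-(rate b lam x y : ℝ))
  linarith

/-! ### Relabelling by automorphisms of the hierarchy -/

/-- The action of a permutation on pairs. -/
def permPair (σ : Equiv.Perm ℕ) (e : VPair ℕ) : VPair ℕ :=
  ⟨e.1.map σ, by rw [Sym2.isDiag_map σ.injective]; exact e.2⟩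

theorem permPair_injective (σ : Equiv.Perm ℕ) : Function.Injective (permPair σ) := fun _ _ h =>
  Subtype.ext (Sym2.map.injective σ.injective (congrArg Subtype.val h))

/-- The multigraph `G` with vertex names changed by `σ`. -/
def relabel (σ : Equiv.Perm ℕ) (G : MGraph ℕ) : MGraph ℕ := fun e => G (permPair σ e)

theorem mult_relabel (σ : Equiv.Perm ℕ) (G : MGraph ℕ) (x y : ℕ) :
    mult (relabel σ G) x y = mult G (σ x) (σ y) := by
  by_cases h : x = y
  · simp [h]
  · rw [mult_of_ne _ h, mult_of_ne _ (σ.injective.ne h)]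
    rfl

theorem measurable_relabel (σ : Equiv.Perm ℕ) : Measurable (relabel σ) :=
  measurable_pi_lambda _ fun _ => measurable_pi_apply _

theorem map_relabel {b : ℕ} (hb : 2 ≤ b) (lam : ℝ≥0) {σ : Equiv.Perm ℕ}
    (hσ : PreservesBlocks b σ) : (edgeMeasure b lam).map (relabel σ) = edgeMeasure b lam := by
  have := Measure.map_infinitePi_infinitePi_of_inj
    (P := fun e : VPair ℕ => poissonMeasure (edgeRate b lam e)) (permPair_injective σ)
  have hrate : ∀ e, edgeRate b lam (permPair σ e) = edgeRate b lam e := by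
    rintro ⟨⟨x, y⟩, he⟩
    exact hσ.rate_eq lam hb x y
  simp only [hrate] at this
  exact this

/-- Two leaves lie in the same block of size `b ^ n`. -/
abbrev SameBlock (b n : ℕ) (x y : ℕ) : Prop := x / b ^ n = y / b ^ n

theorem SameBlock.mono {b n m x y : ℕ} (h : SameBlock b n x y) (hnm : n ≤ m) :
    SameBlock b m x y := by
  obtain ⟨d, rfl⟩ := Nat.exists_eq_add_of_le hnm
  unfold SameBlock at *
  rw [pow_add, ← Nat.div_div_eq_div_mul, ← Nat.div_div_eq_div_mul, h]

theorem Conn.sameBlock {b n : ℕ} {G : MGraph ℕ} {x y : ℕ} (h : Conn (SameBlock b n) G x y) :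
    SameBlock b n x y := by
  induction h with
  | refl => rfl
  | tail _ h ih => exact ih.trans h.1

theorem conn_relabel {q : ℕ → ℕ → Prop} {σ : Equiv.Perm ℕ} (hσ : ∀ x y, q (σ x) (σ y) ↔ q x y)
    (G : MGraph ℕ) (x y : ℕ) : Conn q (relabel σ G) x y ↔ Conn q G (σ x) (σ y) := by
  constructor
  · intro h
    refine Relation.ReflTransGen.lift σ (fun u v huv => ?_) _ _ h
    rw [mult_relabel] at huv
    exact ⟨(hσ u v).2 huv.1, huv.2⟩
  · intro h
    have := Relation.ReflTransGen.lift (p := fun u v => q u v ∧ mult (relabel σ G) u v ≠ 0)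
      σ.symm (fun u v huv => ?_) _ _ h
    · simpa [Function.onFun, Conn] using this
    · rw [Function.onFun, mult_relabel, ← hσ]
      simpa using huv

/-- The mean size of the cluster of the origin in the Poisson edge model restricted to a block of
size `b ^ N`. -/
def blockMean (b : ℕ) (lam : ℝ≥0) (N : ℕ) : ℝ≥0∞ :=
  ∫⁻ G, ((connSet (SameBlock b N) G 0).encard : ℝ≥0∞) ∂edgeMeasure b lam

/-- By transitivity, the mean does not depend on the leaf or on the block. -/
theorem lintegral_connSet {b : ℕ} [NeZero b] (hb : 2 ≤ b) (lam : ℝ≥0) (N v : ℕ) :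
    ∫⁻ G, ((connSet (SameBlock b N) G v).encard : ℝ≥0∞) ∂edgeMeasure b lam = blockMean b lam N := by
  obtain ⟨σ, hσ, rfl⟩ := exists_preservesBlocks hb v
  rw [blockMean]
  conv_rhs => rw [← map_relabel hb lam hσ]
  rw [lintegral_map (measurable_card_connSet _ _) (measurable_relabel σ)]
  refine lintegral_congr fun G => ?_
  congr 1
  have : connSet (SameBlock b N) (relabel σ G) 0 = σ ⁻¹' connSet (SameBlock b N) G (σ 0) := by
    ext y
    exact conn_relabel (fun x y => hσ N x y) G 0 y
  rw [this, Set.encard_preimage_of_bijective σ.bijective]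

/-! ### Size bounds in finite blocks -/

theorem encard_coe_mono {S T : Set ℕ} (h : S ⊆ T) : (S.encard : ℝ≥0∞) ≤ T.encard :=
  ENat.toENNReal_le.2 (Set.encard_le_encard h)

theorem connSet_subset_range {b : ℕ} [NeZero b] {n : ℕ} {G : MGraph ℕ} :
    connSet (SameBlock b n) G 0 ⊆ Finset.range (b ^ n) := by
  intro y hy
  have := (Conn.sameBlock hy).symm
  rw [Nat.zero_div, Nat.div_eq_zero_iff] at this
  have hpos : 0 < b ^ n := Nat.pow_pos (Nat.pos_of_neZero b)
  simp only [Finset.coe_range, Set.mem_Iio]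
  omega

theorem encard_connSet_le {b : ℕ} [NeZero b] (n : ℕ) (G : MGraph ℕ) :
    ((connSet (SameBlock b n) G 0).encard : ℝ≥0∞) ≤ (b : ℝ≥0∞) ^ n := by
  have := Set.encard_le_encard (connSet_subset_range (b := b) (n := n) (G := G))
  rw [Set.encard_coe_eq_coe_finsetCard, Finset.card_range] at this
  calc _ ≤ (((b ^ n : ℕ) : ℕ∞) : ℝ≥0∞) := by exact_mod_cast this
    _ = _ := by simp

theorem blockMean_le_pow {b : ℕ} [NeZero b] (lam : ℝ≥0) (N : ℕ) :
    blockMean b lam N ≤ (b : ℝ≥0∞) ^ N := by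
  calc _ ≤ ∫⁻ _, (b : ℝ≥0∞) ^ N ∂edgeMeasure b lam := lintegral_mono fun G => encard_connSet_le N G
    _ = _ := by simp

/-- A path has finitely many edges, so it lies within some block; the clusters in the growing blocks
of the origin exhaust the full cluster. -/
theorem iSup_encard_connSet {b : ℕ} (hb : 2 ≤ b) (G : MGraph ℕ) :
    ((cluster (G, 0)).encard : ℝ≥0∞) = ⨆ N, ((connSet (SameBlock b N) G 0).encard : ℝ≥0∞) := by
  have hmono : ∀ v, Monotone fun N => (connSet (SameBlock b N) G 0).indicator (1 : ℕ → ℝ≥0∞) v :=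
    fun v N M hNM => Set.indicator_le_indicator_of_subset
      (fun y hy => Conn.mono (fun _ _ h => SameBlock.mono h hNM) hy) (fun _ => zero_le) v
  have hex : ∀ v, v ∈ cluster (G, 0) ↔ ∃ N, v ∈ connSet (SameBlock b N) G 0 := by
    intro v
    constructor
    · intro hv
      have hv' := (reachable_iff _ _ _).1 hv
      clear hv
      induction hv' with
      | refl => exact ⟨0, Relation.ReflTransGen.refl⟩
      | @tail y z _ h ih =>
        obtain ⟨N, hN⟩ := ih
        obtain ⟨k, hk⟩ := exists_common_ancestor hb y z
        exact ⟨N + k, (Conn.mono (fun _ _ h => SameBlock.mono h (Nat.le_add_right N k)) hN).tail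
          ⟨SameBlock.mono hk (Nat.le_add_left k N), h⟩⟩
    · rintro ⟨N, hN⟩
      exact (reachable_iff _ _ _).2 (Relation.ReflTransGen.mono (fun _ _ h => h.2) _ _ hN)
  simp only [encard_eq_tsum]
  -- Cardinalities become integrals for the counting measure, so that monotone convergence applies.
  simp only [← lintegral_count]
  rw [← lintegral_iSup (fun _ => .of_discrete) fun N M hNM v => hmono v hNM]
  simp only [lintegral_count]
  refine tsum_congr fun v => ?_
  by_cases hv : v ∈ cluster (G, 0)
  · rw [Set.indicator_of_mem hv]
    obtain ⟨N, hN⟩ := (hex v).1 hv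
    refine le_antisymm (le_iSup_of_le N (by rw [Set.indicator_of_mem hN])) (iSup_le fun M => ?_)
    exact Set.indicator_le_self' (fun _ _ => zero_le) v
  · rw [Set.indicator_of_notMem hv]
    refine (ENNReal.iSup_eq_zero.2 fun N => Set.indicator_of_notMem (fun h => hv ?_) _).symm
    exact (hex v).2 ⟨N, h⟩

theorem meanSize_edgeModel {b : ℕ} (hb : 2 ≤ b) (lam : ℝ≥0) :
    meanSize (edgeModel b lam) = ⨆ N, blockMean b lam N := by
  rw [meanSize, edgeModel, lintegral_map measurable_card_cluster (by fun_prop)]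
  simp only [iSup_encard_connSet hb]
  rw [lintegral_iSup (fun N => measurable_card_connSet _ _)]
  · rfl
  · intro N M hNM G
    have : connSet (SameBlock b N) G 0 ⊆ connSet (SameBlock b M) G 0 :=
      fun y hy => Conn.mono (fun _ _ h => SameBlock.mono h hNM) hy
    exact encard_coe_mono this

/-! ### The branching inequality -/

/-- Exploring the cluster of `x` from its subcluster `connSet q' G x`. -/
theorem exists_exit_edge {q q' : ℕ → ℕ → Prop} {G : MGraph ℕ} {x y : ℕ}
    (h : Conn q G x y) (hy : y ∉ connSet q' G x) :
    ∃ u ∈ connSet q' G x, ∃ v, (q u v ∧ ¬ q' u v) ∧ mult G u v ≠ 0 ∧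
      Conn (fun a c => q a c ∧ a ∉ connSet q' G x ∧ c ∉ connSet q' G x) G v y := by
  induction h with
  | refl => exact absurd Relation.ReflTransGen.refl hy
  | @tail y z hxy hyz ih =>
    -- The last exit of the path is selected, so that the remaining path avoids the subcluster.
    by_cases h : y ∈ connSet q' G x
    · exact ⟨y, h, z, ⟨hyz.1, fun h' => hy (h.tail ⟨h', hyz.2⟩)⟩, hyz.2, Relation.ReflTransGen.refl⟩
    · obtain ⟨u, hu, v, h1, h2, h3⟩ := ih h
      exact ⟨u, hu, v, h1, h2, h3.tail ⟨⟨hyz.1, h, hy⟩, hyz.2⟩⟩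

theorem connSet_eq_congr {q : ℕ → ℕ → Prop} (hq : ∀ u v, q u v → q v u) {G G' : MGraph ℕ}
    {S : Set ℕ} {x : ℕ}
    (h : ∀ e ∈ pairs (fun u v => q u v ∧ (u ∈ S ∨ v ∈ S)), G e = G' e)
    (hG : connSet q G x = S) : connSet q G' x = S := by
  have hq' : ∀ u v, q u v ∧ (u ∈ S ∨ v ∈ S) → q v u ∧ (v ∈ S ∨ u ∈ S) :=
    fun u v huv => ⟨hq u v huv.1, huv.2.symm⟩
  apply Set.Subset.antisymm
  · intro y hy
    induction hy with
    | refl => rw [← hG]; exact Relation.ReflTransGen.refl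
    | @tail y z _ hyz ih =>
      rw [← mult_congr hq' h ⟨hyz.1, Or.inl ih⟩] at hyz
      rw [← hG] at ih ⊢
      exact Relation.ReflTransGen.tail ih hyz
  · intro y hy
    rw [← hG] at hy
    induction hy with
    | refl => exact Relation.ReflTransGen.refl
    | @tail y z hxy hyz ih =>
      have hy : y ∈ S := hG ▸ hxy
      rw [mult_congr hq' h ⟨hyz.1, Or.inl hy⟩] at hyz
      exact ih.tail hyz

/-- Whether the cluster is `S` can be decided from the edges that touch `S`. All other edges remain
fresh, which is what makes the exploration Markovian. -/
theorem dependsOn_connSet_eq {q : ℕ → ℕ → Prop} (hq : ∀ u v, q u v → q v u) (S : Set ℕ) (x : ℕ) :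
    DependsOn (fun G : MGraph ℕ => connSet q G x = S)
      (pairs (fun u v => q u v ∧ (u ∈ S ∨ v ∈ S))) := fun _ _ h =>
  propext ⟨connSet_eq_congr hq h, connSet_eq_congr hq fun e he => (h e he).symm⟩

theorem measurableSet_connSet_eq (q : ℕ → ℕ → Prop) (S : Set ℕ) (x : ℕ) :
    MeasurableSet {G : MGraph ℕ | connSet q G x = S} := by
  have : {G : MGraph ℕ | connSet q G x = S} = ⋂ y, {G | Conn q G x y ↔ y ∈ S} := by
    ext G
    simp [Set.ext_iff, connSet]
  rw [this]
  refine MeasurableSet.iInter fun y => ?_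
  by_cases hy : y ∈ S
  · simpa [hy] using measurableSet_conn q x y
  · simp only [hy, iff_false]
    exact (measurableSet_conn q x y).compl

theorem encard_iUnion_le {ι : Type*} (T : ι → Set ℕ) :
    ((⋃ i, T i).encard : ℝ≥0∞) ≤ ∑' i, ((T i).encard : ℝ≥0∞) := by
  simp only [encard_eq_tsum]
  rw [ENNReal.tsum_comm]
  refine ENNReal.tsum_le_tsum fun v => ?_
  by_cases h : v ∈ ⋃ i, T i
  · obtain ⟨i, hi⟩ := Set.mem_iUnion.1 h
    rw [Set.indicator_of_mem h]
    calc _ = (T i).indicator (1 : ℕ → ℝ≥0∞) v := by rw [Set.indicator_of_mem hi]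
      _ ≤ _ := ENNReal.le_tsum i
  · rw [Set.indicator_of_notMem h]
    exact zero_le

-- A vertex outside `S` is reached through a last exit edge followed by a path that avoids `S`.
-- Hence `S` and the clusters hanging at the far ends of the exit edges cover everything.
open Classical in
theorem encard_connSet_le_exit (b n N : ℕ) (G : MGraph ℕ) {S : Finset ℕ}
    (hS : connSet (SameBlock b n) G 0 = S) :
    ((connSet (SameBlock b N) G 0).encard : ℝ≥0∞) ≤ S.card + ∑ u ∈ S, ∑' v,
      if SameBlock b N v u ∧ ¬ SameBlock b n v u then
        (if mult G u v ≠ 0 then 1 else 0) *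
          ((connSet (fun a c => SameBlock b N a c ∧ a ∉ S ∧ c ∉ S) G v).encard : ℝ≥0∞)
      else 0 := by
  let T : ℕ → ℕ → Set ℕ := fun u v =>
    if (SameBlock b N v u ∧ ¬ SameBlock b n v u) ∧ mult G u v ≠ 0 then
      connSet (fun a c => SameBlock b N a c ∧ a ∉ S ∧ c ∉ S) G v else ∅
  have hsub : connSet (SameBlock b N) G 0 ⊆ ↑S ∪ ⋃ u : S, ⋃ v, T u v := by
    intro y hy
    by_cases hyS : y ∈ S
    · exact Or.inl hyS
    · obtain ⟨u, hu, v, h1, h2, h3⟩ := exists_exit_edge hy (q' := SameBlock b n)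
        (by rw [hS]; exact hyS)
      rw [hS] at hu
      refine Or.inr (Set.mem_iUnion.2 ⟨⟨u, hu⟩, Set.mem_iUnion.2 ⟨v, ?_⟩⟩)
      have : (SameBlock b N v u ∧ ¬ SameBlock b n v u) ∧ mult G u v ≠ 0 :=
        ⟨⟨h1.1.symm, fun h => h1.2 h.symm⟩, h2⟩
      simp only [T, if_pos this]
      simp only [hS, Finset.mem_coe] at h3
      exact h3
  calc _ ≤ ((↑S ∪ ⋃ u : S, ⋃ v, T u v : Set ℕ).encard : ℝ≥0∞) := encard_coe_mono hsub
    _ ≤ (((S : Set ℕ).encard + (⋃ u : S, ⋃ v, T u v).encard : ℕ∞) : ℝ≥0∞) :=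
        ENat.toENNReal_le.2 (Set.encard_union_le _ _)
    _ = S.card + ((⋃ u : S, ⋃ v, T u v).encard : ℝ≥0∞) := by
        rw [ENat.toENNReal_add, Set.encard_coe_eq_coe_finsetCard]
        rfl
    _ ≤ S.card + ∑' u : S, ∑' v, ((T u v).encard : ℝ≥0∞) := by
        gcongr
        exact (encard_iUnion_le _).trans (ENNReal.tsum_le_tsum fun u => encard_iUnion_le _)
    _ ≤ _ := by
        rw [tsum_fintype, ← Finset.sum_coe_sort S]
        gcongr with u _ v
        simp only [T]
        split_ifs <;> simp_all

/-- The three factors read disjoint sets of pairs: pairs in a common small block that touch `S`, the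
single pair `u`, `v` across small blocks, and pairs that avoid `S`. They are therefore independent,
and dropping the avoidance constraint only enlarges the last cluster. -/
theorem lintegral_exit_le {b : ℕ} [NeZero b] (hb : 2 ≤ b) (lam : ℝ≥0) (n N : ℕ) (S : Finset ℕ)
    {u v : ℕ} (hu : u ∈ S) (h : ¬ SameBlock b n v u) :
    ∫⁻ G, {G | connSet (SameBlock b n) G 0 = S}.indicator 1 G *
        ({G | mult G u v ≠ 0}.indicator 1 G *
          ((connSet (fun a c => SameBlock b N a c ∧ a ∉ S ∧ c ∉ S) G v).encard : ℝ≥0∞))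
        ∂edgeMeasure b lam ≤
      edgeMeasure b lam {G | connSet (SameBlock b n) G 0 = S} *
        (rate b lam u v * blockMean b lam N) := by
  have hne : u ≠ v := by rintro rfl; exact h rfl
  let q1 : ℕ → ℕ → Prop := fun a c => SameBlock b n a c ∧ (a ∈ (S : Set ℕ) ∨ c ∈ (S : Set ℕ))
  let q2 : ℕ → ℕ → Prop := fun a c => (a = u ∧ c = v) ∨ (a = v ∧ c = u)
  let q3 : ℕ → ℕ → Prop := fun a c => SameBlock b N a c ∧ a ∉ S ∧ c ∉ S
  have hq2 : ∀ a c, q2 a c → q2 c a := fun a c h => by simp only [q2] at *; tauto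
  have hq3 : ∀ a c, q3 a c → q3 c a := fun a c h => ⟨h.1.symm, h.2.2, h.2.1⟩
  have hA : MeasurableSet {G : MGraph ℕ | connSet (SameBlock b n) G 0 = S} :=
    measurableSet_connSet_eq _ _ _
  have hB : MeasurableSet {G : MGraph ℕ | mult G u v ≠ 0} :=
    measurable_mult u v (.of_discrete : MeasurableSet {n : ℕ | n ≠ 0})
  have hA' : Measurable ({G : MGraph ℕ | connSet (SameBlock b n) G 0 = S}.indicator
    (1 : MGraph ℕ → ℝ≥0∞)) := measurable_one.indicator hA
  have hB' : Measurable ({G : MGraph ℕ | mult G u v ≠ 0}.indicator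
    (1 : MGraph ℕ → ℝ≥0∞)) := measurable_one.indicator hB
  have hC' := measurable_card_connSet q3 v
  have hBC : Measurable fun G : MGraph ℕ => {G : MGraph ℕ | mult G u v ≠ 0}.indicator
      (1 : MGraph ℕ → ℝ≥0∞) G * ((connSet q3 G v).encard : ℝ≥0∞) := hB'.mul hC'
  have dA : DependsOn ({G : MGraph ℕ | connSet (SameBlock b n) G 0 = S}.indicator
      (1 : MGraph ℕ → ℝ≥0∞)) (pairs q1) := fun G G' hG => by
    have := dependsOn_connSet_eq (q := SameBlock b n) (fun _ _ h => h.symm) (S : Set ℕ) 0 hG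
    simp only [Set.indicator, Set.mem_ofPred_eq]
    congr 1
  have dB : DependsOn ({G : MGraph ℕ | mult G u v ≠ 0}.indicator
      (1 : MGraph ℕ → ℝ≥0∞)) (pairs q2) := fun G G' hG => by
    have : mult G u v = mult G' u v := mult_congr hq2 hG (Or.inl ⟨rfl, rfl⟩)
    simp only [Set.indicator, Set.mem_ofPred_eq, this, Pi.one_apply]
  have dC : DependsOn (fun G : MGraph ℕ => ((connSet q3 G v).encard : ℝ≥0∞)) (pairs q3) :=
    fun G G' hG => by
      have : connSet q3 G v = connSet q3 G' v := Set.ext fun y => conn_congr hq3 hG v y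
      simp only [this]
  have d12 : Disjoint (pairs q1) (pairs q2) := disjoint_pairs fun a c h1 h2 => by
    rcases h2 with ⟨rfl, rfl⟩ | ⟨rfl, rfl⟩
    exacts [h h1.1.symm, h h1.1]
  have d13 : Disjoint (pairs q1) (pairs q3) := disjoint_pairs fun a c h1 h3 =>
    h1.2.elim h3.2.1 h3.2.2
  have d23 : Disjoint (pairs q2) (pairs q3) := disjoint_pairs fun a c h2 h3 => by
    rcases h2 with ⟨rfl, rfl⟩ | ⟨rfl, rfl⟩
    exacts [h3.2.1 hu, h3.2.2 hu]
  have dBC : DependsOn (fun G : MGraph ℕ => {G : MGraph ℕ | mult G u v ≠ 0}.indicator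
      (1 : MGraph ℕ → ℝ≥0∞) G * ((connSet q3 G v).encard : ℝ≥0∞)) (pairs q2 ∪ pairs q3) :=
    fun G G' hG => by
      have h2 := dB (x := G) (y := G') fun e he => hG e (Or.inl he)
      have h3 := dC (x := G) (y := G') fun e he => hG e (Or.inr he)
      simp only at h3
      simp only [h2, h3]
  rw [edgeMeasure, lintegral_mul_of_dependsOn _ hA' hBC dA dBC
    (Set.disjoint_union_right.2 ⟨d12, d13⟩), lintegral_mul_of_dependsOn _ hB' hC' dB dC d23,
    lintegral_indicator_one hA, lintegral_indicator_one hB]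
  gcongr
  · exact edgeMeasure_mult_ne_zero_le b lam hne
  · rw [← lintegral_connSet hb lam N v]
    exact lintegral_mono fun G => encard_coe_mono fun y hy => Conn.mono (fun _ _ h => h.1) hy

theorem lintegral_partition {α ι : Type*} [MeasurableSpace α] [Countable ι] {μ : Measure α}
    {A : ι → Set α} (hA : ∀ i, MeasurableSet (A i)) (hex : ∀ x, ∃! i, x ∈ A i) {f : α → ℝ≥0∞}
    (hf : Measurable f) : ∫⁻ x, f x ∂μ = ∑' i, ∫⁻ x, (A i).indicator 1 x * f x ∂μ := by
  have hm : ∀ i, Measurable fun x => (A i).indicator 1 x * f x :=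
    fun i => (measurable_one.indicator (hA i)).mul hf
  rw [← lintegral_tsum fun i => (hm i).aemeasurable]
  refine lintegral_congr fun x => ?_
  obtain ⟨i, hi, huniq⟩ := hex x
  rw [tsum_eq_single i]
  · simp [hi]
  · intro j hj
    have : x ∉ A j := fun h => hj (huniq j h)
    simp [this]

/-- Given the cluster `S` in the small block, each of its vertices has exit rate at most `lam / b ^
n`, and each exit edge leads to a cluster of mean size at most `blockMean b lam N`. It remains to
sum over `S`. -/
theorem blockMean_le {b : ℕ} [NeZero b] (hb : 2 ≤ b) (lam : ℝ≥0) (n N : ℕ) :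
    blockMean b lam N ≤ blockMean b lam n +
      blockMean b lam n * ((lam / b ^ n : ℝ≥0) * blockMean b lam N) := by
  classical
  let A : Finset ℕ → Set (MGraph ℕ) := fun S => {G | connSet (SameBlock b n) G 0 = S}
  have hA : ∀ S, MeasurableSet (A S) := fun S => measurableSet_connSet_eq _ _ _
  have hex : ∀ G, ∃! S, G ∈ A S := by
    intro G
    have hfin : (connSet (SameBlock b n) G 0).Finite :=
      (Finset.finite_toSet _).subset connSet_subset_range
    refine ⟨hfin.toFinset, by simp [A], fun S hS => ?_⟩
    rw [← Finset.coe_inj, hfin.coe_toFinset]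
    exact hS.symm
  have hmean : ∀ S, ∫⁻ G, (A S).indicator 1 G * ((connSet (SameBlock b n) G 0).encard : ℝ≥0∞)
      ∂edgeMeasure b lam = edgeMeasure b lam (A S) * S.card := by
    intro S
    rw [← lintegral_indicator_one (hA S), ← lintegral_mul_const _ (measurable_one.indicator (hA S))]
    refine lintegral_congr fun G => ?_
    by_cases hG : G ∈ A S
    · have : connSet (SameBlock b n) G 0 = S := hG
      rw [this, Set.encard_coe_eq_coe_finsetCard]
      rfl
    · simp [hG]
  have hstep : ∀ S, ∫⁻ G, (A S).indicator 1 G * ((connSet (SameBlock b N) G 0).encard : ℝ≥0∞)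
      ∂edgeMeasure b lam ≤ edgeMeasure b lam (A S) * S.card +
        edgeMeasure b lam (A S) * S.card * ((lam / b ^ n : ℝ≥0) * blockMean b lam N) := by
    intro S
    let g : ℕ → ℕ → MGraph ℕ → ℝ≥0∞ := fun u v G => {G | mult G u v ≠ 0}.indicator 1 G *
          ((connSet (fun a c => SameBlock b N a c ∧ a ∉ S ∧ c ∉ S) G v).encard : ℝ≥0∞)
    have hg : ∀ u v, Measurable (g u v) := fun u v => (measurable_one.indicator
      (measurable_mult u v (.of_discrete : MeasurableSet {n : ℕ | n ≠ 0}))).mul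
        (measurable_card_connSet _ v)
    have hterm : ∀ u v, Measurable fun G => (A S).indicator 1 G *
        (if SameBlock b N v u ∧ ¬ SameBlock b n v u then g u v G else 0) := by
      intro u v
      refine (measurable_one.indicator (hA S)).mul ?_
      split_ifs
      exacts [hg u v, measurable_const]
    have hconst : Measurable fun G => (A S).indicator 1 G * (S.card : ℝ≥0∞) :=
      (measurable_one.indicator (hA S)).mul_const _
    calc _ ≤ ∫⁻ G, ((A S).indicator 1 G * S.card + ∑ u ∈ S, ∑' v, (A S).indicator 1 G *
          if SameBlock b N v u ∧ ¬ SameBlock b n v u then g u v G else 0) ∂edgeMeasure b lam := by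
          refine lintegral_mono fun G => ?_
          by_cases hG : G ∈ A S
          · have := encard_connSet_le_exit b n N G hG
            simp only [Set.indicator_of_mem hG, Pi.one_apply, one_mul]
            refine this.trans_eq ?_
            simp only [g, Set.indicator, Set.mem_ofPred_eq, Pi.one_apply]
          · simp [hG]
      _ = edgeMeasure b lam (A S) * S.card + ∑ u ∈ S, ∑' v, ∫⁻ G, (A S).indicator 1 G *
          (if SameBlock b N v u ∧ ¬ SameBlock b n v u then g u v G else 0) ∂edgeMeasure b lam := by
          rw [lintegral_add_left hconst,
            lintegral_mul_const _ (measurable_one.indicator (hA S)),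
            lintegral_indicator_one (hA S),
            lintegral_finsetSum _ fun u _ => Measurable.tsum fun v => hterm u v]
          simp only [lintegral_tsum fun v => (hterm _ v).aemeasurable]
      _ ≤ edgeMeasure b lam (A S) * S.card + ∑ u ∈ S, ∑' v, edgeMeasure b lam (A S) *
          ((if SameBlock b N v u ∧ ¬ SameBlock b n v u then (rate b lam u v : ℝ≥0∞) else 0) *
            blockMean b lam N) := by
          gcongr with u hu v
          by_cases h : SameBlock b N v u ∧ ¬ SameBlock b n v u
          · simp only [if_pos h]
            exact lintegral_exit_le hb lam n N S hu h.2
          · simp [if_neg h]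
      _ = edgeMeasure b lam (A S) * S.card + ∑ u ∈ S, edgeMeasure b lam (A S) *
          (annulusRate b lam n N u * blockMean b lam N) := by
          simp only [ENNReal.tsum_mul_left, ENNReal.tsum_mul_right]
          rfl
      _ ≤ edgeMeasure b lam (A S) * S.card + ∑ u ∈ S, edgeMeasure b lam (A S) *
          ((lam / b ^ n : ℝ≥0) * blockMean b lam N) := by
          gcongr with u _
          exact annulusRate_le hb lam n N u
      _ = _ := by
          rw [Finset.sum_const, nsmul_eq_mul]
          ring
  have hn : blockMean b lam n = ∑' S, edgeMeasure b lam (A S) * S.card := by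
    rw [blockMean, lintegral_partition hA hex (measurable_card_connSet _ _)]
    exact tsum_congr hmean
  calc blockMean b lam N = ∑' S, ∫⁻ G, (A S).indicator 1 G *
        ((connSet (SameBlock b N) G 0).encard : ℝ≥0∞) ∂edgeMeasure b lam := by
        rw [blockMean, lintegral_partition hA hex (measurable_card_connSet _ _)]
    _ ≤ ∑' S, (edgeMeasure b lam (A S) * S.card +
        edgeMeasure b lam (A S) * S.card * ((lam / b ^ n : ℝ≥0) * blockMean b lam N)) :=
        ENNReal.tsum_le_tsum hstep
    _ = _ := by rw [ENNReal.tsum_add, ENNReal.tsum_mul_right, ← hn]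

/-- If the cluster in some finite block is small on average, then the whole cluster is. -/
theorem meanSize_le_of_blockMean {b : ℕ} [NeZero b] (hb : 2 ≤ b) (lam : ℝ≥0) (n : ℕ)
    (h : blockMean b lam n * (lam / b ^ n : ℝ≥0) ≤ 1 / 2) :
    meanSize (edgeModel b lam) ≤ 2 * blockMean b lam n := by
  rw [meanSize_edgeModel hb]
  refine iSup_le fun N => ?_
  -- Finiteness, from the number of leaves in the block, permits absorbing half of `blockMean b lam
  -- N` into the left-hand side.
  have hN : blockMean b lam N ≠ ∞ := ne_top_of_le_ne_top (by simp) (blockMean_le_pow lam N)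
  have hn : blockMean b lam n ≠ ∞ := ne_top_of_le_ne_top (by simp) (blockMean_le_pow lam n)
  have h1 := blockMean_le hb lam n N
  rw [← mul_assoc] at h1
  have h2 : blockMean b lam N ≤ blockMean b lam n + 1 / 2 * blockMean b lam N :=
    h1.trans (by gcongr)
  rw [← ENNReal.toReal_le_toReal hN (by finiteness)]
  rw [← ENNReal.toReal_le_toReal hN (by finiteness), ENNReal.toReal_add hn (by finiteness)] at h2
  simp at h2 ⊢
  linarith

/-! ### Isolated blocks -/

/-- There are no edges between the block of the origin of size `b ^ n` and its complement in the
block of size `b ^ M`. -/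
def isolated (b n M : ℕ) : Set (MGraph ℕ) :=
  {G | ∀ x ∈ Finset.range (b ^ n), ∀ y ∈ Finset.Ico (b ^ n) (b ^ M), mult G x y = 0}

theorem measurableSet_no_edges (A B : Finset ℕ) :
    MeasurableSet {G : MGraph ℕ | ∀ x ∈ A, ∀ y ∈ B, mult G x y = 0} := by
  have : {G : MGraph ℕ | ∀ x ∈ A, ∀ y ∈ B, mult G x y = 0} =
      ⋂ x ∈ A, ⋂ y ∈ B, {G | mult G x y = 0} := by
    ext G; simp
  rw [this]
  exact Finset.measurableSet_biInter _ fun x _ => Finset.measurableSet_biInter _ fun y _ =>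
    measurable_mult x y (measurableSet_singleton 0)

theorem measurableSet_isolated (b n M : ℕ) : MeasurableSet (isolated b n M) :=
  measurableSet_no_edges _ _

theorem sum_rate_annulus {b : ℕ} [NeZero b] (hb : 2 ≤ b) (lam : ℝ≥0) {k n M : ℕ} (hkn : k ≤ n)
    (hnM : n ≤ M) :
    ((∑ x ∈ Finset.range (b ^ k), ∑ y ∈ Finset.Ico (b ^ n) (b ^ M), rate b lam x y : ℝ≥0) : ℝ) =
      b ^ k * (lam / b ^ n - lam / b ^ M) := by
  have hpos : ∀ m, 0 < b ^ m := fun m => Nat.pow_pos (by omega)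
  have hpk : b ^ k ≤ b ^ n := Nat.pow_le_pow_right (by omega) hkn
  have hpM : b ^ n ≤ b ^ M := Nat.pow_le_pow_right (by omega) hnM
  -- For any `x` below `b ^ n`, the interval from `b ^ n` to `b ^ M` is exactly the annulus around
  -- `x`.
  have key : ∀ x ∈ Finset.range (b ^ k),
      (∑ y ∈ Finset.Ico (b ^ n) (b ^ M), rate b lam x y) + lam / b ^ M = lam / b ^ n := by
    intro x hx
    rw [Finset.mem_range] at hx
    have := annulusRate_eq hb lam hnM x
    rw [annulusRate, tsum_eq_sum (s := Finset.Ico (b ^ n) (b ^ M))] at this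
    · rw [Finset.sum_congr rfl (g := fun y => (rate b lam x y : ℝ≥0∞))] at this
      · exact_mod_cast this
      · intro y hy
        rw [Finset.mem_Ico] at hy
        rw [if_pos]
        rw [Nat.div_eq_of_lt hy.2, Nat.div_eq_of_lt (show x < b ^ M by omega),
          Nat.div_eq_of_lt (show x < b ^ n by omega)]
        exact ⟨rfl, by rw [Ne, Nat.div_eq_zero_iff]; have := hpos n; omega⟩
    · intro y hy
      rw [if_neg]
      rintro ⟨h1, h2⟩
      rw [Nat.div_eq_of_lt (show x < b ^ M by omega), Nat.div_eq_zero_iff] at h1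
      rw [Nat.div_eq_of_lt (show x < b ^ n by omega), Ne, Nat.div_eq_zero_iff] at h2
      rw [Finset.mem_Ico] at hy
      have := hpos M
      omega
  have key' : ∀ x ∈ Finset.range (b ^ k),
      ((∑ y ∈ Finset.Ico (b ^ n) (b ^ M), rate b lam x y : ℝ≥0) : ℝ) =
        lam / b ^ n - lam / b ^ M := by
    intro x hx
    rw [eq_sub_iff_add_eq]
    exact_mod_cast key x hx
  rw [NNReal.coe_sum, Finset.sum_congr rfl key', Finset.sum_const, Finset.card_range, nsmul_eq_mul]
  push_cast
  rfl

/-- The `b ^ n` leaves of the block each have rate at most `lam / b ^ n` outwards, so the total rate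
out of the block stays below `lam` at every scale. -/
theorem real_isolated {b : ℕ} [NeZero b] (hb : 2 ≤ b) (lam : ℝ≥0) {n M : ℕ} (hnM : n ≤ M) :
    (edgeMeasure b lam).real (isolated b n M) =
      Real.exp (-(lam * (1 - (1 / (b : ℝ)) ^ (M - n)))) := by
  have hb0 : (b : ℝ) ≠ 0 := by positivity
  rw [Measure.real, isolated, edgeMeasure_no_edges, ENNReal.toReal_ofReal (Real.exp_pos _).le,
    sum_rate_annulus hb lam le_rfl hnM]
  · congr 2
    obtain ⟨d, rfl⟩ := Nat.exists_eq_add_of_le hnM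
    rw [Nat.add_sub_cancel_left, pow_add, div_pow, one_pow]
    field_simp
  · rw [Finset.disjoint_left]
    intro x h1 h2
    rw [Finset.mem_range] at h1
    rw [Finset.mem_Ico] at h2
    omega

theorem real_isolated_ge {b : ℕ} [NeZero b] (hb : 2 ≤ b) (lam : ℝ≥0) {n M : ℕ} (hnM : n ≤ M) :
    Real.exp (-lam) ≤ (edgeMeasure b lam).real (isolated b n M) := by
  rw [real_isolated hb lam hnM, Real.exp_le_exp]
  have : 0 ≤ (lam : ℝ) * (1 / (b : ℝ)) ^ (M - n) := by positivity
  linarith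

theorem real_far_edges_le {b : ℕ} [NeZero b] (hb : 2 ≤ b) (lam : ℝ≥0) {k n M : ℕ} (hkn : k ≤ n)
    (hnM : n ≤ M) : (edgeMeasure b lam).real
      {G | ∀ x ∈ Finset.range (b ^ k), ∀ y ∈ Finset.Ico (b ^ n) (b ^ M), mult G x y = 0}ᶜ ≤
      lam / b ^ (n - k) := by
  have hb0 : (b : ℝ) ≠ 0 := by positivity
  have hpk : b ^ k ≤ b ^ n := Nat.pow_le_pow_right (by omega) hkn
  rw [probReal_compl_eq_one_sub (measurableSet_no_edges _ _), Measure.real, edgeMeasure_no_edges,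
    ENNReal.toReal_ofReal (Real.exp_pos _).le, sum_rate_annulus hb lam hkn hnM]
  · have h1 := Real.add_one_le_exp (-((b : ℝ) ^ k * (lam / b ^ n - lam / b ^ M)))
    have h2 : (b : ℝ) ^ k * (lam / b ^ n) = lam / b ^ (n - k) := by
      obtain ⟨d, rfl⟩ := Nat.exists_eq_add_of_le hkn
      rw [Nat.add_sub_cancel_left, pow_add]
      field_simp
    have h3 : 0 ≤ (b : ℝ) ^ k * (lam / b ^ M) := by positivity
    linarith
  · rw [Finset.disjoint_left]
    intro x h1 h2
    rw [Finset.mem_range] at h1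
    rw [Finset.mem_Ico] at h2
    omega

/-- Pairs within the block of the origin of size `b ^ m`. -/
def innerPairs (b m : ℕ) : Set (VPair ℕ) := pairs fun u v => u < b ^ m ∧ v < b ^ m

/-- Pairs not within the block of the origin of size `b ^ m`. -/
def outerPairs (b m : ℕ) : Set (VPair ℕ) := pairs fun u v => ¬ (u < b ^ m ∧ v < b ^ m)

theorem disjoint_innerPairs_outerPairs (b m : ℕ) : Disjoint (innerPairs b m) (outerPairs b m) :=
  disjoint_pairs fun _ _ h => not_not.2 h

theorem isolated_congr_inner {b n m : ℕ} {G G' : MGraph ℕ} (hb : 2 ≤ b) (hnm : n ≤ m)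
    (h : ∀ e ∈ innerPairs b m, G e = G' e) : G ∈ isolated b n m ↔ G' ∈ isolated b n m := by
  have hp : b ^ n ≤ b ^ m := Nat.pow_le_pow_right (by omega) hnm
  refine forall₂_congr fun x hx => forall₂_congr fun y hy => ?_
  rw [Finset.mem_range] at hx
  rw [Finset.mem_Ico] at hy
  rw [mult_congr (fun u v h => h.symm) h ⟨by omega, hy.2⟩]

theorem isolated_congr_outer {b n m M : ℕ} {G G' : MGraph ℕ} (hb : 2 ≤ b) (hnm : m ≤ n)
    (h : ∀ e ∈ outerPairs b m, G e = G' e) : G ∈ isolated b n M ↔ G' ∈ isolated b n M := by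
  have hp : b ^ m ≤ b ^ n := Nat.pow_le_pow_right (by omega) hnm
  refine forall₂_congr fun x hx => forall₂_congr fun y hy => ?_
  rw [Finset.mem_Ico] at hy
  rw [mult_congr (fun u v h h' => h h'.symm) h (fun h => by omega)]

theorem real_inter_of_dependsOn {b : ℕ} (lam : ℝ≥0) (m : ℕ) {A B : Set (MGraph ℕ)}
    (hA : MeasurableSet A) (hB : MeasurableSet B) (dA : DependsOn (· ∈ A) (innerPairs b m))
    (dB : DependsOn (· ∈ B) (outerPairs b m)) :
    (edgeMeasure b lam).real (A ∩ B) =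
      (edgeMeasure b lam).real A * (edgeMeasure b lam).real B := by
  rw [Measure.real, edgeMeasure, measure_inter_of_dependsOn _ hA hB dA dB
    (disjoint_innerPairs_outerPairs b m), ENNReal.toReal_mul]
  rfl

/-- Isolation of the small block only within the intermediate block is a weaker event that reads
inner pairs, whereas isolation of the intermediate block reads outer pairs. These two are
independent. -/
theorem real_isolated_inter_le {b : ℕ} (hb : 2 ≤ b) (lam : ℝ≥0) {n m M : ℕ} (hnm : n ≤ m)
    (hmM : m ≤ M) : (edgeMeasure b lam).real (isolated b n M ∩ isolated b m M) ≤
      (edgeMeasure b lam).real (isolated b n m) * (edgeMeasure b lam).real (isolated b m M) := by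
  rw [← real_inter_of_dependsOn lam m (measurableSet_isolated _ _ _) (measurableSet_isolated _ _ _)
    (fun G G' h => propext (isolated_congr_inner hb hnm h))
    (fun G G' h => propext (isolated_congr_outer hb le_rfl h))]
  refine measureReal_mono (Set.inter_subset_inter_left _ fun G hG x hx y hy => hG x hx y ?_)
  have : b ^ m ≤ b ^ M := Nat.pow_le_pow_right (by omega) hmM
  rw [Finset.mem_Ico] at hy ⊢
  omega

/-- A Bonferroni inequality. -/
theorem sum_sub_le_measureReal_iUnion {α : Type*} [MeasurableSpace α] {μ : Measure α}
    [IsFiniteMeasure μ] {A : ℕ → Set α} (hA : ∀ i, MeasurableSet (A i)) (I : ℕ) :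
    ∑ i ∈ Finset.range I, (μ.real (A i) - ∑ j ∈ Finset.range i, μ.real (A j ∩ A i)) ≤
      μ.real (⋃ i ∈ Finset.range I, A i) := by
  induction I with
  | zero => simp
  | succ I ih =>
    rw [Finset.sum_range_succ, Finset.range_add_one, Finset.set_biUnion_insert, Set.union_comm]
    have h1 := measureReal_union_add_inter (μ := μ) (s := ⋃ i ∈ Finset.range I, A i) (hA I)
      (measure_ne_top _ _)
    have h2 : μ.real ((⋃ i ∈ Finset.range I, A i) ∩ A I) ≤
        ∑ j ∈ Finset.range I, μ.real (A j ∩ A I) := by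
      rw [Set.iUnion₂_inter]
      exact measureReal_biUnion_finset_le _ _
    linarith

theorem sum_quarter_pow_le (i : ℕ) : ∑ j ∈ Finset.range i, (1 / 4 : ℝ) ^ (i - j) ≤ 1 / 3 := by
  induction i with
  | zero => simp
  | succ i ih =>
    rw [Finset.sum_range_succ]
    have : ∑ j ∈ Finset.range i, (1 / 4 : ℝ) ^ (i + 1 - j) =
        1 / 4 * ∑ j ∈ Finset.range i, (1 / 4 : ℝ) ^ (i - j) := by
      rw [Finset.mul_sum]
      refine Finset.sum_congr rfl fun j hj => ?_
      rw [Finset.mem_range] at hj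
      rw [show i + 1 - j = (i - j) + 1 by omega, pow_succ']
    rw [this, show i + 1 - i = 1 by omega]
    linarith

/-- Convexity of the exponential between `-lam` and `0`. The additive error `t` is geometrically
small in the gap between scales and hence summable. -/
theorem exp_neg_mul_one_sub_le {lam t : ℝ} (h0 : 0 ≤ t) (h1 : t ≤ 1) :
    Real.exp (-(lam * (1 - t))) ≤ Real.exp (-lam) + t := by
  have := convexOn_exp.2 (Set.mem_univ (-lam)) (Set.mem_univ 0) (sub_nonneg.2 h1) h0 (by ring)
  simp only [smul_eq_mul, mul_zero, add_zero, Real.exp_zero, mul_one] at this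
  calc Real.exp (-(lam * (1 - t))) = Real.exp ((1 - t) * -lam) := by ring_nf
    _ ≤ (1 - t) * Real.exp (-lam) + t := this
    _ ≤ _ := by nlinarith [Real.exp_pos (-lam)]

/-- With probability bounded below, some block with size in a window of about `exp lam` scales is
isolated within a larger block. -/
theorem real_window_ge {b : ℕ} [NeZero b] (hb : 2 ≤ b) (lam : ℝ≥0) (N K I : ℕ)
    (hI : Real.exp lam / 2 ≤ I) (hI' : (I : ℝ) ≤ Real.exp lam / 2 + 1) :
    1 / 12 ≤ (edgeMeasure b lam).real
      (⋃ i ∈ Finset.range I, isolated b (N + 2 * i) (N + (2 * I + K))) := by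
  refine le_trans ?_ (sum_sub_le_measureReal_iUnion (fun i => measurableSet_isolated _ _ _) I)
  have hexp : Real.exp lam * Real.exp (-lam) = 1 := by rw [← Real.exp_add]; simp
  -- Using only every second scale gives the ratio `1 / 4` even for `b = 2`, so the correlation
  -- errors sum to at most `1 / 3`.
  have hb' : (1 / (b : ℝ)) ^ 2 ≤ 1 / 4 := by
    have : (2 : ℝ) ≤ b := by exact_mod_cast hb
    have h4 : (4 : ℝ) ≤ b ^ 2 := by nlinarith
    rw [div_pow, one_pow]
    exact one_div_le_one_div_of_le (by norm_num) h4
  -- The pair terms cost at most the fraction `1 / 2 + 1 / 3` of the single term: `1 / 2` from fewer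
  -- than `exp lam / 2 + 1` scales, `1 / 3` from the geometric errors. A sixth of at least `exp
  -- (-lam)` remains.
  have hterm : ∀ i ∈ Finset.range I, Real.exp (-lam) / 6 ≤
      (edgeMeasure b lam).real (isolated b (N + 2 * i) (N + (2 * I + K))) -
        ∑ j ∈ Finset.range i, (edgeMeasure b lam).real (isolated b (N + 2 * j) (N + (2 * I + K)) ∩
          isolated b (N + 2 * i) (N + (2 * I + K))) := by
    intro i hi
    rw [Finset.mem_range] at hi
    have h1 := real_isolated_ge hb lam (show N + 2 * i ≤ N + (2 * I + K) by omega)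
    set p := (edgeMeasure b lam).real (isolated b (N + 2 * i) (N + (2 * I + K)))
    have h2 : ∑ j ∈ Finset.range i, (edgeMeasure b lam).real
        (isolated b (N + 2 * j) (N + (2 * I + K)) ∩ isolated b (N + 2 * i) (N + (2 * I + K)))
        ≤ ∑ j ∈ Finset.range i, (Real.exp (-lam) + (1 / 4) ^ (i - j)) * p := by
      refine Finset.sum_le_sum fun j hj => ?_
      rw [Finset.mem_range] at hj
      refine (real_isolated_inter_le hb lam (by omega) (by omega)).trans ?_
      gcongr
      rw [real_isolated hb lam (by omega)]
      refine (exp_neg_mul_one_sub_le (by positivity) ?_).trans ?_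
      · refine pow_le_one₀ (by positivity) ?_
        rw [div_le_one (by positivity)]
        exact_mod_cast (show 1 ≤ b by omega)
      · gcongr
        rw [show N + 2 * i - (N + 2 * j) = 2 * (i - j) by omega, pow_mul]
        gcongr
    rw [← Finset.sum_mul, Finset.sum_add_distrib, Finset.sum_const, Finset.card_range,
      nsmul_eq_mul] at h2
    have h3 : (i : ℝ) * Real.exp (-lam) ≤ 1 / 2 := by
      have : (i : ℝ) + 1 ≤ I := by exact_mod_cast hi
      calc _ ≤ Real.exp lam / 2 * Real.exp (-lam) := by gcongr; linarith
        _ = _ := by linarith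
    have h4 := sum_quarter_pow_le i
    have h5 : ((i : ℝ) * Real.exp (-lam) + ∑ j ∈ Finset.range i, (1 / 4 : ℝ) ^ (i - j)) * p ≤
        5 / 6 * p := by
      gcongr
      linarith
    linarith
  calc (1 : ℝ) / 12 = Real.exp lam / 2 * (Real.exp (-lam) / 6) := by linarith
    _ ≤ I * (Real.exp (-lam) / 6) := by gcongr
    _ = ∑ i ∈ Finset.range I, Real.exp (-lam) / 6 := by
      rw [Finset.sum_const, Finset.card_range, nsmul_eq_mul]
    _ ≤ _ := Finset.sum_le_sum hterm

/-- No block of the origin of size at most `b ^ (N - K)` is isolated within the block of size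
`b ^ N`. -/
def entangled (b K N : ℕ) : Set (MGraph ℕ) := {G | ∀ n, n + K ≤ N → G ∉ isolated b n N}

theorem measurableSet_entangled (b K N : ℕ) : MeasurableSet (entangled b K N) := by
  have : entangled b K N = ⋂ n, ⋂ (_ : n + K ≤ N), (isolated b n N)ᶜ := by
    ext G; simp [entangled]
  rw [this]
  exact MeasurableSet.iInter fun n => MeasurableSet.iInter fun _ =>
    (measurableSet_isolated _ _ _).compl

/-- Entanglement at the larger scale leaves two possibilities. Either the smaller scale is entangled
and the fresh window contains no isolated block, two independent events; or a block that was
isolated in the block of size `b ^ N` has an edge leaving that block. The margin `K` makes the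
second case unlikely. -/
theorem real_entangled_step {b : ℕ} [NeZero b] (hb : 2 ≤ b) (lam : ℝ≥0) (N K I : ℕ)
    (hI : Real.exp lam / 2 ≤ I) (hI' : (I : ℝ) ≤ Real.exp lam / 2 + 1) :
    (edgeMeasure b lam).real (entangled b K (N + (2 * I + K))) ≤
      11 / 12 * (edgeMeasure b lam).real (entangled b K N) + lam / b ^ K := by
  set L := 2 * I + K
  set W := ⋃ i ∈ Finset.range I, isolated b (N + 2 * i) (N + L)
  have hW : MeasurableSet W :=
    Finset.measurableSet_biUnion _ fun _ _ => measurableSet_isolated _ _ _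
  -- The condition `K ≤ N` guards the truncated subtraction. For `N < K` every graph is entangled
  -- and this error event is not needed.
  set E : Set (MGraph ℕ) := {G | K ≤ N ∧ ¬ ∀ x ∈ Finset.range (b ^ (N - K)),
    ∀ y ∈ Finset.Ico (b ^ N) (b ^ (N + L)), mult G x y = 0}
  have hsub : entangled b K (N + L) ⊆ (entangled b K N ∩ Wᶜ) ∪ E := by
    intro G hG
    have hGW : G ∈ Wᶜ := by
      simp only [W, Set.mem_compl_iff, Set.mem_iUnion, not_exists, Finset.mem_range]
      intro i hi
      exact hG _ (by omega)
    by_cases h : G ∈ entangled b K N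
    · exact Or.inl ⟨h, hGW⟩
    · right
      simp only [entangled, Set.mem_ofPred_eq, not_forall, not_not] at h
      obtain ⟨n, hn, hiso⟩ := h
      refine ⟨by omega, fun hno => hG n (by omega) fun x hx y hy => ?_⟩
      have hp : b ^ n ≤ b ^ (N - K) := Nat.pow_le_pow_right (by omega) (by omega)
      rw [Finset.mem_Ico] at hy
      rcases Nat.lt_or_ge y (b ^ N) with h | h
      · exact hiso x hx y (Finset.mem_Ico.2 ⟨hy.1, h⟩)
      · exact hno x (Finset.mem_range.2 ((Finset.mem_range.1 hx).trans_le hp)) y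
          (Finset.mem_Ico.2 ⟨h, hy.2⟩)
  have hE : (edgeMeasure b lam).real E ≤ lam / b ^ K := by
    by_cases hKN : K ≤ N
    · have := real_far_edges_le hb lam (Nat.sub_le N K) (Nat.le_add_right N L)
      rw [Nat.sub_sub_self hKN] at this
      refine le_trans (measureReal_mono fun G hG => hG.2) this
    · have : E = ∅ := by
        ext G
        simp [E, hKN]
      rw [this, measureReal_empty]
      positivity
  have hindep : (edgeMeasure b lam).real (entangled b K N ∩ Wᶜ) =
      (edgeMeasure b lam).real (entangled b K N) * (edgeMeasure b lam).real Wᶜ := by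
    refine real_inter_of_dependsOn lam N (measurableSet_entangled _ _ _) hW.compl
      (fun G G' h => propext ?_) (fun G G' h => propext ?_)
    · exact forall₂_congr fun n hn => not_congr (isolated_congr_inner hb (by omega) h)
    · simp only [W, Set.mem_compl_iff, Set.mem_iUnion]
      exact not_congr (exists_congr fun i => exists_congr fun _ =>
        isolated_congr_outer hb (by omega) h)
  have hWc : (edgeMeasure b lam).real Wᶜ ≤ 11 / 12 := by
    rw [probReal_compl_eq_one_sub hW]
    have := real_window_ge hb lam N K I hI hI'
    linarith
  calc _ ≤ (edgeMeasure b lam).real ((entangled b K N ∩ Wᶜ) ∪ E) := measureReal_mono hsub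
    _ ≤ (edgeMeasure b lam).real (entangled b K N ∩ Wᶜ) + (edgeMeasure b lam).real E :=
      measureReal_union_le _ _
    _ ≤ _ := by
      rw [hindep, mul_comm]
      gcongr

/-- The constant `12` comes from the fixed point of the affine recursion `x ↦ 11 / 12 * x + lam / b
^ K`. -/
theorem real_entangled_le {b : ℕ} [NeZero b] (hb : 2 ≤ b) (lam : ℝ≥0) (K I J : ℕ)
    (hI : Real.exp lam / 2 ≤ I) (hI' : (I : ℝ) ≤ Real.exp lam / 2 + 1) :
    (edgeMeasure b lam).real (entangled b K (J * (2 * I + K))) ≤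
      (11 / 12) ^ J + 12 * (lam / b ^ K) := by
  induction J with
  | zero =>
    have : (edgeMeasure b lam).real (entangled b K (0 * (2 * I + K))) ≤ 1 := measureReal_le_one
    have h : 0 ≤ (lam : ℝ) / b ^ K := by positivity
    simp only [pow_zero]
    linarith
  | succ J ih =>
    rw [Nat.succ_mul]
    have := real_entangled_step hb lam (J * (2 * I + K)) K I hI hI'
    rw [pow_succ]
    linarith

theorem connSet_subset_of_isolated {b n N : ℕ} [NeZero b] {G : MGraph ℕ} (h : G ∈ isolated b n N) :
    connSet (SameBlock b N) G 0 ⊆ Finset.range (b ^ n) := by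
  intro y hy
  have hN : y ∈ (Finset.range (b ^ N) : Set ℕ) := connSet_subset_range hy
  induction hy with
  | refl => simpa using Nat.pow_pos (Nat.pos_of_neZero b)
  | @tail y z hxy hyz ih =>
    have hy := ih (connSet_subset_range hxy)
    by_contra hz
    simp only [Finset.coe_range, Set.mem_Iio, not_lt] at hz hN
    exact hyz.2 (h y hy z (Finset.mem_Ico.2 ⟨hz, hN⟩))

/-- On the entangled event the whole block bounds the cluster. Otherwise the cluster is confined to
an isolated block that is smaller by a factor of at least `b ^ K`. -/
theorem blockMean_le_entangled {b : ℕ} [NeZero b] (lam : ℝ≥0) (K N : ℕ) :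
    blockMean b lam N ≤ (b : ℝ≥0∞) ^ N * (edgeMeasure b lam (entangled b K N)) +
      (b : ℝ≥0∞) ^ N * ((b : ℝ≥0∞) ^ K)⁻¹ := by
  have hb0 : (b : ℝ≥0∞) ≠ 0 := by exact_mod_cast NeZero.ne b
  calc blockMean b lam N ≤ ∫⁻ G, ((entangled b K N).indicator (fun _ => (b : ℝ≥0∞) ^ N) G +
        (b : ℝ≥0∞) ^ N * ((b : ℝ≥0∞) ^ K)⁻¹) ∂edgeMeasure b lam := by
        refine lintegral_mono fun G => ?_
        by_cases hG : G ∈ entangled b K N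
        · rw [Set.indicator_of_mem hG]
          exact (encard_connSet_le N G).trans le_self_add
        · rw [Set.indicator_of_notMem hG, zero_add]
          simp only [entangled, Set.mem_ofPred_eq, not_forall, not_not] at hG
          obtain ⟨n, hn, hiso⟩ := hG
          refine (encard_coe_mono (connSet_subset_of_isolated hiso)).trans ?_
          rw [Set.encard_coe_eq_coe_finsetCard, Finset.card_range]
          have h1 : (b : ℝ≥0∞) ^ n * (b : ℝ≥0∞) ^ K ≤ (b : ℝ≥0∞) ^ N := by
            rw [← pow_add]
            exact pow_le_pow_right₀ (by exact_mod_cast Nat.pos_of_neZero b) hn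
          rw [← div_eq_mul_inv, ENNReal.le_div_iff_mul_le (Or.inl (by positivity))
            (Or.inl (by simp))]
          simpa using h1
    _ = _ := by
        rw [lintegral_add_right _ measurable_const, lintegral_indicator (measurableSet_entangled _ _ _),
          lintegral_const, lintegral_const]
        simp

/-! ### The upper bounds for the mean size -/

theorem exists_blockMean_small {b : ℕ} [NeZero b] (hb : 2 ≤ b) (lam : ℝ≥0) :
    ∃ N : ℕ, blockMean b lam N * (lam / b ^ N : ℝ≥0) ≤ 1 / 2 ∧
      (N : ℝ) ≤ 16 * Real.exp lam * (18 + 12 * Real.log (1 + lam)) := by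
  have hb0 : (b : ℝ) ≠ 0 := by positivity
  have hl : (0 : ℝ) ≤ lam := lam.2
  have hlog : 0 ≤ Real.log (1 + lam) := Real.log_nonneg (by linarith)
  have hlog1 : Real.log (1 + lam) ≤ lam := by
    have := Real.log_le_sub_one_of_pos (show (0 : ℝ) < 1 + lam by linarith)
    linarith
  have hlog2 : Real.log 2 ≤ 0.7 := Real.log_two_lt_d9.le.trans (by norm_num)
  have hlog2' : 0.69 ≤ Real.log 2 := le_trans (by norm_num) Real.log_two_gt_d9.le
  have hlog4 : Real.log 4 = 2 * Real.log 2 := by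
    rw [show (4 : ℝ) = 2 ^ 2 by norm_num, Real.log_pow]
    norm_num
  have hexp := Real.add_one_le_exp (lam : ℝ)
  set I : ℕ := ⌊Real.exp lam / 2⌋₊ + 1
  have hI : Real.exp lam / 2 ≤ I := by
    have := (Nat.lt_floor_add_one (Real.exp lam / 2)).le
    simpa [I] using this
  have hI' : (I : ℝ) ≤ Real.exp lam / 2 + 1 := by
    have := Nat.floor_le (show 0 ≤ Real.exp lam / 2 by positivity)
    simpa [I] using this
  -- Since `11 / 12 ≤ exp (-1 / 12)`, this number of windows gives `(11 / 12) ^ J * lam ≤ 1 / 4`.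
  set J : ℕ := ⌈12 * Real.log (4 * (1 + lam))⌉₊
  -- As `48 ≤ 2 ^ 6` and `3 * log 2 ≥ 2`, this gives `48 * (1 + lam) ^ 2 ≤ b ^ K`, which bounds the
  -- remaining error `(12 * lam + 1) * lam / b ^ K` by `1 / 4`.
  set K : ℕ := ⌈6 + 3 * Real.log (1 + lam)⌉₊
  have hmul : Real.log (4 * (1 + lam)) = 2 * Real.log 2 + Real.log (1 + lam) := by
    rw [Real.log_mul (by norm_num) (by linarith), hlog4]
  have hJ0 : 12 * Real.log (4 * (1 + lam)) ≤ J := Nat.le_ceil _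
  have hJ1 : (J : ℝ) ≤ 18 + 12 * Real.log (1 + lam) := by
    have := (Nat.ceil_lt_add_one (show 0 ≤ 12 * Real.log (4 * (1 + lam)) by
      rw [hmul]; linarith)).le
    rw [hmul] at this
    simp only [J]
    rw [hmul]
    linarith
  have hK0 : 6 + 3 * Real.log (1 + lam) ≤ K := Nat.le_ceil _
  have hK1 : (K : ℝ) ≤ 7 + 3 * lam := by
    have := (Nat.ceil_lt_add_one (show 0 ≤ 6 + 3 * Real.log (1 + lam) by linarith)).le
    linarith
  have hJ2 : (11 / 12 : ℝ) ^ J * lam ≤ 1 / 4 := by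
    have h1 : (11 / 12 : ℝ) ≤ Real.exp (-(1 / 12)) := by
      have := Real.add_one_le_exp (-(1 / 12 : ℝ))
      linarith
    have h2 : (11 / 12 : ℝ) ^ J ≤ (4 * (1 + (lam : ℝ)))⁻¹ := by
      calc _ ≤ Real.exp (-(1 / 12)) ^ J := by gcongr
        _ = Real.exp (-(J / 12)) := by rw [← Real.exp_nat_mul]; ring_nf
        _ ≤ Real.exp (-Real.log (4 * (1 + lam))) := by
          rw [Real.exp_le_exp]
          linarith
        _ = _ := by rw [Real.exp_neg, Real.exp_log (by linarith)]
    calc _ ≤ (4 * (1 + lam : ℝ))⁻¹ * lam := by gcongr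
      _ ≤ _ := by
        rw [inv_mul_le_iff₀ (by linarith)]
        linarith
  have hK2 : 48 * (1 + (lam : ℝ)) ^ 2 ≤ b ^ K := by
    have h1 : Real.log (48 * (1 + lam) ^ 2) ≤ K * Real.log 2 := by
      have h3 : Real.log 48 ≤ 6 * Real.log 2 := by
        rw [← Real.log_rpow (by norm_num)]
        exact Real.log_le_log (by norm_num) (by norm_num)
      rw [Real.log_mul (by norm_num) (by positivity), Real.log_pow]
      push_cast
      nlinarith
    calc _ ≤ (2 : ℝ) ^ K := by
          rw [← Real.log_le_log_iff (by positivity) (by positivity), Real.log_pow]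
          exact h1
      _ ≤ _ := by
        gcongr
        exact_mod_cast hb
  set N := J * (2 * I + K)
  have hent := real_entangled_le hb lam K I J hI hI'
  refine ⟨N, ?_, ?_⟩
  · have h1 := blockMean_le_entangled (b := b) lam K N
    have hfin : blockMean b lam N ≠ ∞ := ne_top_of_le_ne_top (by simp) (blockMean_le_pow lam N)
    have hbe : (b : ℝ≥0∞) ≠ 0 := by exact_mod_cast NeZero.ne b
    have h2 : (blockMean b lam N).toReal ≤
        b ^ N * (edgeMeasure b lam).real (entangled b K N) + b ^ N * ((b : ℝ) ^ K)⁻¹ := by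
      have hinv : ((b : ℝ≥0∞) ^ K)⁻¹ ≠ ∞ := by simp [hbe]
      have := (ENNReal.toReal_le_toReal hfin (by finiteness)).2 h1
      rw [ENNReal.toReal_add (by finiteness) (by finiteness)] at this
      simpa [Measure.real] using this
    rw [← ENNReal.toReal_le_toReal (by finiteness) (by simp), ENNReal.toReal_mul]
    simp only [ENNReal.coe_toReal, NNReal.coe_div, NNReal.coe_pow, NNReal.coe_natCast,
      ENNReal.toReal_div, ENNReal.toReal_one, ENNReal.toReal_ofNat]
    calc (blockMean b lam N).toReal * (lam / b ^ N)
        ≤ (b ^ N * ((11 / 12) ^ J + 12 * (lam / b ^ K)) + b ^ N * ((b : ℝ) ^ K)⁻¹) *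
          (lam / b ^ N) := by
          gcongr
          exact h2.trans (by gcongr)
      _ = (11 / 12) ^ J * lam + (12 * lam + 1) * lam / b ^ K := by
          field_simp
          ring
      _ ≤ 1 / 4 + 1 / 4 := by
          refine add_le_add hJ2 ?_
          rw [div_le_iff₀ (by positivity)]
          nlinarith
      _ = _ := by norm_num
  · simp only [N]
    push_cast
    rw [mul_comm]
    gcongr
    linarith

theorem meanSize_le_exp {b : ℕ} [NeZero b] (hb : 2 ≤ b) (lam : ℝ≥0) :
    meanSize (edgeModel b lam) ≤ ENNReal.ofReal (Real.exp (Real.log 2 +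
      Real.log b * (16 * Real.exp lam * (18 + 12 * Real.log (1 + lam))))) := by
  obtain ⟨N, hN, hN'⟩ := exists_blockMean_small hb lam
  have hb1 : (1 : ℝ) ≤ b := by exact_mod_cast (show 1 ≤ b by omega)
  have hlogb : 0 ≤ Real.log b := Real.log_nonneg hb1
  calc _ ≤ 2 * blockMean b lam N := meanSize_le_of_blockMean hb lam N hN
    _ ≤ 2 * (b : ℝ≥0∞) ^ N := by gcongr; exact blockMean_le_pow lam N
    _ = ENNReal.ofReal (2 * (b : ℝ) ^ N) := by
      rw [ENNReal.ofReal_mul (by norm_num), ENNReal.ofReal_pow (by positivity)]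
      simp
    _ ≤ _ := by
      refine ENNReal.ofReal_le_ofReal ?_
      rw [Real.exp_add, Real.exp_log (by norm_num)]
      gcongr
      calc (b : ℝ) ^ N = Real.exp (Real.log b * N) := by
            rw [mul_comm, Real.exp_nat_mul, Real.exp_log (by linarith)]
        _ ≤ _ := by
          rw [Real.exp_le_exp]
          gcongr

/-- The criterion already holds at scale `0`, where the block is one leaf. The separate case is
needed because the double exponential bound tends to `exp 1` as `lam` tends to `0`. -/
theorem meanSize_le_two {b : ℕ} [NeZero b] (hb : 2 ≤ b) {lam : ℝ≥0} (h : lam ≤ 1 / 2) :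
    meanSize (edgeModel b lam) ≤ 2 := by
  have h0 : blockMean b lam 0 ≤ 1 := by simpa using blockMean_le_pow (b := b) lam 0
  have h2 : ((lam : ℝ≥0) : ℝ≥0∞) ≤ 1 / 2 := by
    calc (lam : ℝ≥0∞) ≤ ((1 / 2 : ℝ≥0) : ℝ≥0∞) := by exact_mod_cast h
      _ = _ := by rw [ENNReal.coe_div (by norm_num)]; rfl
  have : blockMean b lam 0 * (lam / b ^ 0 : ℝ≥0) ≤ 1 / 2 := by
    rw [pow_zero, div_one]
    calc _ ≤ 1 * (1 / 2 : ℝ≥0∞) := mul_le_mul' h0 h2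
      _ = _ := one_mul _
  calc _ ≤ 2 * blockMean b lam 0 := meanSize_le_of_blockMean hb lam 0 this
    _ ≤ 2 * 1 := by gcongr
    _ = 2 := mul_one 2

theorem meanSize_lt_top {b : ℕ} [NeZero b] (hb : 2 ≤ b) (lam : ℝ≥0) :
    meanSize (edgeModel b lam) < ∞ := (meanSize_le_exp hb lam).trans_lt ENNReal.ofReal_lt_top

theorem one_le_meanSize (b : ℕ) (lam : ℝ≥0) : 1 ≤ meanSize (edgeModel b lam) := by
  have : IsProbabilityMeasure (edgeModel b lam) :=
    Measure.isProbabilityMeasure_map (by fun_prop)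
  calc (1 : ℝ≥0∞) = ∫⁻ _, 1 ∂edgeModel b lam := by simp
    _ ≤ _ := lintegral_mono fun X => by
      have := Set.one_le_encard_iff_nonempty.2 ⟨X.2, root_mem_cluster X⟩
      simpa using ENat.toENNReal_le.2 this

theorem exists_meanSize_lt {b : ℕ} [NeZero b] (hb : 2 ≤ b) :
    ∃ C : ℝ, 0 < C ∧ ∀ lam : ℝ≥0, meanSize (edgeModel b lam) <
      ENNReal.ofReal (Real.exp (Real.exp (C * lam))) := by
  have hb1 : (1 : ℝ) ≤ b := by exact_mod_cast (show 1 ≤ b by omega)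
  have hlogb : 0 ≤ Real.log b := Real.log_nonneg hb1
  set D : ℝ := 1 + 288 * Real.log b
  have hD : 1 ≤ D := by simp only [D]; linarith
  have hlogD : 0 ≤ Real.log D := Real.log_nonneg hD
  -- For `lam > 1 / 2` the exponent is at most `D * exp (2 * lam)`, and `log D ≤ 2 * lam * log D`.
  -- The coefficient `3` in place of `2` makes the inequality strict.
  refine ⟨3 + 2 * Real.log D, by linarith, fun lam => ?_⟩
  have hl : (0 : ℝ) ≤ lam := lam.2
  rcases le_or_gt lam (1 / 2) with h | h
  · refine (meanSize_le_two hb h).trans_lt ?_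
    rw [show (2 : ℝ≥0∞) = ENNReal.ofReal 2 by simp, ENNReal.ofReal_lt_ofReal_iff (Real.exp_pos _)]
    have h1 : (1 : ℝ) ≤ Real.exp ((3 + 2 * Real.log D) * lam) :=
      Real.one_le_exp (by positivity)
    have h2 : Real.exp 1 ≤ Real.exp (Real.exp ((3 + 2 * Real.log D) * lam)) :=
      Real.exp_le_exp.2 h1
    have := Real.exp_one_gt_d9
    linarith
  · refine (meanSize_le_exp hb lam).trans_lt ?_
    rw [ENNReal.ofReal_lt_ofReal_iff (Real.exp_pos _), Real.exp_lt_exp]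
    have h' : (1 / 2 : ℝ) < lam := by exact_mod_cast h
    have hlog1 : Real.log (1 + lam) ≤ lam := by
      have := Real.log_le_sub_one_of_pos (show (0 : ℝ) < 1 + lam by linarith)
      linarith
    have hexp := Real.add_one_le_exp (lam : ℝ)
    have hexp2 : Real.exp lam * Real.exp lam = Real.exp (2 * lam) := by
      rw [← Real.exp_add]; ring_nf
    have h1 : 16 * Real.exp lam * (18 + 12 * Real.log (1 + lam)) ≤ 288 * Real.exp (2 * lam) := by
      rw [← hexp2]
      have : 18 + 12 * Real.log (1 + lam) ≤ 18 * Real.exp lam := by linarith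
      nlinarith [Real.exp_pos (lam : ℝ)]
    have h2 : Real.log 2 ≤ Real.exp (2 * lam) := by
      have := Real.log_two_lt_d9
      have := Real.add_one_le_exp (2 * lam : ℝ)
      linarith
    calc _ ≤ Real.exp (2 * lam) + Real.log b * (288 * Real.exp (2 * lam)) := by gcongr
      _ = D * Real.exp (2 * lam) := by simp only [D]; ring
      _ = Real.exp (Real.log D + 2 * lam) := by rw [Real.exp_add, Real.exp_log (by linarith)]
      _ < _ := by
        rw [Real.exp_lt_exp]
        nlinarith

theorem isBigO_log_meanSize {b : ℕ} [NeZero b] (hb : 2 ≤ b) :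
    (fun lam : ℝ≥0 => Real.log (meanSize (edgeModel b lam)).toReal) =O[Filter.atTop]
      (fun lam : ℝ≥0 => Real.exp lam * Real.log lam) := by
  have hb1 : (1 : ℝ) ≤ b := by exact_mod_cast (show 1 ≤ b by omega)
  have hlogb : 0 ≤ Real.log b := Real.log_nonneg hb1
  -- The constant `1600` is `16 * 100`, where `18 + 12 * log (1 + lam) ≤ 100 * log lam` for `lam ≥
  -- 2`; the summand `2` absorbs `log 2`.
  refine Asymptotics.IsBigO.of_bound (2 + Real.log b * 1600) ?_
  filter_upwards [Filter.eventually_ge_atTop (2 : ℝ≥0)] with lam hlam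
  have hlam' : (2 : ℝ) ≤ lam := by exact_mod_cast hlam
  have hχ : 1 ≤ (meanSize (edgeModel b lam)).toReal := by
    rw [← ENNReal.toReal_one]
    exact (ENNReal.toReal_le_toReal (by simp) (meanSize_lt_top hb lam).ne).2 (one_le_meanSize b lam)
  have h2 := Real.log_two_gt_d9
  have hloglam : Real.log 2 ≤ Real.log lam := Real.log_le_log (by norm_num) hlam'
  have hnn : 0 ≤ Real.exp lam * Real.log lam :=
    mul_nonneg (Real.exp_pos _).le (Real.log_nonneg (by linarith))
  have hlog1 : Real.log (1 + lam) ≤ 2 * Real.log lam := by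
    rw [← Real.log_rpow (by linarith)]
    refine Real.log_le_log (by linarith) ?_
    norm_num
    nlinarith
  have hexp := Real.add_one_le_exp (lam : ℝ)
  have hle : Real.log (meanSize (edgeModel b lam)).toReal ≤ Real.log 2 +
      Real.log b * (16 * Real.exp lam * (18 + 12 * Real.log (1 + lam))) := by
    rw [← Real.log_exp (Real.log 2 + _)]
    refine Real.log_le_log (by linarith) ?_
    exact ENNReal.toReal_le_of_le_ofReal (Real.exp_pos _).le (meanSize_le_exp hb lam)
  rw [Real.norm_of_nonneg (Real.log_nonneg hχ), Real.norm_of_nonneg hnn]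
  refine hle.trans ?_
  have h3 : 18 + 12 * Real.log (1 + lam) ≤ 100 * Real.log lam := by linarith
  calc _ ≤ Real.exp lam * Real.log lam +
        Real.log b * (16 * Real.exp lam * (100 * Real.log lam)) := by
        gcongr
        nlinarith
    _ ≤ _ := by
        nlinarith

/-! ### The lower bound for the mean size -/

theorem rate_of_level {b : ℕ} (hb : 2 ≤ b) (lam : ℝ≥0) {n x y : ℕ} (h : x / b ^ n ≠ y / b ^ n)
    (h' : x / b ^ (n + 1) = y / b ^ (n + 1)) : rate b lam x y = lam / b ^ (2 * n + 1) := by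
  induction n generalizing x y with
  | zero => rw [rate_siblings lam (by simpa using h) (by simpa using h')]; simp
  | succ n ih =>
    rw [div_pow_succ, div_pow_succ] at h
    rw [div_pow_succ, div_pow_succ b y] at h'
    rw [rate_parent hb lam (fun e => h (by rw [e])), ih h h', div_div, ← pow_add]
    congr 2

/-- The block of size `b ^ n` with index `z`. -/
def block (b n z : ℕ) : Finset ℕ := Finset.Ico (b ^ n * z) (b ^ n * (z + 1))

theorem mem_block {b : ℕ} [NeZero b] {n z x : ℕ} : x ∈ block b n z ↔ x / b ^ n = z := by
  have hpos : 0 < b ^ n := Nat.pow_pos (Nat.pos_of_neZero b)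
  rw [block, Finset.mem_Ico, Nat.div_eq_iff hpos, Nat.mul_succ, mul_comm]
  omega

/-- All leaves of the block of size `b ^ n` with index `z` are connected within this block. -/
def fullBlock (b n z : ℕ) : Set (MGraph ℕ) :=
  {G | ∀ x ∈ block b n z, ∀ y ∈ block b n z, Conn (SameBlock b n) G x y}

theorem measurableSet_fullBlock (b n z : ℕ) : MeasurableSet (fullBlock b n z) := by
  have : fullBlock b n z = ⋂ x ∈ block b n z, ⋂ y ∈ block b n z,
      {G | Conn (SameBlock b n) G x y} := by
    ext G; simp [fullBlock]
  rw [this]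
  exact Finset.measurableSet_biInter _ fun x _ => Finset.measurableSet_biInter _ fun y _ =>
    measurableSet_conn _ x y

theorem conn_symm {q : ℕ → ℕ → Prop} (hq : ∀ u v, q u v → q v u) {G : MGraph ℕ} {x y : ℕ}
    (h : Conn q G x y) : Conn q G y x := by
  induction h with
  | refl => exact Relation.ReflTransGen.refl
  | tail _ h ih => exact ih.head ⟨hq _ _ h.1, by rw [mult_comm]; exact h.2⟩

/-- There are `b ^ (2 * n)` pairs of leaves, each with rate `lam / b ^ (2 * n + 1)`, so the total
rate is `lam / b` at every scale. -/
theorem real_no_edges_siblings {b : ℕ} [NeZero b] (hb : 2 ≤ b) (lam : ℝ≥0) (n z : ℕ) {i : ℕ}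
    (hi0 : i ≠ 0) (hi : i < b) : (edgeMeasure b lam).real
      {G | ∀ x ∈ block b n (b * z), ∀ y ∈ block b n (b * z + i), mult G x y = 0} =
      Real.exp (-(lam / b)) := by
  have hb0 : (b : ℝ) ≠ 0 := by positivity
  have hrate : ∀ x ∈ block b n (b * z), ∀ y ∈ block b n (b * z + i),
      rate b lam x y = lam / b ^ (2 * n + 1) := by
    intro x hx y hy
    rw [mem_block] at hx hy
    refine rate_of_level hb lam (by omega) ?_
    rw [pow_succ, ← Nat.div_div_eq_div_mul, ← Nat.div_div_eq_div_mul, hx, hy,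
      Nat.mul_div_cancel_left _ (by omega), Nat.mul_add_div (by omega), Nat.div_eq_of_lt hi,
      add_zero]
  have hcard : ∀ w, (block b n w).card = b ^ n := by
    intro w
    rw [block, Nat.card_Ico, Nat.mul_succ, Nat.add_sub_cancel_left]
  rw [Measure.real, edgeMeasure_no_edges, ENNReal.toReal_ofReal (Real.exp_pos _).le]
  · rw [Finset.sum_congr rfl fun x hx => Finset.sum_congr rfl fun y hy => hrate x hx y hy]
    simp only [Finset.sum_const, hcard, nsmul_eq_mul]
    congr 2
    push_cast
    rw [pow_succ, two_mul, pow_add]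
    field_simp
  · rw [Finset.disjoint_left]
    intro x h1 h2
    rw [mem_block] at h1 h2
    omega

/-- A block is connected if its sub-blocks are and the first of them is joined to each of the
others. The failure bounds thus satisfy `p (n + 1) ≤ b * p n + (b - 1) * exp (-lam / b)`, and the
stated expression is a convenient supersolution. -/
theorem real_fullBlock_compl_le {b : ℕ} [NeZero b] (hb : 2 ≤ b) (lam : ℝ≥0) (n z : ℕ) :
    (edgeMeasure b lam).real (fullBlock b n z)ᶜ ≤
      (b ^ n - 1) * (b ^ 2 * Real.exp (-(lam / b))) := by
  have hb2 : (2 : ℝ) ≤ b := by exact_mod_cast hb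
  induction n generalizing z with
  | zero =>
    have : fullBlock b 0 z = Set.univ := by
      refine Set.eq_univ_of_forall fun G x hx y hy => ?_
      rw [mem_block] at hx hy
      obtain rfl : x = y := by simpa using hx.trans hy.symm
      exact Relation.ReflTransGen.refl
    simp [this]
  | succ n ih =>
    let E : ℕ → Set (MGraph ℕ) := fun i =>
      {G | ∀ x ∈ block b n (b * z), ∀ y ∈ block b n (b * z + i), mult G x y = 0}
    have hsub : (fullBlock b (n + 1) z)ᶜ ⊆
        (⋃ i ∈ Finset.range b, (fullBlock b n (b * z + i))ᶜ) ∪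
          ⋃ i ∈ (Finset.range b).erase 0, E i := by
      intro G hG
      by_contra hcon
      refine hG ?_
      simp only [Set.mem_union, Set.mem_iUnion, not_or, not_exists, Set.mem_compl_iff, not_not,
        Finset.mem_range, Finset.mem_erase] at hcon
      obtain ⟨hfull, hedge⟩ := hcon
      have hup : ∀ {x y}, Conn (SameBlock b n) G x y → Conn (SameBlock b (n + 1)) G x y :=
        fun h => Conn.mono (fun _ _ h => SameBlock.mono h (Nat.le_succ n)) h
      have hbase : b ^ n * (b * z) ∈ block b n (b * z) := by
        rw [mem_block, Nat.mul_div_cancel_left _ (Nat.pow_pos (by omega))]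
      have key : ∀ y ∈ block b (n + 1) z,
          Conn (SameBlock b (n + 1)) G (b ^ n * (b * z)) y := by
        intro y hy
        have hy' : y / b ^ n / b = z := by
          rw [mem_block, pow_succ, ← Nat.div_div_eq_div_mul] at hy
          exact hy
        have hmod := Nat.div_add_mod (y / b ^ n) b
        rw [hy'] at hmod
        have hlt : y / b ^ n % b < b := Nat.mod_lt _ (by omega)
        set i := y / b ^ n % b
        have hyi : y ∈ block b n (b * z + i) := mem_block.2 hmod.symm
        by_cases hi : i = 0
        · rw [hi, add_zero] at hyi
          have := hfull 0 (by omega)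
          rw [add_zero] at this
          exact hup (this _ hbase _ hyi)
        · have := hedge i ⟨hi, hlt⟩
          simp only [E, Set.mem_ofPred_eq, not_forall] at this
          obtain ⟨u, hu, v, hv, huv⟩ := this
          have h0 := hfull 0 (by omega)
          rw [add_zero] at h0
          refine (hup (h0 _ hbase _ hu)).trans (Relation.ReflTransGen.head ⟨?_, huv⟩
            (hup (hfull i hlt _ hv _ hyi)))
          rw [mem_block] at hu hv
          rw [SameBlock, pow_succ, ← Nat.div_div_eq_div_mul, ← Nat.div_div_eq_div_mul, hu, hv,
            Nat.mul_div_cancel_left _ (by omega), Nat.mul_add_div (by omega),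
            Nat.div_eq_of_lt hlt, add_zero]
      intro x hx y hy
      exact (conn_symm (fun _ _ h => h.symm) (key x hx)).trans (key y hy)
    calc (edgeMeasure b lam).real (fullBlock b (n + 1) z)ᶜ
        ≤ (edgeMeasure b lam).real (⋃ i ∈ Finset.range b, (fullBlock b n (b * z + i))ᶜ) +
          (edgeMeasure b lam).real (⋃ i ∈ (Finset.range b).erase 0, E i) :=
          (measureReal_mono hsub).trans (measureReal_union_le _ _)
      _ ≤ ∑ i ∈ Finset.range b, (edgeMeasure b lam).real (fullBlock b n (b * z + i))ᶜ +
          ∑ i ∈ (Finset.range b).erase 0, (edgeMeasure b lam).real (E i) :=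
          add_le_add (measureReal_biUnion_finset_le _ _) (measureReal_biUnion_finset_le _ _)
      _ ≤ ∑ i ∈ Finset.range b, (b ^ n - 1 : ℝ) * (b ^ 2 * Real.exp (-(lam / b))) +
          ∑ i ∈ (Finset.range b).erase 0, Real.exp (-(lam / b)) := by
          gcongr with i _ i hi
          · exact ih _
          · rw [Finset.mem_erase, Finset.mem_range] at hi
            exact (real_no_edges_siblings hb lam n z hi.1 hi.2).le
      _ = b * ((b ^ n - 1 : ℝ) * (b ^ 2 * Real.exp (-(lam / b)))) +
          (b - 1) * Real.exp (-(lam / b)) := by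
          rw [Finset.sum_const, Finset.sum_const, Finset.card_erase_of_mem (by simp; omega),
            Finset.card_range, nsmul_eq_mul, nsmul_eq_mul, Nat.cast_sub (by omega), Nat.cast_one]
      _ ≤ _ := by
          have he := Real.exp_pos (-(lam / b : ℝ))
          have : (0 : ℝ) ≤ (b - 1) * (b ^ 2 - 1) * Real.exp (-(lam / b)) := by
            have : (0 : ℝ) ≤ b ^ 2 - 1 := by nlinarith
            have : (0 : ℝ) ≤ b - 1 := by linarith
            positivity
          rw [show (b : ℝ) ^ (n + 1) = b ^ n * b from pow_succ _ _]
          linarith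

theorem blockMean_le_meanSize {b : ℕ} (hb : 2 ≤ b) (lam : ℝ≥0) (n : ℕ) :
    blockMean b lam n ≤ meanSize (edgeModel b lam) := by
  rw [meanSize_edgeModel hb]
  exact le_iSup (blockMean b lam) n

theorem blockMean_ge {b : ℕ} [NeZero b] (hb : 2 ≤ b) (lam : ℝ≥0) (n : ℕ) :
    b ^ n * (1 - b ^ (n + 2) * Real.exp (-(lam / b))) ≤ (blockMean b lam n).toReal := by
  have hfin : blockMean b lam n ≠ ∞ := ne_top_of_le_ne_top (by simp) (blockMean_le_pow lam n)
  have h1 : (b : ℝ≥0∞) ^ n * edgeMeasure b lam (fullBlock b n 0) ≤ blockMean b lam n := by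
    rw [← lintegral_indicator_const (measurableSet_fullBlock b n 0), blockMean]
    refine lintegral_mono fun G => ?_
    by_cases hG : G ∈ fullBlock b n 0
    · rw [Set.indicator_of_mem hG]
      have hsub : (Finset.range (b ^ n) : Set ℕ) ⊆ connSet (SameBlock b n) G 0 := by
        intro y hy
        have hy' : y < b ^ n := by simpa using hy
        exact hG 0 (by rw [mem_block, Nat.zero_div]) y (by rw [mem_block, Nat.div_eq_of_lt hy'])
      have := encard_coe_mono hsub
      rw [Set.encard_coe_eq_coe_finsetCard, Finset.card_range] at this
      simpa using this
    · rw [Set.indicator_of_notMem hG]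
      exact zero_le
  have h2 := (ENNReal.toReal_le_toReal (by finiteness) hfin).2 h1
  rw [ENNReal.toReal_mul, ENNReal.toReal_pow, ENNReal.toReal_natCast] at h2
  have h3 := real_fullBlock_compl_le hb lam n 0
  rw [probReal_compl_eq_one_sub (measurableSet_fullBlock b n 0)] at h3
  refine le_trans ?_ h2
  gcongr
  change _ ≤ (edgeMeasure b lam).real _
  have : 0 ≤ (b : ℝ) ^ 2 * Real.exp (-(lam / b)) := by positivity
  rw [pow_add]
  linarith

/-- Only the root and its sibling `1` are counted. This beats `1` for every positive `lam`, in the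
range where the connected blocks give nothing. -/
theorem two_sub_exp_le_meanSize {b : ℕ} [NeZero b] (hb : 2 ≤ b) (lam : ℝ≥0) :
    2 - Real.exp (-(lam / b)) ≤ (meanSize (edgeModel b lam)).toReal := by
  have hm : MeasurableSet {G : MGraph ℕ | mult G 0 1 = 0} :=
    measurable_mult 0 1 (measurableSet_singleton 0)
  have hp : (edgeMeasure b lam).real {G | mult G 0 1 = 0} = Real.exp (-(lam / b)) := by
    have := edgeMeasure_no_edges b lam (A := {0}) (B := {1}) (by simp)
    rw [Measure.real]
    simp only [Finset.mem_singleton, forall_eq, Finset.sum_singleton] at this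
    rw [this, ENNReal.toReal_ofReal (Real.exp_pos _).le, rate_siblings lam (by simp)]
    · simp
    · rw [Nat.zero_div, Nat.div_eq_of_lt (by omega)]
  have h1 : 1 + edgeMeasure b lam {G | mult G 0 1 = 0}ᶜ ≤ meanSize (edgeModel b lam) := by
    rw [meanSize, edgeModel, lintegral_map measurable_card_cluster (by fun_prop)]
    calc _ = ∫⁻ G, (1 + ({G | mult G 0 1 = 0}ᶜ : Set (MGraph ℕ)).indicator 1 G)
          ∂edgeMeasure b lam := by
          rw [lintegral_add_left measurable_const, lintegral_indicator_one hm.compl]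
          simp
      _ ≤ _ := by
          refine lintegral_mono fun G => ?_
          by_cases hG : mult G 0 1 = 0
          · rw [Set.indicator_of_notMem (by simpa using hG), add_zero]
            have := Set.one_le_encard_iff_nonempty.2 ⟨_, root_mem_cluster (G, 0)⟩
            simpa using ENat.toENNReal_le.2 this
          · rw [Set.indicator_of_mem (by simpa using hG)]
            have hsub : ({0, 1} : Set ℕ) ⊆ cluster (G, 0) := by
              rintro x (rfl | rfl)
              · exact root_mem_cluster (G, 0)
              · exact mem_cluster_of_mult (root_mem_cluster (G, 0)) hG
            have := encard_coe_mono hsub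
            rw [Set.encard_pair (by simp)] at this
            refine le_trans (le_of_eq ?_) this
            norm_num
  have h2 := (ENNReal.toReal_le_toReal (by finiteness) (meanSize_lt_top hb lam).ne).2 h1
  rw [ENNReal.toReal_add (by simp) (by finiteness), ENNReal.toReal_one] at h2
  change 1 + (edgeMeasure b lam).real _ ≤ _ at h2
  rw [probReal_compl_eq_one_sub hm, hp] at h2
  linarith

theorem exists_lt_meanSize {b : ℕ} [NeZero b] (hb : 2 ≤ b) :
    ∃ c : ℝ, 0 < c ∧ ∀ lam : ℝ≥0, 0 < lam →
      ENNReal.ofReal (Real.exp (c * lam)) < meanSize (edgeModel b lam) := by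
  have hb2 : (2 : ℝ) ≤ b := by exact_mod_cast hb
  -- Beyond `l₀`, `exp (lam / (2 * b))` exceeds `4 * b ^ 3`, which absorbs the powers of `b` lost in
  -- the choice of the scale.
  set l₀ : ℝ := 2 * b * Real.log (4 * b ^ 3)
  have hlog : 0 < Real.log (4 * b ^ 3) := Real.log_pos (by
    have : (1 : ℝ) ≤ b ^ 3 := one_le_pow₀ (by linarith)
    linarith)
  have hl₀ : 0 < l₀ := by positivity
  -- For `lam ≤ l₀` put `t = lam / (b + l₀)`. Then `exp (t / 4) < 1 + t ≤ 2 - exp (-lam / b)`.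
  refine ⟨1 / (4 * (b + l₀)), by positivity, fun lam hlam => ?_⟩
  have hl : (0 : ℝ) < lam := hlam
  rw [ENNReal.ofReal_lt_iff_lt_toReal (Real.exp_pos _).le (meanSize_lt_top hb lam).ne]
  rcases le_or_gt (lam : ℝ) l₀ with h | h
  · refine lt_of_lt_of_le ?_ (two_sub_exp_le_meanSize hb lam)
    have h1 : Real.exp (-(lam / b)) ≤ 1 - lam / (b + l₀) := by
      rw [Real.exp_neg, inv_le_comm₀ (Real.exp_pos _)]
      · refine le_trans ?_ (Real.add_one_le_exp _)
        rw [inv_le_comm₀]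
        · rw [div_add_one (by positivity), inv_div]
          have : (b : ℝ) / (lam + b) = 1 - lam / (lam + b) := by field_simp; ring
          rw [this]
          have : (lam : ℝ) / (b + l₀) ≤ lam / (lam + b) :=
            div_le_div_of_nonneg_left hl.le (by positivity) (by linarith)
          linarith
        · rw [sub_pos, div_lt_one (by positivity)]
          linarith
        · positivity
      · rw [sub_pos, div_lt_one (by positivity)]
        linarith
    set t : ℝ := lam / (b + l₀)
    have ht0 : 0 < t := by positivity
    have ht1 : t ≤ 1 := by
      simp only [t]
      rw [div_le_one (by positivity)]
      linarith
    have h2 : 1 / (4 * (b + l₀)) * lam = t / 4 := by simp only [t]; field_simp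
    rw [h2]
    have h3 : Real.exp (t / 4) ≤ 1 / (1 - t / 4) := by
      rw [le_div_iff₀ (by linarith)]
      have := Real.add_one_le_exp (-(t / 4))
      calc _ ≤ Real.exp (t / 4) * Real.exp (-(t / 4)) := by gcongr; linarith
        _ = 1 := by rw [← Real.exp_add]; simp
    have h4 : 1 / (1 - t / 4) < 1 + t := by
      rw [div_lt_iff₀ (by linarith)]
      nlinarith
    linarith
  · set E := Real.exp (lam / (2 * b))
    have hE : 4 * (b : ℝ) ^ 3 < E := by
      rw [← Real.exp_log (show (0 : ℝ) < 4 * b ^ 3 by positivity), Real.exp_lt_exp,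
        lt_div_iff₀ (by positivity)]
      linarith
    have hEE : Real.exp (lam / b) = E * E := by
      rw [← Real.exp_add]
      congr 1
      field_simp
      ring
    have hb3 : (1 : ℝ) ≤ b ^ 3 := one_le_pow₀ (by linarith)
    have hx : 1 ≤ E * E / (2 * b ^ 2) := by
      rw [one_le_div (by positivity)]
      have : (b : ℝ) ^ 2 ≤ b ^ 3 := pow_le_pow_right₀ (by linarith) (by norm_num)
      nlinarith
    -- The largest scale whose failure bound `b ^ (n + 2) * exp (-lam / b)` is at most `1 / 2`;
    -- maximality gives `b ^ n / 2 > E`.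
    obtain ⟨n, hn1, hn2⟩ := exists_nat_pow_near hx (show (1 : ℝ) < b by linarith)
    have h1 := blockMean_ge hb lam n
    have h2 : (b : ℝ) ^ (n + 2) * Real.exp (-(lam / b)) ≤ 1 / 2 := by
      rw [Real.exp_neg, hEE, ← div_eq_mul_inv, div_le_iff₀ (by positivity), pow_add]
      rw [le_div_iff₀ (by positivity)] at hn1
      linarith
    have h3 : (blockMean b lam n).toReal ≤ (meanSize (edgeModel b lam)).toReal :=
      ENNReal.toReal_mono (meanSize_lt_top hb lam).ne (blockMean_le_meanSize hb lam n)
    have h4 : E < (b : ℝ) ^ n * (1 / 2) := by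
      rw [div_lt_iff₀ (by positivity), pow_succ] at hn2
      have h5 : 4 * (b : ℝ) ^ 3 * E < E * E := by gcongr
      have h6 : E * (4 * b ^ 3) < b ^ n * (1 / 2) * (4 * b ^ 3) := by
        calc _ < E * E := by linarith
          _ < b ^ n * b * (2 * b ^ 2) := hn2
          _ = _ := by ring
      exact lt_of_mul_lt_mul_right h6 (by positivity)
    calc Real.exp (1 / (4 * (b + l₀)) * lam) ≤ E := by
          rw [Real.exp_le_exp, div_mul_eq_mul_div, one_mul]
          exact div_le_div_of_nonneg_left hl.le (by positivity) (by linarith)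
      _ < b ^ n * (1 / 2) := h4
      _ ≤ b ^ n * (1 - b ^ (n + 2) * Real.exp (-(lam / b))) := by
          gcongr
          linarith
      _ ≤ _ := h1.trans h3

/-! ### The splitting operation -/

section Split

variable {b : ℕ} [NeZero b]

theorem divModEquiv_child (u : ℕ) (i : Fin b) : Nat.divModEquiv b (b * u + i) = (u, i) := by
  rw [← Equiv.eq_symm_apply]
  simp [Nat.divModEquiv, mul_comm]

theorem exists_child (b : ℕ) [NeZero b] (x : ℕ) : ∃ (u : ℕ) (i : Fin b), x = b * u + i :=
  ⟨x / b, ⟨x % b, Nat.mod_lt _ (Nat.pos_of_neZero b)⟩, (Nat.div_add_mod x b).symm⟩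

theorem child_inj {u v : ℕ} {i j : Fin b} : b * u + i = b * v + j ↔ u = v ∧ i = j := by
  constructor
  · intro h
    have := congrArg (Nat.divModEquiv b) h
    rw [divModEquiv_child, divModEquiv_child] at this
    simpa using this
  · rintro ⟨rfl, rfl⟩
    rfl

theorem mult_split_self (G : MGraph ℕ) (half : ℕ × ℕ × ℕ → Fin b) (new : ℕ × VPair (Fin b) → ℕ)
    (u : ℕ) (i j : Fin b) : mult (split b G half new) (b * u + i) (b * u + j) =
      mult (fun e => new (u, e)) i j := by
  by_cases h : i = j
  · simp [h]
  · rw [split, mult_ofFun _ _ (fun h' => h (child_inj.1 h').2), divModEquiv_child,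
      divModEquiv_child]
    simp

theorem mult_split_of_ne (G : MGraph ℕ) (half : ℕ × ℕ × ℕ → Fin b) (new : ℕ × VPair (Fin b) → ℕ)
    {u v : ℕ} (h : u ≠ v) (i j : Fin b) : mult (split b G half new) (b * u + i) (b * v + j) =
      ((Finset.range (mult G u v)).filter
        fun k => half (u, v, k) = i ∧ half (v, u, k) = j).card := by
  rw [split, mult_ofFun _ _ (fun h' => h (child_inj.1 h').1), divModEquiv_child,
    divModEquiv_child]
  simp [h]

theorem eq_or_mult_of_mult_split {G : MGraph ℕ} {half : ℕ × ℕ × ℕ → Fin b}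
    {new : ℕ × VPair (Fin b) → ℕ} {x y : ℕ} (h : mult (split b G half new) x y ≠ 0) :
    x / b = y / b ∨ mult G (x / b) (y / b) ≠ 0 := by
  obtain ⟨u, i, rfl⟩ := exists_child b x
  obtain ⟨v, j, rfl⟩ := exists_child b y
  rw [mul_add_div_fin, mul_add_div_fin]
  by_cases huv : u = v
  · exact Or.inl huv
  · refine Or.inr fun h0 => h ?_
    rw [mult_split_of_ne _ _ _ huv, h0]
    rfl

/-- Edges of the split graph project to old edges or stay within one family, so its clusters project
into old clusters. -/
theorem div_mem_cluster {X : RGraph} {half : ℕ × ℕ × ℕ → Fin b} {new : ℕ × VPair (Fin b) → ℕ}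
    {i : Fin b} {x : ℕ} (h : x ∈ cluster (splitRooted b (X, half, new, i))) :
    x / b ∈ cluster X := by
  have h' := (reachable_iff _ _ _).1 h
  clear h
  induction h' with
  | refl => simpa [splitRooted, mul_add_div_fin] using root_mem_cluster X
  | tail _ hyz ih =>
    rcases eq_or_mult_of_mult_split hyz with h | h
    · exact h ▸ ih
    · exact mem_cluster_of_mult ih h

/-- Parallel edges are numbered from `0`, so those of the smaller graph are an initial segment and
receive the same end-vertices in both splittings. -/
theorem split_mono {G H : MGraph ℕ} (h : H ≤ G) (half : ℕ × ℕ × ℕ → Fin b)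
    (new : ℕ × VPair (Fin b) → ℕ) : split b H half new ≤ split b G half new := by
  rintro ⟨⟨x, y⟩, he⟩
  have hne : x ≠ y := by simpa using he
  suffices mult (split b H half new) x y ≤ mult (split b G half new) x y by
    rwa [mult_of_ne _ hne, mult_of_ne _ hne] at this
  obtain ⟨u, i, rfl⟩ := exists_child b x
  obtain ⟨v, j, rfl⟩ := exists_child b y
  by_cases huv : u = v
  · subst huv
    rw [mult_split_self, mult_split_self]
  · rw [mult_split_of_ne _ _ _ huv, mult_split_of_ne _ _ _ huv]
    refine Finset.card_le_card (Finset.filter_subset_filter _ ?_)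
    exact Finset.range_subset_range.2 (mult_mono h u v)

/-- The space of the random choices made in one splitting. -/
abbrev Choices (b : ℕ) := (ℕ × ℕ × ℕ → Fin b) × (ℕ × VPair (Fin b) → ℕ) × Fin b

/-- The law of the random choices made in one splitting. -/
def choiceLaw (b : ℕ) [NeZero b] (lam : ℝ≥0) : Measure (Choices b) :=
  (Measure.infinitePi (fun _ : ℕ × ℕ × ℕ => unif b)).prod
    ((Measure.infinitePi (fun _ : ℕ × VPair (Fin b) => poissonMeasure (lam / b))).prod (unif b))

instance (lam : ℝ≥0) : IsProbabilityMeasure (choiceLaw b lam) := by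
  unfold choiceLaw; infer_instance

theorem measurable_split : Measurable fun p : MGraph ℕ × (ℕ × ℕ × ℕ → Fin b) ×
    (ℕ × VPair (Fin b) → ℕ) => split b p.1 p.2.1 p.2.2 := by
  refine measurable_pi_lambda _ ?_
  rintro ⟨⟨x, y⟩, he⟩
  have hne : x ≠ y := by simpa using he
  suffices Measurable fun p : MGraph ℕ × (ℕ × ℕ × ℕ → Fin b) × (ℕ × VPair (Fin b) → ℕ) =>
      mult (split b p.1 p.2.1 p.2.2) x y by
    simpa only [mult_of_ne _ hne] using this
  obtain ⟨u, i, rfl⟩ := exists_child b x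
  obtain ⟨v, j, rfl⟩ := exists_child b y
  by_cases huv : u = v
  · subst huv
    simp only [mult_split_self]
    exact (measurable_mult i j).comp (by fun_prop :
      Measurable fun p : MGraph ℕ × (ℕ × ℕ × ℕ → Fin b) × (ℕ × VPair (Fin b) → ℕ) =>
        fun e => p.2.2 (u, e))
  · simp only [mult_split_of_ne _ _ _ huv]
    let F : ℕ × (ℕ × ℕ × ℕ → Fin b) → ℕ := fun q => ((Finset.range q.1).filter
        fun k => q.2 (u, v, k) = i ∧ q.2 (v, u, k) = j).card
    have hF : Measurable F := by
      refine measurable_from_prod_countable_right fun m => ?_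
      simp only [F, Finset.card_filter]
      refine Finset.measurable_sum _ fun k _ => Measurable.ite ?_ measurable_const measurable_const
      exact (measurableSet_eq_fun (measurable_pi_apply (u, v, k)) measurable_const).inter
        (measurableSet_eq_fun (measurable_pi_apply (v, u, k)) measurable_const)
    exact hF.comp (((measurable_mult u v).comp measurable_fst).prodMk
      (measurable_fst.comp measurable_snd))

theorem measurable_splitRooted : Measurable (splitRooted b) := by
  have h1 : Measurable fun ω : RGraph × Choices b => split b ω.1.1 ω.2.1 ω.2.2.1 :=
    measurable_split.comp (g := fun p : MGraph ℕ × (ℕ × ℕ × ℕ → Fin b) ×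
      (ℕ × VPair (Fin b) → ℕ) => split b p.1 p.2.1 p.2.2)
      (f := fun ω : RGraph × Choices b => (ω.1.1, ω.2.1, ω.2.2.1)) (by fun_prop)
  have h2 : Measurable fun ω : RGraph × Choices b => b * ω.1.2 + (ω.2.2.2 : ℕ) :=
    (measurable_of_countable (fun p : ℕ × Fin b => b * p.1 + (p.2 : ℕ))).comp
      (f := fun ω : RGraph × Choices b => (ω.1.2, ω.2.2.2)) (by fun_prop)
  exact h1.prodMk h2

theorem lintegral_splitLaw (lam : ℝ≥0) (μ : Measure RGraph) {f : RGraph → ℝ≥0∞}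
    (hf : Measurable f) : ∫⁻ X, f X ∂splitLaw b lam μ =
      ∫⁻ X, ∫⁻ ω, f (splitRooted b (X, ω)) ∂choiceLaw b lam ∂μ := by
  change ∫⁻ X, f X ∂((μ.prod (choiceLaw b lam)).map (splitRooted b)) = _
  rw [lintegral_map hf measurable_splitRooted]
  exact lintegral_prod _ (hf.comp measurable_splitRooted).aemeasurable

theorem measurable_lintegral_split (lam : ℝ≥0) {f : RGraph → ℝ≥0∞} (hf : Measurable f) :
    Measurable fun X => ∫⁻ ω, f (splitRooted b (X, ω)) ∂choiceLaw b lam :=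
  (hf.comp measurable_splitRooted).lintegral_prod_right'

/-! ### Splitting isomorphic multigraphs -/

/-- Only choices on the old cluster matter, so the two families of choices need to correspond only
there. -/
theorem splitRooted_iso {X Y : RGraph} (φ : ℕ → ℕ) (hroot : φ X.2 = Y.2)
    (hinj : Set.InjOn φ (cluster X))
    (hmult : ∀ x ∈ cluster X, ∀ x' ∈ cluster X, mult Y.1 (φ x) (φ x') = mult X.1 x x')
    (hclosed : ∀ x ∈ cluster X, ∀ y, mult Y.1 (φ x) y ≠ 0 → ∃ x' ∈ cluster X, φ x' = y)
    {half half' : ℕ × ℕ × ℕ → Fin b} {new new' : ℕ × VPair (Fin b) → ℕ} (i : Fin b)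
    (hhalf : ∀ u ∈ cluster X, ∀ v ∈ cluster X, ∀ k, half' (φ u, φ v, k) = half (u, v, k))
    (hnew : ∀ u ∈ cluster X, ∀ e, new' (φ u, e) = new (u, e)) :
    Iso (splitRooted b (X, half, new, i)) (splitRooted b (Y, half', new', i)) := by
  have hmult' : ∀ u ∈ cluster X, ∀ v ∈ cluster X, ∀ i j : Fin b,
      mult (split b Y.1 half' new') (b * φ u + i) (b * φ v + j) =
        mult (split b X.1 half new) (b * u + i) (b * v + j) := by
    intro u hu v hv i j
    by_cases huv : u = v
    · subst huv
      rw [mult_split_self, mult_split_self]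
      congr 1
      ext e
      exact hnew u hu e
    · rw [mult_split_of_ne _ _ _ huv, mult_split_of_ne _ _ _ (hinj.ne hu hv huv), hmult u hu v hv]
      congr 1
      refine Finset.filter_congr fun k _ => ?_
      rw [hhalf u hu v hv, hhalf v hv u hu]
  refine iso_of_map (fun x => b * φ (x / b) + x % b) ?_ ?_ ?_ ?_
  · simp only [splitRooted, mul_add_div_fin, mul_add_mod_fin, hroot]
  · intro x hx y hy hxy
    have hx' := div_mem_cluster hx
    have hy' := div_mem_cluster hy
    obtain ⟨u, i, rfl⟩ := exists_child b x
    obtain ⟨v, j, rfl⟩ := exists_child b y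
    simp only [mul_add_div_fin, mul_add_mod_fin] at hx' hy' hxy
    rw [child_inj] at hxy ⊢
    exact ⟨hinj hx' hy' hxy.1, hxy.2⟩
  · intro x hx y hy
    have hx' := div_mem_cluster hx
    have hy' := div_mem_cluster hy
    obtain ⟨u, i, rfl⟩ := exists_child b x
    obtain ⟨v, j, rfl⟩ := exists_child b y
    simp only [mul_add_div_fin, mul_add_mod_fin] at hx' hy' ⊢
    exact hmult' u hx' v hy' i j
  · intro x hx y hxy
    have hx' := div_mem_cluster hx
    obtain ⟨u, i, rfl⟩ := exists_child b x
    obtain ⟨w, j, rfl⟩ := exists_child b y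
    simp only [mul_add_div_fin, mul_add_mod_fin] at hx' hxy
    obtain ⟨v, hv, rfl⟩ : ∃ v ∈ cluster X, φ v = w := by
      rcases eq_or_mult_of_mult_split hxy with h | h
      · rw [mul_add_div_fin, mul_add_div_fin] at h
        exact ⟨u, hx', h⟩
      · rw [mul_add_div_fin, mul_add_div_fin] at h
        exact hclosed u hx' w h
    refine ⟨b * v + j, ?_, by rw [mul_add_div_fin, mul_add_mod_fin]⟩
    refine mem_cluster_of_mult hx ?_
    change mult (split b X.1 half new) _ _ ≠ 0
    rw [← hmult' u hx' v hv]
    exact hxy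

/-- Reading the choices for a multigraph off from choices with a larger index set. -/
def pullChoices {J : Type} (e : ℕ → J)
    (ω : (J × J × ℕ → Fin b) × (J × VPair (Fin b) → ℕ) × Fin b) : Choices b :=
  (fun p => ω.1 (e p.1, e p.2.1, p.2.2), fun p => ω.2.1 (e p.1, p.2), ω.2.2)

theorem measurePreserving_pullChoices {J : Type} (lam : ℝ≥0) {e : ℕ → J}
    (he : Function.Injective e) : MeasurePreserving (pullChoices (b := b) e)
      ((Measure.infinitePi (fun _ : J × J × ℕ => unif b)).prod
        ((Measure.infinitePi (fun _ : J × VPair (Fin b) => poissonMeasure (lam / b))).prod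
          (unif b))) (choiceLaw b lam) := by
  have h1 : MeasurePreserving (fun (ω : J × J × ℕ → Fin b) (p : ℕ × ℕ × ℕ) =>
      ω (e p.1, e p.2.1, p.2.2)) (Measure.infinitePi (fun _ => unif b))
      (Measure.infinitePi (fun _ => unif b)) :=
    ⟨by fun_prop, Measure.map_infinitePi_infinitePi_of_inj (P := fun _ : J × J × ℕ => unif b)
      (f := fun p : ℕ × ℕ × ℕ => (e p.1, e p.2.1, p.2.2)) (by
        rintro ⟨x, y, k⟩ ⟨x', y', k'⟩ h
        simp only [Prod.mk.injEq] at h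
        rw [he h.1, he h.2.1, h.2.2])⟩
  have h2 : MeasurePreserving (fun (ω : J × VPair (Fin b) → ℕ) (p : ℕ × VPair (Fin b)) =>
      ω (e p.1, p.2)) (Measure.infinitePi (fun _ => poissonMeasure (lam / b)))
      (Measure.infinitePi (fun _ => poissonMeasure (lam / b))) :=
    ⟨by fun_prop, Measure.map_infinitePi_infinitePi_of_inj
      (P := fun _ : J × VPair (Fin b) => poissonMeasure (lam / b))
      (f := fun p : ℕ × VPair (Fin b) => (e p.1, p.2)) (by
        rintro ⟨x, y⟩ ⟨x', y'⟩ h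
        simp only [Prod.mk.injEq] at h
        rw [he h.1, h.2])⟩
  exact h1.prod (h2.prod (MeasurePreserving.id _))

theorem lintegral_split_iso (lam : ℝ≥0) {f : RGraph → ℝ≥0∞} (hf : Measurable f)
    (hiso : ∀ X Y, Iso X Y → f X = f Y) {X Y : RGraph} (h : Iso X Y) :
    ∫⁻ ω, f (splitRooted b (X, ω)) ∂choiceLaw b lam =
      ∫⁻ ω, f (splitRooted b (Y, ω)) ∂choiceLaw b lam := by
  classical
  obtain ⟨ψ, hroot, hmult⟩ := h
  let φ : ℕ → ℕ := fun x => if hx : x ∈ cluster X then ψ ⟨x, hx⟩ else 0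
  have hφ : ∀ x (hx : x ∈ cluster X), φ x = ψ ⟨x, hx⟩ := fun x hx => by simp [φ, hx]
  -- The isomorphism `φ` need not extend to a permutation of `ℕ`. Choices indexed by two copies of
  -- `ℕ` solve this: the cluster of `X` reads the first copy through `φ`, the other vertices read
  -- the second copy, and `Y` reads the first copy. Both readings are injective, hence have the
  -- right law.
  let e : ℕ → ℕ ⊕ ℕ := fun x => if x ∈ cluster X then Sum.inl (φ x) else Sum.inr x
  have hφinj : Set.InjOn φ (cluster X) := by
    intro x hx y hy hxy
    rw [hφ x hx, hφ y hy] at hxy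
    simpa using ψ.injective (Subtype.ext hxy)
  have he : Function.Injective e := by
    intro x y hxy
    by_cases hx : x ∈ cluster X <;> by_cases hy : y ∈ cluster X <;> simp [e, hx, hy] at hxy
    · exact hφinj hx hy hxy
    · exact hxy
  have hfm : ∀ X, Measurable fun ω => f (splitRooted b (X, ω)) := fun X =>
    (hf.comp measurable_splitRooted).comp measurable_prodMk_left
  rw [← (measurePreserving_pullChoices lam he).lintegral_comp (hfm X),
    ← (measurePreserving_pullChoices lam (Sum.inl_injective (α := ℕ) (β := ℕ))).lintegral_comp
      (hfm Y)]
  refine lintegral_congr fun ω => hiso _ _ ?_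
  have hel : ∀ x ∈ cluster X, e x = Sum.inl (φ x) := fun x hx => by simp [e, hx]
  refine splitRooted_iso φ ?_ hφinj ?_ ?_ _ ?_ ?_
  · rw [hφ _ (root_mem_cluster X)]
    exact hroot ⟨X.2, root_mem_cluster X⟩ rfl
  · intro x hx x' hx'
    rw [hφ x hx, hφ x' hx']
    exact hmult ⟨x, hx⟩ ⟨x', hx'⟩
  · intro x hx y hxy
    rw [hφ x hx] at hxy
    have hy : y ∈ cluster Y := mem_cluster_of_mult (ψ ⟨x, hx⟩).2 hxy
    refine ⟨ψ.symm ⟨y, hy⟩, (ψ.symm ⟨y, hy⟩).2, ?_⟩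
    rw [hφ _ (ψ.symm ⟨y, hy⟩).2]
    simp
  · intro u hu v hv k
    simp only [hel u hu, hel v hv]
  · intro u hu p
    simp only [hel u hu]

theorem SameLaw.split {μ ν : Measure RGraph} (lam : ℝ≥0) (h : SameLaw μ ν) :
    SameLaw (splitLaw b lam μ) (splitLaw b lam ν) := by
  intro A hA hi
  have hiso : ∀ X Y, Iso X Y → A.indicator (1 : RGraph → ℝ≥0∞) X = A.indicator 1 Y := by
    intro X Y hXY
    have := hi X Y hXY
    by_cases hX : X ∈ A
    · rw [Set.indicator_of_mem hX, Set.indicator_of_mem (this.1 hX)]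
      rfl
    · rw [Set.indicator_of_notMem hX, Set.indicator_of_notMem (mt this.2 hX)]
  have hf : Measurable (A.indicator (1 : RGraph → ℝ≥0∞)) := measurable_one.indicator hA
  rw [← lintegral_indicator_one hA, ← lintegral_indicator_one hA, lintegral_splitLaw lam _ hf,
    lintegral_splitLaw lam _ hf]
  exact h.lintegral_eq (measurable_lintegral_split lam hf)
    fun X Y hXY => lintegral_split_iso lam hf hiso hXY

theorem SameLaw.iterate_split {μ ν : Measure RGraph} (lam : ℝ≥0) (h : SameLaw μ ν) (n : ℕ) :
    SameLaw ((splitLaw b lam)^[n] μ) ((splitLaw b lam)^[n] ν) := by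
  induction n with
  | zero => exact h
  | succ n ih =>
    rw [Function.iterate_succ_apply', Function.iterate_succ_apply']
    exact ih.split lam

theorem sameLaw_iterate {μ : Measure RGraph} {lam : ℝ≥0} (h : SameLaw (splitLaw b lam μ) μ)
    (n : ℕ) : SameLaw ((splitLaw b lam)^[n] μ) μ := by
  induction n with
  | zero => exact fun _ _ _ => rfl
  | succ n ih =>
    rw [Function.iterate_succ_apply']
    exact (ih.split lam).trans h

end Split

/-! ### Splitting two nested multigraphs simultaneously -/

section Pairs

variable {b : ℕ} [NeZero b]

/-- Codes for two multigraphs with a common root. -/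
abbrev GPair := MGraph ℕ × MGraph ℕ × ℕ

/-- The first of two multigraphs with a common root. -/
def GPair.fst (p : GPair) : RGraph := (p.1, p.2.2)

/-- Splitting two multigraphs with the same random choices. -/
def splitPair (b : ℕ) [NeZero b] (q : GPair × Choices b) : GPair :=
  (split b q.1.1 q.2.1 q.2.2.1, splitRooted b (q.1.2, q.2))

/-- The law of the result of splitting two multigraphs simultaneously. -/
def splitPairLaw (b : ℕ) [NeZero b] (lam : ℝ≥0) (m : Measure GPair) : Measure GPair :=
  (m.prod (choiceLaw b lam)).map (splitPair b)

theorem measurable_gpair_fst : Measurable GPair.fst :=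
  (measurable_fst (α := MGraph ℕ) (β := MGraph ℕ × ℕ)).prodMk
    (measurable_snd.comp measurable_snd)

theorem measurable_splitPair : Measurable (splitPair b) := by
  have h1 : Measurable fun q : GPair × Choices b => split b q.1.1 q.2.1 q.2.2.1 :=
    measurable_split.comp (g := fun p : MGraph ℕ × (ℕ × ℕ × ℕ → Fin b) ×
      (ℕ × VPair (Fin b) → ℕ) => split b p.1 p.2.1 p.2.2)
      (f := fun q : GPair × Choices b => (q.1.1, q.2.1, q.2.2.1)) (by fun_prop)
  have h2 : Measurable fun q : GPair × Choices b => splitRooted b (q.1.2, q.2) :=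
    measurable_splitRooted.comp (f := fun q : GPair × Choices b => (q.1.2, q.2)) (by fun_prop)
  exact h1.prodMk h2

theorem lintegral_splitPairLaw (lam : ℝ≥0) (m : Measure GPair) {f : GPair → ℝ≥0∞}
    (hf : Measurable f) : ∫⁻ p, f p ∂splitPairLaw b lam m =
      ∫⁻ p, ∫⁻ ω, f (splitPair b (p, ω)) ∂choiceLaw b lam ∂m := by
  rw [splitPairLaw, lintegral_map hf measurable_splitPair]
  exact lintegral_prod _ (hf.comp measurable_splitPair).aemeasurable

theorem fst_splitPair (p : GPair) (ω : Choices b) :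
    (splitPair b (p, ω)).fst = splitRooted b (p.fst, ω) := rfl

theorem map_fst_splitPairLaw (lam : ℝ≥0) (m : Measure GPair) :
    (splitPairLaw b lam m).map GPair.fst = splitLaw b lam (m.map GPair.fst) := by
  refine Measure.ext_of_lintegral _ fun f hf => ?_
  rw [lintegral_map hf measurable_gpair_fst, lintegral_splitLaw lam _ hf,
    lintegral_map (measurable_lintegral_split lam hf) measurable_gpair_fst,
    lintegral_splitPairLaw lam _ (f := fun p => f p.fst) (hf.comp measurable_gpair_fst)]
  simp only [fst_splitPair]

theorem map_snd_splitPairLaw (lam : ℝ≥0) (m : Measure GPair) :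
    (splitPairLaw b lam m).map Prod.snd = splitLaw b lam (m.map Prod.snd) := by
  refine Measure.ext_of_lintegral _ fun f hf => ?_
  rw [lintegral_map hf measurable_snd, lintegral_splitLaw lam _ hf,
    lintegral_map (measurable_lintegral_split lam hf) measurable_snd,
    lintegral_splitPairLaw lam _ (f := fun p => f p.2) (hf.comp measurable_snd)]
  rfl

theorem measurableSet_nested : MeasurableSet {p : GPair | p.2.1 ≤ p.1} := by
  have : {p : GPair | p.2.1 ≤ p.1} = ⋂ e, {p : GPair | p.2.1 e ≤ p.1 e} := by
    ext p; simp [Pi.le_def]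
  rw [this]
  exact MeasurableSet.iInter fun e => measurableSet_le (by fun_prop) (by fun_prop)

theorem nested_splitPairLaw (lam : ℝ≥0) {m : Measure GPair} [SFinite m]
    (h : ∀ᵐ p ∂m, p.2.1 ≤ p.1) : ∀ᵐ p ∂splitPairLaw b lam m, p.2.1 ≤ p.1 := by
  rw [splitPairLaw, ae_map_iff measurable_splitPair.aemeasurable measurableSet_nested]
  filter_upwards [Measure.quasiMeasurePreserving_fst.ae h] with q hq
  exact split_mono hq _ _

/-- The number of edges at `u` that are present only in the first multigraph. -/
def excess (u : ℕ) (p : GPair) : ℝ≥0∞ := ∑' v, ((mult p.1 u v - mult p.2.1 u v : ℕ) : ℝ≥0∞)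

theorem measurable_excess (u : ℕ) : Measurable (excess u) := by
  refine Measurable.tsum fun v => ?_
  have h : Measurable fun p : GPair => (mult p.1 u v, mult p.2.1 u v) :=
    ((measurable_mult u v).comp measurable_fst).prodMk
      ((measurable_mult u v).comp (measurable_fst.comp measurable_snd))
  exact (measurable_of_countable fun q : ℕ × ℕ => ((q.1 - q.2 : ℕ) : ℝ≥0∞)).comp h

theorem card_filter_range_sub (P : ℕ → Prop) [DecidablePred P] (a c : ℕ) :
    ((Finset.range a).filter P).card - ((Finset.range c).filter P).card =
      ((Finset.Ico c a).filter P).card := by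
  simp only [Finset.card_filter]
  rcases le_total c a with h | h
  · rw [← Finset.sum_range_add_sum_Ico _ h, Nat.add_sub_cancel_left]
  · rw [Finset.Ico_eq_empty (by omega), Finset.sum_empty, Nat.sub_eq_zero_iff_le]
    exact Finset.sum_le_sum_of_subset (Finset.range_subset_range.2 h)

/-- New sibling edges are common to both graphs and cancel. A surplus edge at `u` contributes to
child `i` exactly if its half at `u` is `i`, whatever its other half is. -/
theorem excess_splitPair (p : GPair) (ω : Choices b) (u : ℕ) (i : Fin b) :
    excess (b * u + i) (splitPair b (p, ω)) =
      ∑' v, ∑ k ∈ Finset.Ico (mult p.2.1 u v) (mult p.1 u v),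
        (if ω.1 (u, v, k) = i then 1 else 0 : ℝ≥0∞) := by
  rw [excess, tsum_divMod (b := b)]
  refine tsum_congr fun v => ?_
  by_cases huv : u = v
  · subst huv
    simp [splitPair, splitRooted, mult_split_self]
  · simp only [splitPair, splitRooted, mult_split_of_ne _ _ _ huv, card_filter_range_sub]
    simp only [Finset.card_filter, Nat.cast_sum]
    rw [Finset.sum_comm]
    refine Finset.sum_congr rfl fun k _ => ?_
    by_cases h : ω.1 (u, v, k) = i
    · simp [h]
    · simp [h]

/-! ### Decay of the surplus edges under simultaneous splitting. -/

theorem unif_singleton (i : Fin b) : unif b {i} = (b : ℝ≥0∞)⁻¹ := by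
  rw [unif, PMF.toMeasure_apply_singleton _ _ (measurableSet_singleton i)]
  simp

theorem split_congr_half (H : MGraph ℕ) {half half' : ℕ × ℕ × ℕ → Fin b}
    (new : ℕ × VPair (Fin b) → ℕ) (h : ∀ u v, ∀ k < mult H u v, half (u, v, k) = half' (u, v, k)) :
    split b H half new = split b H half' new := by
  ext ⟨⟨x, y⟩, he⟩
  have hne : x ≠ y := by simpa using he
  suffices mult (split b H half new) x y = mult (split b H half' new) x y by
    rwa [mult_of_ne _ hne, mult_of_ne _ hne] at this
  obtain ⟨u, i, rfl⟩ := exists_child b x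
  obtain ⟨v, j, rfl⟩ := exists_child b y
  by_cases huv : u = v
  · subst huv
    rw [mult_split_self, mult_split_self]
  · rw [mult_split_of_ne _ _ _ huv, mult_split_of_ne _ _ _ huv]
    congr 1
    refine Finset.filter_congr fun k hk => ?_
    rw [Finset.mem_range] at hk
    rw [h u v k hk, h v u k (by rwa [mult_comm])]

/-- The splitting of `Y` reads only halves numbered below the multiplicity in `Y`. The half of a
surplus edge is therefore independent of it and equals `i` with probability `1 / b`. -/
theorem lintegral_half_mul (lam : ℝ≥0) {F : RGraph → ℝ≥0∞} (hF : Measurable F) (Y : RGraph)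
    {u v k : ℕ} (hk : mult Y.1 u v ≤ k) (i : Fin b) :
    ∫⁻ ω : Choices b, (if ω.1 (u, v, k) = i then 1 else 0) * F (splitRooted b (Y, ω))
        ∂choiceLaw b lam =
      (b : ℝ≥0∞)⁻¹ * ∫⁻ ω, F (splitRooted b (Y, ω)) ∂choiceLaw b lam := by
  have hF' : Measurable fun ω : Choices b => F (splitRooted b (Y, ω)) :=
    (hF.comp measurable_splitRooted).comp measurable_prodMk_left
  have hi : Measurable fun h : ℕ × ℕ × ℕ → Fin b => (if h (u, v, k) = i then 1 else 0 : ℝ≥0∞) :=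
    Measurable.ite (measurableSet_eq_fun (measurable_pi_apply (u, v, k)) measurable_const)
      measurable_const measurable_const
  have hi' : Measurable fun ω : Choices b =>
      (if ω.1 (u, v, k) = i then 1 else 0 : ℝ≥0∞) * F (splitRooted b (Y, ω)) :=
    (hi.comp measurable_fst).mul hF'
  rw [choiceLaw, lintegral_prod_symm' _ hi', lintegral_prod_symm' _ hF',
    ← lintegral_const_mul _ hF'.lintegral_prod_left']
  refine lintegral_congr fun z => ?_
  have hdep : DependsOn (fun h : ℕ × ℕ × ℕ → Fin b => F (splitRooted b (Y, h, z)))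
      {(u, v, k)}ᶜ := fun h h' hh => by
    have : split b Y.1 h z.1 = split b Y.1 h' z.1 := by
      refine split_congr_half _ _ fun x y l hl => hh _ ?_
      rintro e
      simp only [Set.mem_singleton_iff, Prod.mk.injEq] at e
      obtain ⟨rfl, rfl, rfl⟩ := e
      omega
    simp only [splitRooted, this]
  have hdep' : DependsOn (fun h : ℕ × ℕ × ℕ → Fin b => (if h (u, v, k) = i then 1 else 0 : ℝ≥0∞))
      {(u, v, k)} := fun h h' hh => by
    simp only [hh (u, v, k) rfl]
  have hFz : Measurable fun h : ℕ × ℕ × ℕ → Fin b => F (splitRooted b (Y, h, z)) :=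
    hF'.comp (f := fun h => (h, z)) measurable_prodMk_right
  refine (lintegral_mul_of_dependsOn (fun _ => unif b) hi hFz hdep' hdep
    disjoint_compl_right).trans ?_
  congr 1
  have hS : MeasurableSet {h : ℕ × ℕ × ℕ → Fin b | h (u, v, k) = i} :=
    measurableSet_eq_fun (measurable_pi_apply (u, v, k)) measurable_const
  have : (fun h : ℕ × ℕ × ℕ → Fin b => (if h (u, v, k) = i then 1 else 0 : ℝ≥0∞)) =
      {h : ℕ × ℕ × ℕ → Fin b | h (u, v, k) = i}.indicator 1 := by
    ext h
    simp [Set.indicator]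
  rw [this, lintegral_indicator_one hS]
  have hp := (measurePreserving_eval_infinitePi (fun _ : ℕ × ℕ × ℕ => unif b)
    (u, v, k)).measure_preimage (s := ({i} : Set (Fin b)))
      (measurableSet_singleton i).nullMeasurableSet
  rw [unif_singleton] at hp
  exact hp

/-- The mean excess at `u`, conditionally on the second multigraph, is controlled on the event that
`u` is connected to the root in that multigraph. -/
def ExcessBound (c : ℝ≥0∞) (m : Measure GPair) (ν : Measure RGraph) : Prop :=
  ∀ u, ∀ F : RGraph → ℝ≥0∞, Measurable F → (∀ Y, u ∉ cluster Y → F Y = 0) →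
    ∫⁻ p, excess u p * F p.2 ∂m ≤ c * ∫⁻ Y, F Y ∂ν

/-- Averaging the test function over the choices gives a test function of the old graph; it vanishes
unless `u` is in the old cluster, because clusters project to parents. Each surplus edge at `u` then
contributes the factor `1 / b`. -/
theorem ExcessBound.split {c : ℝ≥0∞} {m : Measure GPair} {ν : Measure RGraph}
    (h : ExcessBound c m ν) (lam : ℝ≥0) :
    ExcessBound (c * (b : ℝ≥0∞)⁻¹) (splitPairLaw b lam m) (splitLaw b lam ν) := by
  intro x F hF hx
  obtain ⟨u, i, rfl⟩ := exists_child b x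
  let F' : RGraph → ℝ≥0∞ := fun Y => ∫⁻ ω, F (splitRooted b (Y, ω)) ∂choiceLaw b lam
  have hF' : Measurable F' := measurable_lintegral_split lam hF
  have hu : ∀ Y, u ∉ cluster Y → F' Y = 0 := by
    intro Y hY
    simp only [F']
    rw [lintegral_eq_zero_of_ae_eq_zero]
    refine Filter.Eventually.of_forall fun ω => hx _ fun hmem => hY ?_
    have := div_mem_cluster hmem
    rwa [mul_add_div_fin] at this
  have hinner : ∀ p : GPair, ∫⁻ ω, excess (b * u + i) (splitPair b (p, ω)) *
      F (splitPair b (p, ω)).2 ∂choiceLaw b lam = (b : ℝ≥0∞)⁻¹ * (excess u p * F' p.2) := by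
    intro p
    have hFm : Measurable fun ω : Choices b => F (splitRooted b (p.2, ω)) :=
      (hF.comp measurable_splitRooted).comp measurable_prodMk_left
    have hi : ∀ v k, Measurable fun ω : Choices b =>
        (if ω.1 (u, v, k) = i then 1 else 0 : ℝ≥0∞) * F (splitRooted b (p.2, ω)) := fun v k =>
      (Measurable.ite (measurableSet_eq_fun ((measurable_pi_apply (u, v, k)).comp measurable_fst)
        measurable_const) measurable_const measurable_const).mul hFm
    have hrw : ∀ ω, excess (b * u + i) (splitPair b (p, ω)) * F (splitPair b (p, ω)).2 =
        ∑' v, ∑ k ∈ Finset.Ico (mult p.2.1 u v) (mult p.1 u v),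
          (if ω.1 (u, v, k) = i then 1 else 0 : ℝ≥0∞) * F (splitRooted b (p.2, ω)) := by
      intro ω
      rw [excess_splitPair, ← ENNReal.tsum_mul_right]
      simp only [Finset.sum_mul]
      rfl
    simp only [hrw]
    rw [lintegral_tsum fun v => (Finset.measurable_fun_sum _ fun k _ => hi v k).aemeasurable]
    simp only [lintegral_finsetSum _ fun k _ => hi _ k]
    calc _ = ∑' v, ∑ k ∈ Finset.Ico (mult p.2.1 u v) (mult p.1 u v),
          (b : ℝ≥0∞)⁻¹ * F' p.2 := by
          refine tsum_congr fun v => Finset.sum_congr rfl fun k hk => ?_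
          exact lintegral_half_mul lam hF p.2 (Finset.mem_Ico.1 hk).1 i
      _ = _ := by
          simp only [Finset.sum_const, Nat.card_Ico, nsmul_eq_mul]
          rw [ENNReal.tsum_mul_right, excess]
          ring
  have hm : ∀ (x : ℕ) {F : RGraph → ℝ≥0∞}, Measurable F →
      Measurable fun p : GPair => excess x p * F p.2 := fun x F hF =>
    (measurable_excess x).mul (hF.comp measurable_snd)
  rw [lintegral_splitPairLaw lam _ (hm _ hF), lintegral_splitLaw lam _ hF]
  simp only [hinner]
  rw [lintegral_const_mul _ (hm _ hF'), mul_comm c, mul_assoc]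
  gcongr
  exact h u F' hF' hu

/-- If no surplus edge touches the smaller cluster, it is also the full cluster of the root in the
larger graph. -/
theorem iso_of_excess {p : GPair} (hle : p.2.1 ≤ p.1) (h : ∀ u ∈ cluster p.2, excess u p = 0) :
    Iso p.2 p.fst := by
  have heq : ∀ u ∈ cluster p.2, ∀ v, mult p.1 u v = mult p.2.1 u v := by
    intro u hu v
    have h0 := (ENNReal.tsum_eq_zero.1 (h u hu)) v
    rw [Nat.cast_eq_zero] at h0
    have := mult_mono hle u v
    omega
  refine iso_of_map id rfl Function.injective_id.injOn (fun x hx y _ => heq x hx y) ?_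
  intro x hx y hy
  refine ⟨y, mem_cluster_of_mult hx ?_, rfl⟩
  rw [← heq x hx y]
  exact hy

/-- Markov's inequality, as a nonzero excess is at least `1`, and a union bound over `u`; the
probabilities of `u ∈ cluster` add up to the mean size. -/
theorem measure_excess_le {c : ℝ≥0∞} {m : Measure GPair} {ν : Measure RGraph}
    (h : ExcessBound c m ν) :
    m {p | ∃ u ∈ cluster p.2, excess u p ≠ 0} ≤ c * meanSize ν := by
  have hm : ∀ u, MeasurableSet {Y : RGraph | u ∈ cluster Y} := measurableSet_mem_cluster
  have hone : ∀ u p, excess u p ≠ 0 → 1 ≤ excess u p := by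
    intro u p hne
    obtain ⟨v, hv⟩ : ∃ v, ((mult p.1 u v - mult p.2.1 u v : ℕ) : ℝ≥0∞) ≠ 0 := by
      by_contra hcon
      push Not at hcon
      exact hne (ENNReal.tsum_eq_zero.2 hcon)
    refine le_trans ?_ (ENNReal.le_tsum v)
    rw [Nat.cast_ne_zero] at hv
    exact_mod_cast Nat.one_le_iff_ne_zero.2 hv
  have hpoint : ∀ u, m {p | u ∈ cluster p.2 ∧ excess u p ≠ 0} ≤
      c * ∫⁻ Y, {Y : RGraph | u ∈ cluster Y}.indicator 1 Y ∂ν := by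
    intro u
    refine le_trans ?_ (h u _ (measurable_one.indicator (hm u)) fun Y hY =>
      Set.indicator_of_notMem (s := {Y : RGraph | u ∈ cluster Y}) hY _)
    have hmeas : MeasurableSet {p : GPair | u ∈ cluster p.2 ∧ excess u p ≠ 0} :=
      (measurable_snd (hm u)).inter (measurableSet_eq_fun (measurable_excess u)
        measurable_const).compl
    rw [← lintegral_indicator_one hmeas]
    refine lintegral_mono fun p => ?_
    by_cases hp : u ∈ cluster p.2 ∧ excess u p ≠ 0
    · rw [Set.indicator_of_mem (s := {p : GPair | u ∈ cluster p.2 ∧ excess u p ≠ 0}) hp, Set.indicator_of_mem (show p.2 ∈ {Y | u ∈ cluster Y} from hp.1)]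
      simpa using hone u p hp.2
    · rw [Set.indicator_of_notMem (s := {p : GPair | u ∈ cluster p.2 ∧ excess u p ≠ 0}) hp]
      exact zero_le
  calc _ = m (⋃ u, {p | u ∈ cluster p.2 ∧ excess u p ≠ 0}) := by
        congr 1
        ext p
        simp
    _ ≤ ∑' u, m {p | u ∈ cluster p.2 ∧ excess u p ≠ 0} := measure_iUnion_le _
    _ ≤ ∑' u, c * ∫⁻ Y, {Y : RGraph | u ∈ cluster Y}.indicator 1 Y ∂ν :=
        ENNReal.tsum_le_tsum hpoint
    _ = _ := by
        rw [ENNReal.tsum_mul_left, meanSize,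
          ← lintegral_tsum fun u => (measurable_one.indicator (hm u)).aemeasurable]
        simp only [encard_eq_tsum]
        rfl

end Pairs

/-! ### Uniqueness of the invariant law -/

section Uniqueness

variable {b : ℕ} [NeZero b]

/-- The graph without edges with root `r`. -/
def edgeless (r : ℕ) : RGraph := (0, r)

theorem mult_zero (u v : ℕ) : mult (0 : MGraph ℕ) u v = 0 := by
  by_cases h : u = v
  · simp [h]
  · rw [mult_of_ne _ h]
    rfl

theorem cluster_edgeless (r : ℕ) : cluster (edgeless r) = {r} := by
  ext x
  rw [Set.mem_singleton_iff]
  constructor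
  · intro hx
    have hx' := (reachable_iff _ _ _).1 hx
    rcases Relation.ReflTransGen.cases_tail hx' with h | ⟨y, _, h⟩
    · exact h
    · exact absurd (mult_zero y x) h
  · rintro rfl
    exact root_mem_cluster (edgeless x)

theorem iso_edgeless (r s : ℕ) : Iso (edgeless r) (edgeless s) := by
  refine iso_of_map (fun _ => s) rfl ?_ ?_ ?_
  · rw [cluster_edgeless]
    exact Set.injOn_singleton _ _
  · intro x hx x' hx'
    simp [edgeless, mult_zero]
  · intro x hx y hy
    exact absurd (mult_zero s y) hy

theorem measurable_edgeless : Measurable edgeless := measurable_of_countable _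

/-- All edgeless codes are isomorphic, whatever the root. The total mass is kept because the lemma
is also applied to the degree-weighted measure, which need not be a probability. -/
theorem sameLaw_edgeless (μ : Measure RGraph) :
    SameLaw (μ.map fun X => edgeless X.2) (μ Set.univ • Measure.dirac (edgeless 0)) := by
  intro A hA hi
  have hm : Measurable fun X : RGraph => edgeless X.2 := measurable_edgeless.comp measurable_snd
  rw [Measure.map_apply hm hA, Measure.smul_apply, Measure.dirac_apply' _ hA, smul_eq_mul]
  have : ∀ X : RGraph, edgeless X.2 ∈ A ↔ edgeless 0 ∈ A := fun X => hi _ _ (iso_edgeless _ _)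
  by_cases h : edgeless 0 ∈ A
  · have hu : (fun X : RGraph => edgeless X.2) ⁻¹' A = Set.univ := by
      ext X
      simpa [this X] using h
    rw [hu, Set.indicator_of_mem h]
    simp
  · have hu : (fun X : RGraph => edgeless X.2) ⁻¹' A = ∅ := by
      ext X
      simpa [this X] using h
    rw [hu, Set.indicator_of_notMem h]
    simp

theorem splitLaw_smul (lam : ℝ≥0) (c : ℝ≥0∞) (μ : Measure RGraph) :
    splitLaw b lam (c • μ) = c • splitLaw b lam μ := by
  refine Measure.ext_of_lintegral _ fun f hf => ?_
  rw [lintegral_splitLaw lam _ hf, lintegral_smul_measure, lintegral_smul_measure,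
    lintegral_splitLaw lam _ hf]

theorem iterate_splitLaw_smul (lam : ℝ≥0) (c : ℝ≥0∞) (μ : Measure RGraph) (n : ℕ) :
    (splitLaw b lam)^[n] (c • μ) = c • (splitLaw b lam)^[n] μ := by
  induction n with
  | zero => rfl
  | succ n ih => rw [Function.iterate_succ_apply', Function.iterate_succ_apply', ih, splitLaw_smul]

theorem map_fst_iterate (lam : ℝ≥0) (m : Measure GPair) (n : ℕ) :
    ((splitPairLaw b lam)^[n] m).map GPair.fst = (splitLaw b lam)^[n] (m.map GPair.fst) := by
  induction n with
  | zero => rfl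
  | succ n ih =>
    rw [Function.iterate_succ_apply', Function.iterate_succ_apply', map_fst_splitPairLaw, ih]

theorem map_snd_iterate (lam : ℝ≥0) (m : Measure GPair) (n : ℕ) :
    ((splitPairLaw b lam)^[n] m).map Prod.snd = (splitLaw b lam)^[n] (m.map Prod.snd) := by
  induction n with
  | zero => rfl
  | succ n ih =>
    rw [Function.iterate_succ_apply', Function.iterate_succ_apply', map_snd_splitPairLaw, ih]

theorem sfinite_iterate (lam : ℝ≥0) (m : Measure GPair) [SFinite m] (n : ℕ) :
    SFinite ((splitPairLaw b lam)^[n] m) := by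
  induction n with
  | zero => assumption
  | succ n ih =>
    rw [Function.iterate_succ_apply', splitPairLaw]
    infer_instance

theorem nested_iterate (lam : ℝ≥0) {m : Measure GPair} [SFinite m]
    (h : ∀ᵐ p ∂m, p.2.1 ≤ p.1) (n : ℕ) :
    ∀ᵐ p ∂(splitPairLaw b lam)^[n] m, p.2.1 ≤ p.1 := by
  induction n with
  | zero => exact h
  | succ n ih =>
    have := sfinite_iterate (b := b) lam m n
    rw [Function.iterate_succ_apply']
    exact nested_splitPairLaw lam ih

theorem ExcessBound.iterate {c : ℝ≥0∞} {m : Measure GPair} {ν : Measure RGraph}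
    (h : ExcessBound c m ν) (lam : ℝ≥0) (n : ℕ) :
    ExcessBound (c * (b : ℝ≥0∞)⁻¹ ^ n) ((splitPairLaw b lam)^[n] m)
      ((splitLaw b lam)^[n] ν) := by
  induction n with
  | zero => simpa using h
  | succ n ih =>
    rw [Function.iterate_succ_apply', Function.iterate_succ_apply', pow_succ, ← mul_assoc]
    exact ih.split lam

/-- The pair of a multigraph and the multigraph without edges with the same root. -/
def withEdgeless (X : RGraph) : GPair := (X.1, edgeless X.2)

theorem measurable_withEdgeless : Measurable withEdgeless :=
  measurable_fst.prodMk (measurable_edgeless.comp measurable_snd)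

theorem map_fst_withEdgeless (μ : Measure RGraph) : (μ.map withEdgeless).map GPair.fst = μ := by
  rw [Measure.map_map measurable_gpair_fst measurable_withEdgeless]
  exact Measure.map_id

theorem map_snd_withEdgeless (μ : Measure RGraph) :
    (μ.map withEdgeless).map Prod.snd = μ.map fun X => edgeless X.2 := by
  rw [Measure.map_map measurable_snd measurable_withEdgeless]
  rfl

theorem nested_withEdgeless (μ : Measure RGraph) :
    ∀ᵐ p ∂μ.map withEdgeless, p.2.1 ≤ p.1 := by
  rw [ae_map_iff measurable_withEdgeless.aemeasurable measurableSet_nested]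
  exact Filter.Eventually.of_forall fun X e => Nat.zero_le _

/-- Initially only the excess at the root matters, and it is the root degree. Using the degree as a
density turns it into a measure for the second graph with constant `1`. -/
theorem excessBound_withEdgeless (μ : Measure RGraph) :
    ExcessBound 1 (μ.map withEdgeless)
      ((μ.withDensity rootDegree).map fun X => edgeless X.2) := by
  intro u F hF hu
  have hm : Measurable fun X : RGraph => edgeless X.2 := measurable_edgeless.comp measurable_snd
  have hme : Measurable fun p : GPair => excess u p * F p.2 :=
    (measurable_excess u).mul (hF.comp measurable_snd)
  have hFm : Measurable fun X : RGraph => F (edgeless X.2) := hF.comp hm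
  rw [one_mul, lintegral_map hF hm, lintegral_map hme measurable_withEdgeless,
    lintegral_withDensity_eq_lintegral_mul _ measurable_rootDegree hFm]
  refine lintegral_mono fun X => ?_
  simp only [Pi.mul_apply]
  by_cases h : u = X.2
  · subst h
    refine le_of_eq ?_
    simp [withEdgeless, excess, rootDegree, edgeless, mult_zero]
  · have h0 : F (edgeless X.2) = 0 := hu _ (by rw [cluster_edgeless]; exact h)
    simp [withEdgeless, h0]

/-- The law of the multigraph obtained from a single vertex by repeated splitting. -/
def iteratedSplit (b : ℕ) [NeZero b] (lam : ℝ≥0) (n : ℕ) : Measure RGraph :=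
  (splitLaw b lam)^[n] (Measure.dirac (edgeless 0))

/-! ### Comparison of invariant laws with iterated splittings of one vertex. -/

theorem meanSize_smul (c : ℝ≥0∞) (μ : Measure RGraph) : meanSize (c • μ) = c * meanSize μ := by
  rw [meanSize, lintegral_smul_measure]
  rfl

/-- In the coupling, the descendants of the bare root form a subgraph of the split invariant graph,
whose law up to isomorphism is still `μ`. -/
theorem meanSize_iteratedSplit_le {lam : ℝ≥0} {μ : Measure RGraph} [IsProbabilityMeasure μ]
    (h : SameLaw (splitLaw b lam μ) μ) (n : ℕ) :
    meanSize (iteratedSplit b lam n) ≤ meanSize μ := by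
  have : IsProbabilityMeasure (μ.map withEdgeless) :=
    Measure.isProbabilityMeasure_map measurable_withEdgeless.aemeasurable
  set m := (splitPairLaw b lam)^[n] (μ.map withEdgeless)
  have h1 : meanSize (m.map Prod.snd) = meanSize (iteratedSplit b lam n) := by
    have hs := (sameLaw_edgeless μ).iterate_split (b := b) lam n
    rw [map_snd_iterate, map_snd_withEdgeless, hs.meanSize_eq, measure_univ, one_smul]
    rfl
  have h2 : meanSize (m.map GPair.fst) = meanSize μ := by
    rw [map_fst_iterate, map_fst_withEdgeless, (sameLaw_iterate h n).meanSize_eq]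
  rw [← h1, ← h2, meanSize, meanSize, lintegral_map measurable_card_cluster measurable_snd,
    lintegral_map measurable_card_cluster measurable_gpair_fst]
  refine lintegral_mono_ae ?_
  filter_upwards [nested_iterate (b := b) lam (nested_withEdgeless μ) n] with p hp
  exact encard_coe_mono fun v hv => reachable_mono hp hv

/-- The coupled clusters are isomorphic outside the event that a surplus edge meets the smaller one,
and the probability of that event decays like `b ^ (-n)`. -/
theorem close_iteratedSplit {lam : ℝ≥0} {μ : Measure RGraph} (hμ : IsSplitInvariant b lam μ)
    (n : ℕ) {A : Set RGraph} (hA : MeasurableSet A) (hi : ∀ X Y, Iso X Y → (X ∈ A ↔ Y ∈ A)) :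
    μ A ≤ iteratedSplit b lam n A + (∫⁻ X, rootDegree X ∂μ) *
        meanSize (iteratedSplit b lam n) * (b : ℝ≥0∞)⁻¹ ^ n ∧
      iteratedSplit b lam n A ≤ μ A + (∫⁻ X, rootDegree X ∂μ) *
        meanSize (iteratedSplit b lam n) * (b : ℝ≥0∞)⁻¹ ^ n := by
  have := hμ.isProbability
  have : IsProbabilityMeasure (μ.map withEdgeless) :=
    Measure.isProbabilityMeasure_map measurable_withEdgeless.aemeasurable
  set m := (splitPairLaw b lam)^[n] (μ.map withEdgeless)
  set B : Set GPair := {p | ∃ u ∈ cluster p.2, excess u p ≠ 0}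
  have hB : m B ≤ (∫⁻ X, rootDegree X ∂μ) * meanSize (iteratedSplit b lam n) *
      (b : ℝ≥0∞)⁻¹ ^ n := by
    have h1 := measure_excess_le ((excessBound_withEdgeless μ).iterate (b := b) lam n)
    refine h1.trans_eq ?_
    -- The degree-weighted edgeless law is the mean root degree times a point mass, up to
    -- isomorphism, and splitting is linear.
    rw [((sameLaw_edgeless (μ.withDensity rootDegree)).iterate_split (b := b) lam n).meanSize_eq,
      iterate_splitLaw_smul, meanSize_smul, withDensity_apply _ MeasurableSet.univ,
      Measure.restrict_univ, one_mul, mul_comm]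
    rfl
  have h1 : μ A = m (GPair.fst ⁻¹' A) := by
    rw [← Measure.map_apply measurable_gpair_fst hA, map_fst_iterate, map_fst_withEdgeless]
    exact (sameLaw_iterate hμ.invariant n A hA hi).symm
  have h2 : iteratedSplit b lam n A = m (Prod.snd ⁻¹' A) := by
    rw [← Measure.map_apply measurable_snd hA, map_snd_iterate, map_snd_withEdgeless]
    have := (sameLaw_edgeless μ).iterate_split (b := b) lam n A hA hi
    rw [this, measure_univ, one_smul]
    rfl
  have hae : ∀ᵐ p ∂m, p ∉ B → (p.fst ∈ A ↔ p.2 ∈ A) := by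
    filter_upwards [nested_iterate (b := b) lam (nested_withEdgeless μ) n] with p hp hpB
    refine (hi _ _ (iso_of_excess hp fun u hu => ?_)).symm
    by_contra hne
    exact hpB ⟨u, hu, hne⟩
  rw [h1, h2]
  constructor
  · calc m (GPair.fst ⁻¹' A) ≤ m (Prod.snd ⁻¹' A ∪ B) := by
          refine measure_mono_ae ?_
          filter_upwards [hae] with p hp hpA
          by_cases h : p ∈ B
          · exact Or.inr h
          · exact Or.inl ((hp h).1 hpA)
      _ ≤ _ := (measure_union_le _ _).trans (by gcongr)
  · calc m (Prod.snd ⁻¹' A) ≤ m (GPair.fst ⁻¹' A ∪ B) := by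
          refine measure_mono_ae ?_
          filter_upwards [hae] with p hp hpA
          by_cases h : p ∈ B
          · exact Or.inr h
          · exact Or.inl ((hp h).2 hpA)
      _ ≤ _ := (measure_union_le _ _).trans (by gcongr)

theorem sameLaw_of_splitInvariant (hb : 2 ≤ b) {lam : ℝ≥0} {μ ν : Measure RGraph}
    (hμ : IsSplitInvariant b lam μ) (hν : IsSplitInvariant b lam ν) (hfin : meanSize ν < ∞) :
    SameLaw μ ν := by
  have := hν.isProbability
  -- The mean size is controlled by the fixed law `ν` only, so the inequality can be used in both
  -- directions without assuming that `μ` has finite mean size.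
  have key : ∀ {μ ν' : Measure RGraph}, IsSplitInvariant b lam μ → IsSplitInvariant b lam ν' →
      ∀ A : Set RGraph, MeasurableSet A → (∀ X Y, Iso X Y → (X ∈ A ↔ Y ∈ A)) → μ A ≤ ν' A := by
    intro μ ν' hμ hν' A hA hi
    set D := (∫⁻ X, rootDegree X ∂μ) * meanSize ν + (∫⁻ X, rootDegree X ∂ν') * meanSize ν
    have hD : D ≠ ∞ := by
      have h1 := hμ.finite_degree.ne
      have h2 := hν'.finite_degree.ne
      have h3 := hfin.ne
      finiteness
    have hle : ∀ n : ℕ, μ A ≤ ν' A + D * (b : ℝ≥0∞)⁻¹ ^ n := by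
      intro n
      have hs := meanSize_iteratedSplit_le hν.invariant n
      calc μ A ≤ _ := (close_iteratedSplit hμ n hA hi).1
        _ ≤ _ := add_le_add_left (close_iteratedSplit hν' n hA hi).2 _
        _ ≤ ν' A + (∫⁻ X, rootDegree X ∂ν') * meanSize ν * (b : ℝ≥0∞)⁻¹ ^ n +
            (∫⁻ X, rootDegree X ∂μ) * meanSize ν * (b : ℝ≥0∞)⁻¹ ^ n := by gcongr
        _ = _ := by simp only [D]; ring
    have hlim : Filter.Tendsto (fun n : ℕ => ν' A + D * (b : ℝ≥0∞)⁻¹ ^ n) Filter.atTop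
        (nhds (ν' A + D * 0)) := by
      refine Filter.Tendsto.const_add _ (ENNReal.Tendsto.const_mul ?_ (Or.inr hD))
      refine ENNReal.tendsto_pow_atTop_nhds_zero_of_lt_one ?_
      rw [ENNReal.inv_lt_one]
      exact_mod_cast hb
    rw [mul_zero, add_zero] at hlim
    exact ge_of_tendsto' hlim hle
  intro A hA hi
  exact le_antisymm (key hμ hν A hA hi) (key hν hμ A hA hi)

end Uniqueness

/-! ### Poisson thinning -/

section Thinning

variable {ι : Type*} [Fintype ι] [DecidableEq ι] [MeasurableSpace ι] [MeasurableSingletonClass ι]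

/-- The number of occurrences of `i` among the first `n` labels. -/
def labelCount (n : ℕ) (l : ℕ → ι) (i : ι) : ℕ := ((Finset.range n).filter fun k => l k = i).card

theorem labelCount_zero (l : ℕ → ι) (i : ι) : labelCount 0 l i = 0 := by simp [labelCount]

theorem labelCount_succ (n : ℕ) (l : ℕ → ι) (i : ι) :
    labelCount (n + 1) l i = labelCount n l i + if l n = i then 1 else 0 := by
  rw [labelCount, labelCount, Finset.range_add_one, Finset.filter_insert]
  split_ifs with h
  · rw [Finset.card_insert_of_notMem (by simp)]
  · rfl

theorem measurable_labelCount (n : ℕ) : Measurable fun l : ℕ → ι => labelCount n l := by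
  refine measurable_pi_lambda _ fun i => ?_
  induction n with
  | zero => simp [labelCount_zero]
  | succ n ih =>
    simp only [labelCount_succ]
    refine ih.add (Measurable.ite ?_ measurable_const measurable_const)
    exact (measurable_pi_apply (X := fun _ : ℕ => ι) n) (measurableSet_singleton i)

theorem labelCount_congr {n : ℕ} {l l' : ℕ → ι} (h : ∀ k < n, l k = l' k) :
    labelCount n l = labelCount n l' := by
  ext i
  unfold labelCount
  congr 1
  refine Finset.filter_congr fun k hk => ?_
  rw [h k (Finset.mem_range.1 hk)]

variable (μ : Measure ι) [IsProbabilityMeasure μ]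

/-- The last label is independent of the earlier ones; the event is partitioned according to its
value. -/
theorem measure_labelCount_succ (n : ℕ) (m : ι → ℕ) :
    Measure.infinitePi (fun _ : ℕ => μ) {l | labelCount (n + 1) l = m} =
      ∑ i, if m i = 0 then 0 else
        μ {i} * Measure.infinitePi (fun _ : ℕ => μ) {l | labelCount n l = m - Pi.single i 1} := by
  set P := Measure.infinitePi (fun _ : ℕ => μ)
  have hmeas : ∀ m : ι → ℕ, MeasurableSet {l : ℕ → ι | labelCount n l = m} := fun m =>
    measurable_labelCount n (measurableSet_singleton m)
  have hlab : ∀ i : ι, MeasurableSet {l : ℕ → ι | l n = i} := fun i =>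
    (measurable_pi_apply (X := fun _ : ℕ => ι) n) (measurableSet_singleton i)
  have hu : {l : ℕ → ι | labelCount (n + 1) l = m} =
      ⋃ i : ι, {l | l n = i} ∩ {l | labelCount (n + 1) l = m} := by
    ext l
    simp
  have hm1 : MeasurableSet {l : ℕ → ι | labelCount (n + 1) l = m} :=
    measurable_labelCount (n + 1) (measurableSet_singleton m)
  rw [hu, measure_iUnion _ (fun i => (hlab i).inter hm1), tsum_fintype]
  · refine Finset.sum_congr rfl fun i _ => ?_
    split_ifs with hi
    · have : {l : ℕ → ι | l n = i} ∩ {l | labelCount (n + 1) l = m} = ∅ := by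
        ext l
        simp only [Set.mem_inter_iff, Set.mem_ofPred_eq, Set.mem_empty_iff_false, iff_false, not_and]
        rintro h rfl
        simp [labelCount_succ, h] at hi
      rw [this, measure_empty]
    · have : {l : ℕ → ι | l n = i} ∩ {l | labelCount (n + 1) l = m} =
          {l | l n = i} ∩ {l | labelCount n l = m - Pi.single i 1} := by
        ext l
        simp only [Set.mem_inter_iff, Set.mem_ofPred_eq, and_congr_right_iff]
        intro h
        simp only [funext_iff, labelCount_succ, h, Pi.sub_apply]
        refine forall_congr' fun j => ?_
        by_cases hj : i = j
        · subst hj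
          simp only [if_true, Pi.single_eq_same]
          omega
        · simp [hj]
      rw [this, measure_inter_of_dependsOn (fun _ : ℕ => μ) (hlab i) (hmeas _) (S := {n})
        (T := Set.Iio n)]
      · congr 1
        exact (measurePreserving_eval_infinitePi (fun _ : ℕ => μ) n).measure_preimage
          (measurableSet_singleton i).nullMeasurableSet
      · intro l l' h
        simp [h n rfl]
      · intro l l' h
        simp only [Set.mem_ofPred_eq]
        rw [labelCount_congr fun k hk => h k hk]
      · simp
  · intro i j hij
    refine Set.disjoint_left.2 fun l h1 h2 => hij ?_
    exact h1.1.symm.trans h2.1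

theorem prod_pow_sub_single (p : ι → ℝ≥0∞) {m : ι → ℕ} {i : ι} (hi : m i ≠ 0) :
    p i * ∏ j, p j ^ (m - Pi.single i 1 : ι → ℕ) j = ∏ j, p j ^ m j := by
  rw [← Finset.mul_prod_erase _ _ (Finset.mem_univ i),
    ← Finset.mul_prod_erase _ (fun j => p j ^ m j) (Finset.mem_univ i), ← mul_assoc]
  congr 1
  · simp only [Pi.sub_apply, Pi.single_eq_same]
    rw [← pow_succ', Nat.sub_add_cancel (Nat.one_le_iff_ne_zero.2 hi)]
  · refine Finset.prod_congr rfl fun j hj => ?_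
    simp [Pi.single_eq_of_ne (Finset.ne_of_mem_erase hj)]

theorem prod_factorial_sub_single {m : ι → ℕ} {i : ι} (hi : m i ≠ 0) :
    m i * ∏ j, ((m - Pi.single i 1 : ι → ℕ) j).factorial = ∏ j, (m j).factorial := by
  rw [← Finset.mul_prod_erase _ _ (Finset.mem_univ i),
    ← Finset.mul_prod_erase _ (fun j => (m j).factorial) (Finset.mem_univ i), ← mul_assoc]
  congr 1
  · simp only [Pi.sub_apply, Pi.single_eq_same]
    exact Nat.mul_factorial_pred hi
  · refine Finset.prod_congr rfl fun j hj => ?_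
    simp [Pi.single_eq_of_ne (Finset.ne_of_mem_erase hj)]

theorem sum_sub_single {m : ι → ℕ} {i : ι} (hi : m i ≠ 0) :
    ∑ j, (m - Pi.single i 1 : ι → ℕ) j + 1 = ∑ j, m j := by
  have : ∀ j, m j = (m - Pi.single i 1 : ι → ℕ) j + (Pi.single i 1 : ι → ℕ) j := by
    intro j
    by_cases hj : j = i
    · subst hj
      simp only [Pi.sub_apply, Pi.single_eq_same]
      omega
    · simp [Pi.single_eq_of_ne hj]
  rw [Finset.sum_congr rfl fun j _ => this j, Finset.sum_add_distrib, Finset.sum_pi_single']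
  simp

/-- The multinomial distribution. -/
theorem measure_labelCount (n : ℕ) (m : ι → ℕ) :
    Measure.infinitePi (fun _ : ℕ => μ) {l | labelCount n l = m} * ((∏ i, (m i).factorial : ℕ) : ℝ≥0∞)
      = if ∑ i, m i = n then (n.factorial : ℝ≥0∞) * ∏ i, μ {i} ^ m i else 0 := by
  induction n generalizing m with
  | zero =>
    by_cases h : m = 0
    · subst h
      have : {l : ℕ → ι | labelCount 0 l = 0} = Set.univ := by
        ext l
        simp [funext_iff, labelCount_zero]
      rw [this]
      simp
    · have h1 : {l : ℕ → ι | labelCount 0 l = m} = ∅ := by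
        ext l
        simp only [Set.mem_ofPred_eq, Set.mem_empty_iff_false, iff_false]
        rintro rfl
        exact h (funext fun i => labelCount_zero l i)
      have h2 : ¬ ∑ i, m i = 0 := by
        intro h0
        refine h (funext fun i => ?_)
        exact (Finset.sum_eq_zero_iff.1 h0) i (Finset.mem_univ i)
      rw [h1, measure_empty, zero_mul, if_neg h2]
  | succ n ih =>
    rw [measure_labelCount_succ, Finset.sum_mul]
    -- Each value `i` of the last label contributes with weight `m i`; the weights sum to `n + 1`,
    -- which completes the factorial.
    have key : ∀ i, (if m i = 0 then 0 else μ {i} * Measure.infinitePi (fun _ : ℕ => μ)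
        {l | labelCount n l = m - Pi.single i 1}) * ((∏ i, (m i).factorial : ℕ) : ℝ≥0∞) =
        m i * (if ∑ i, m i = n + 1 then (n.factorial : ℝ≥0∞) * ∏ i, μ {i} ^ m i else 0) := by
      intro i
      by_cases hi : m i = 0
      · simp [hi]
      · rw [if_neg hi, ← prod_factorial_sub_single hi, Nat.cast_mul]
        calc _ = m i * (μ {i} * (Measure.infinitePi (fun _ : ℕ => μ)
              {l | labelCount n l = m - Pi.single i 1} *
              ((∏ j, ((m - Pi.single i 1 : ι → ℕ) j).factorial : ℕ) : ℝ≥0∞))) := by ring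
          _ = _ := by
            rw [ih, ← sum_sub_single hi]
            simp only [Nat.add_right_cancel_iff]
            split_ifs
            · rw [← prod_pow_sub_single (fun i => μ {i}) hi]
              ring
            · simp
    rw [Finset.sum_congr rfl fun i _ => key i, ← Finset.sum_mul, ← Nat.cast_sum]
    split_ifs with h
    · rw [h, Nat.factorial_succ]
      push_cast
      ring
    · simp

theorem poissonMeasure_singleton_mul (r : ℝ≥0) (n : ℕ) :
    poissonMeasure r {n} * n.factorial = ENNReal.ofReal (Real.exp (-r)) * (r : ℝ≥0∞) ^ n := by
  rw [poissonMeasure_singleton, ← ENNReal.ofReal_natCast, ← ENNReal.ofReal_mul (by positivity),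
    div_mul_cancel₀ _ (by positivity), ENNReal.ofReal_mul (by positivity),
    ENNReal.ofReal_pow (by positivity), ENNReal.ofReal_coe_nnreal]

/-- If each of a Poisson number of items receives an independent random label, then the numbers of
items with the different labels are independent Poisson variables. -/
theorem map_labelCount (r : ℝ≥0) {p : ι → ℝ≥0} (hp : ∀ i, μ {i} = p i) :
    ((poissonMeasure r).prod (Measure.infinitePi fun _ : ℕ => μ)).map
        (fun ω => labelCount ω.1 ω.2) =
      Measure.infinitePi fun i => poissonMeasure (r * p i) := by
  have hmeas : Measurable fun ω : ℕ × (ℕ → ι) => labelCount ω.1 ω.2 :=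
    measurable_from_prod_countable_right fun n => measurable_labelCount n
  have hsum : ∑ i, p i = 1 := by
    have h : ∑ i, μ {i} = μ Set.univ := by
      simpa only [Finset.coe_univ] using sum_measure_singleton (μ := μ) (s := Finset.univ)
    rw [measure_univ, Finset.sum_congr rfl fun i _ => hp i] at h
    exact_mod_cast h
  refine Measure.ext_of_singleton fun m => ?_
  rw [Measure.map_apply hmeas (measurableSet_singleton m),
    Measure.prod_apply (hmeas (measurableSet_singleton m)), Measure.infinitePi_singleton_of_fintype]
  have hfac : ((∏ i, (m i).factorial : ℕ) : ℝ≥0∞) ≠ 0 := by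
    exact_mod_cast (Finset.prod_pos fun i _ => (m i).factorial_pos).ne'
  -- Multiplying by the factorials avoids division in `ℝ≥0∞` and matches the multinomial formula.
  rw [← ENNReal.mul_left_inj hfac (ENNReal.natCast_ne_top _)]
  rw [← lintegral_mul_const _ (by exact measurable_of_countable _)]
  have h1 : ∀ n, Measure.infinitePi (fun _ : ℕ => μ)
      (Prod.mk n ⁻¹' ((fun ω : ℕ × (ℕ → ι) => labelCount ω.1 ω.2) ⁻¹' {m})) *
      ((∏ i, (m i).factorial : ℕ) : ℝ≥0∞) =
      ({∑ i, m i} : Set ℕ).indicator (fun n => (n.factorial : ℝ≥0∞) * ∏ i, μ {i} ^ m i) n := by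
    intro n
    refine (measure_labelCount μ n m).trans ?_
    by_cases h : ∑ i, m i = n
    · simp [h]
    · rw [if_neg h, Set.indicator_of_notMem (by simpa using Ne.symm h)]
  rw [lintegral_congr h1, lintegral_indicator (measurableSet_singleton _), lintegral_singleton,
    mul_right_comm, mul_comm (Nat.cast _), poissonMeasure_singleton_mul]
  push_cast
  rw [← Finset.prod_mul_distrib, Finset.prod_congr rfl fun i _ =>
    poissonMeasure_singleton_mul (r * p i) (m i), Finset.prod_mul_distrib,
    ← ENNReal.ofReal_prod_of_nonneg (fun _ _ => by positivity), ← Real.exp_sum]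
  have he : ∑ i, -((r * p i : ℝ≥0) : ℝ) = -r := by
    rw [Finset.sum_neg_distrib]
    congr 1
    exact_mod_cast (by rw [← Finset.mul_sum, hsum, mul_one] : ∑ i, r * p i = r)
  rw [he, mul_assoc, ← Finset.prod_pow_eq_pow_sum, ← Finset.prod_mul_distrib]
  congr 1
  refine Finset.prod_congr rfl fun i _ => ?_
  rw [hp, ENNReal.coe_mul, mul_pow]

end Thinning

/-! ### Pairs of product measures -/

section ProductMeasures

variable {ι κ : Type*} {X Y : ι → Type*} [∀ i, MeasurableSpace (X i)] [∀ i, MeasurableSpace (Y i)]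

/-- On a box, the section measure is a product of functions of separate coordinates, so independence
lets the integral factorize. -/
theorem infinitePi_prod_map (μ : ∀ i, Measure (X i)) (ν : ∀ i, Measure (Y i))
    [∀ i, IsProbabilityMeasure (μ i)] [∀ i, IsProbabilityMeasure (ν i)] :
    ((Measure.infinitePi μ).prod (Measure.infinitePi ν)).map (fun ω i => (ω.1 i, ω.2 i)) =
      Measure.infinitePi fun i => (μ i).prod (ν i) := by
  have hm : Measurable fun (ω : (∀ i, X i) × ∀ i, Y i) i => (ω.1 i, ω.2 i) := by fun_prop
  refine Measure.eq_infinitePi _ fun s t ht => ?_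
  have hst : MeasurableSet (Set.pi (s : Set ι) t) :=
    MeasurableSet.pi s.countable_toSet fun i _ => ht i
  rw [Measure.map_apply hm hst, Measure.prod_apply (hm hst)]
  have h1 : ∀ x : ∀ i, X i, Measure.infinitePi ν (Prod.mk x ⁻¹'
      ((fun (ω : (∀ i, X i) × ∀ i, Y i) i => (ω.1 i, ω.2 i)) ⁻¹' Set.pi (s : Set ι) t)) =
      ∏ i ∈ s, ν i (Prod.mk (x i) ⁻¹' t i) := by
    intro x
    rw [← Measure.infinitePi_pi ν fun i _ => measurable_prodMk_left (ht i)]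
    rfl
  rw [lintegral_congr h1]
  have hind : iIndepFun (fun i (x : ∀ i, X i) => ν i (Prod.mk (x i) ⁻¹' t i))
      (Measure.infinitePi μ) :=
    iIndepFun_infinitePi (X := fun i x => ν i (Prod.mk x ⁻¹' t i))
      fun i => measurable_measure_prodMk_left (ht i)
  have hmi : ∀ i, Measurable fun x : ∀ i, X i => ν i (Prod.mk (x i) ⁻¹' t i) := fun i =>
    (measurable_measure_prodMk_left (ht i)).comp (measurable_pi_apply i)
  rw [lintegral_prod_eq_prod_lintegral_of_indepFun s _ hind hmi]
  refine Finset.prod_congr rfl fun i _ => ?_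
  rw [Measure.prod_apply (ht i), ← Measure.infinitePi_map_eval μ i,
    lintegral_map (measurable_measure_prodMk_left (ht i)) (measurable_pi_apply i)]

theorem infinitePi_prod_map_sumElim {Z : Type*} [MeasurableSpace Z] (ρ : ι ⊕ κ → Measure Z)
    [∀ i, IsProbabilityMeasure (ρ i)] :
    ((Measure.infinitePi fun i => ρ (Sum.inl i)).prod
        (Measure.infinitePi fun j => ρ (Sum.inr j))).map (fun ω => Sum.elim ω.1 ω.2) =
      Measure.infinitePi ρ := by
  have hm : Measurable fun (ω : (ι → Z) × (κ → Z)) => (Sum.elim ω.1 ω.2 : ι ⊕ κ → Z) := by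
    refine measurable_pi_lambda _ fun i => ?_
    cases i
    · exact (measurable_pi_apply _).comp measurable_fst
    · exact (measurable_pi_apply _).comp measurable_snd
  refine Measure.eq_infinitePi _ fun s t ht => ?_
  rw [Measure.map_apply hm (MeasurableSet.pi s.countable_toSet fun i _ => ht i)]
  have : (fun (ω : (ι → Z) × (κ → Z)) => (Sum.elim ω.1 ω.2 : ι ⊕ κ → Z)) ⁻¹'
      Set.pi (s : Set (ι ⊕ κ)) t = Set.pi (s.toLeft : Set ι) (fun i => t (Sum.inl i)) ×ˢ
        Set.pi (s.toRight : Set κ) (fun i => t (Sum.inr i)) := by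
    ext ω
    simp [Set.mem_pi]
  rw [this, Measure.prod_prod, Measure.infinitePi_pi _ fun i _ => ht _,
    Measure.infinitePi_pi _ fun i _ => ht _]
  conv_rhs => rw [← s.toLeft_disjSum_toRight, Finset.prod_disjSum]

end ProductMeasures

/-! ### Invariance of the Poisson edge model under splitting -/

section Ordered

/-- The smaller element of a pair. -/
def lo (e : VPair ℕ) : ℕ := e.1.inf

/-- The larger element of a pair. -/
def hi (e : VPair ℕ) : ℕ := e.1.sup

theorem lo_mk {x y : ℕ} (h : x < y) (h') : lo ⟨s(x, y), h'⟩ = x := by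
  simp [lo, h.le]

theorem hi_mk {x y : ℕ} (h : x < y) (h') : hi ⟨s(x, y), h'⟩ = y := by
  simp [hi, h.le]

theorem eq_mk_lo_hi (e : VPair ℕ) : ∃ h : lo e < hi e, e = ⟨s(lo e, hi e), by simpa using h.ne⟩ := by
  obtain ⟨⟨x, y⟩, h⟩ := e
  have hxy : x ≠ y := by simpa using h
  rcases hxy.lt_or_gt with hlt | hlt
  · have h1 : lo ⟨s(x, y), h⟩ = x := lo_mk hlt _
    have h2 : hi ⟨s(x, y), h⟩ = y := hi_mk hlt _
    exact ⟨by change lo ⟨s(x, y), h⟩ < hi ⟨s(x, y), h⟩; omega, Subtype.ext (by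
      change s(x, y) = s(lo ⟨s(x, y), h⟩, hi ⟨s(x, y), h⟩)
      rw [h1, h2])⟩
  · have h1 : lo ⟨s(x, y), h⟩ = y := by simp [lo, hlt.le]
    have h2 : hi ⟨s(x, y), h⟩ = x := by simp [hi, hlt.le]
    exact ⟨by change lo ⟨s(x, y), h⟩ < hi ⟨s(x, y), h⟩; omega, Subtype.ext (by
      change s(x, y) = s(lo ⟨s(x, y), h⟩, hi ⟨s(x, y), h⟩)
      rw [h1, h2, Sym2.eq_swap])⟩

theorem lo_lt_hi (e : VPair ℕ) : lo e < hi e := (eq_mk_lo_hi e).1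

theorem apply_eq_mult (G : MGraph ℕ) (e : VPair ℕ) : G e = mult G (lo e) (hi e) := by
  obtain ⟨h, he⟩ := eq_mk_lo_hi e
  rw [mult_of_ne _ h.ne]
  exact congrArg G he

theorem edgeRate_eq_rate (b : ℕ) (lam : ℝ≥0) (e : VPair ℕ) :
    edgeRate b lam e = rate b lam (lo e) (hi e) := by
  obtain ⟨h, he⟩ := eq_mk_lo_hi e
  conv_lhs => rw [he]
  rfl

theorem vpair_ext {e e' : VPair ℕ} (h1 : lo e = lo e') (h2 : hi e = hi e') : e = e' := by
  obtain ⟨h, he⟩ := eq_mk_lo_hi e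
  obtain ⟨h', he'⟩ := eq_mk_lo_hi e'
  rw [he, he']
  simp only [h1, h2]

end Ordered

/-- The index of the choice of the end-vertex `c` of the `k`-th edge of a pair. -/
def halfIndex (q : VPair ℕ × ℕ × Bool) : ℕ × ℕ × ℕ :=
  if q.2.2 then (lo q.1, hi q.1, q.2.1) else (hi q.1, lo q.1, q.2.1)

theorem halfIndex_injective : Function.Injective halfIndex := by
  rintro ⟨e, k, c⟩ ⟨e', k', c'⟩ h
  have h1 := lo_lt_hi e
  have h2 := lo_lt_hi e'
  cases c <;> cases c' <;> simp only [halfIndex, if_true, Bool.false_eq_true, if_false,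
    Prod.mk.injEq] at h
  · rw [vpair_ext h.2.1 h.1, h.2.2]
  · omega
  · omega
  · rw [vpair_ext h.1 h.2.1, h.2.2]

/-- The chosen end-vertices of the edges. -/
def labels {b : ℕ} (h : ℕ × ℕ × ℕ → Fin b) (e : VPair ℕ) (k : ℕ) (c : Bool) : Fin b :=
  h (halfIndex (e, k, c))

theorem measurable_labels {b : ℕ} : Measurable (labels (b := b)) := by
  unfold labels
  fun_prop

section Invariance

variable {b : ℕ} [NeZero b]

theorem map_labels : (Measure.infinitePi fun _ : ℕ × ℕ × ℕ => unif b).map labels =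
    Measure.infinitePi fun _ : VPair ℕ => Measure.infinitePi fun _ : ℕ =>
      Measure.infinitePi fun _ : Bool => unif b := by
  have h1 := Measure.map_infinitePi_infinitePi_of_inj (P := fun _ : ℕ × ℕ × ℕ => unif b)
    halfIndex_injective
  have h2 := Measure.infinitePi_map_curry fun (_ : VPair ℕ) (_ : ℕ × Bool) => unif b
  have h3 := Measure.infinitePi_map_pi
    (fun _ : VPair ℕ => Measure.infinitePi fun _ : ℕ × Bool => unif b)
    (f := fun _ => MeasurableEquiv.curry ℕ Bool (Fin b)) (fun _ => MeasurableEquiv.measurable _)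
  rw [Measure.infinitePi_map_curry fun (_ : ℕ) (_ : Bool) => unif b, ← h2, ← h1,
    Measure.map_map (by fun_prop) (by fun_prop), Measure.map_map (by fun_prop) (by fun_prop)] at h3
  exact h3

theorem infinitePi_unif_singleton (l : Bool → Fin b) :
    Measure.infinitePi (fun _ : Bool => unif b) {l} = (((b : ℝ≥0) ^ 2)⁻¹ : ℝ≥0) := by
  have hb : (b : ℝ≥0) ≠ 0 := by exact_mod_cast NeZero.ne b
  rw [Measure.infinitePi_singleton_of_fintype]
  simp only [unif_singleton, Finset.prod_const, Finset.card_univ, Fintype.card_bool]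
  rw [ENNReal.coe_inv (pow_ne_zero 2 hb), ENNReal.coe_pow, ENNReal.inv_pow, ENNReal.coe_natCast]

/-- The numbers of edges of the parent pairs with the different choices of end-vertices. -/
def childCount (ω : MGraph ℕ × (ℕ × ℕ × ℕ → Fin b)) (q : VPair ℕ × (Bool → Fin b)) : ℕ :=
  labelCount (ω.1 q.1) (labels ω.2 q.1) q.2

/-- Poisson thinning applied pair by pair: the label of an edge is its pair of chosen end-vertices,
one of `b ^ 2` equally likely values. -/
theorem map_childCount (lam : ℝ≥0) :
    ((edgeMeasure b lam).prod (Measure.infinitePi fun _ : ℕ × ℕ × ℕ => unif b)).map childCount =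
      Measure.infinitePi fun q : VPair ℕ × (Bool → Fin b) =>
        poissonMeasure (edgeRate b lam q.1 * ((b : ℝ≥0) ^ 2)⁻¹) := by
  have hc : Measurable fun ω : ℕ × (ℕ → Bool → Fin b) => labelCount ω.1 ω.2 :=
    measurable_from_prod_countable_right fun n => measurable_labelCount n
  have h1 := Measure.map_prod_map (edgeMeasure b lam)
    (Measure.infinitePi fun _ : ℕ × ℕ × ℕ => unif b) measurable_id measurable_labels
  rw [Measure.map_id, map_labels] at h1
  have h2 := infinitePi_prod_map (fun e => poissonMeasure (edgeRate b lam e))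
    fun _ : VPair ℕ => Measure.infinitePi fun _ : ℕ => Measure.infinitePi fun _ : Bool => unif b
  have h3 := Measure.infinitePi_map_pi (fun e : VPair ℕ => (poissonMeasure (edgeRate b lam e)).prod
    (Measure.infinitePi fun _ : ℕ => Measure.infinitePi fun _ : Bool => unif b))
    (f := fun _ ω => labelCount ω.1 ω.2) (fun _ => hc)
  simp only [map_labelCount _ _ infinitePi_unif_singleton] at h3
  have h4 := Measure.infinitePi_map_curry_symm fun (e : VPair ℕ) (_ : Bool → Fin b) =>
    poissonMeasure (edgeRate b lam e * ((b : ℝ≥0) ^ 2)⁻¹)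
  have hm1 : Measurable (Prod.map id labels :
    MGraph ℕ × (ℕ × ℕ × ℕ → Fin b) → MGraph ℕ × (VPair ℕ → ℕ → Bool → Fin b)) :=
    measurable_id.prodMap measurable_labels
  have hm2 : Measurable fun (ω : (VPair ℕ → ℕ) × (VPair ℕ → ℕ → Bool → Fin b)) e =>
      (ω.1 e, ω.2 e) := by fun_prop
  have hm3 : Measurable fun (ω : VPair ℕ → ℕ × (ℕ → Bool → Fin b)) e =>
      labelCount (ω e).1 (ω e).2 :=
    measurable_pi_lambda _ fun e => hc.comp (measurable_pi_apply e)
  have hm4 := (MeasurableEquiv.curry (VPair ℕ) (Bool → Fin b) ℕ).symm.measurable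
  rw [← h4, ← h3, ← h2]
  change _ = (((((edgeMeasure b lam).prod _).map _).map _).map _)
  rw [h1, Measure.map_map hm2 hm1, Measure.map_map hm3 (hm2.comp hm1),
    Measure.map_map hm4 (hm3.comp (hm2.comp hm1))]
  rfl

theorem measurable_childCount : Measurable (childCount (b := b)) := by
  refine measurable_pi_lambda _ fun q => ?_
  have hc : Measurable fun ω : ℕ × (ℕ → Bool → Fin b) => labelCount ω.1 ω.2 :=
    measurable_from_prod_countable_right fun n => measurable_labelCount n
  have hm : Measurable fun ω : MGraph ℕ × (ℕ × ℕ × ℕ → Fin b) => (ω.1 q.1, labels ω.2 q.1) :=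
    ((measurable_pi_apply _).comp measurable_fst).prodMk
      ((measurable_pi_apply _).comp (measurable_labels.comp measurable_snd))
  exact (measurable_pi_apply q.2).comp (hc.comp hm)

/-- The remainder modulo `b`. -/
def modFin (b : ℕ) [NeZero b] (x : ℕ) : Fin b := ⟨x % b, Nat.mod_lt _ (NeZero.pos b)⟩

theorem eq_mul_div_add_modFin (x : ℕ) : x = b * (x / b) + (modFin b x : ℕ) :=
  (Nat.div_add_mod x b).symm

theorem ne_modFin {x y : ℕ} (hxy : x ≠ y) (h : x / b = y / b) : modFin b x ≠ modFin b y := by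
  intro h'
  apply hxy
  rw [eq_mul_div_add_modFin (b := b) x, eq_mul_div_add_modFin (b := b) y, h, h']

/-- The random variable that gives the number of edges of a pair in the split multigraph. -/
def splitIndex (b : ℕ) [NeZero b] (e : VPair ℕ) :
    (VPair ℕ × (Bool → Fin b)) ⊕ (ℕ × VPair (Fin b)) :=
  if h : lo e / b = hi e / b then
    Sum.inr (lo e / b, ⟨s(modFin b (lo e), modFin b (hi e)), by
      simpa using ne_modFin (lo_lt_hi e).ne h⟩)
  else
    Sum.inl (⟨s(lo e / b, hi e / b), by simpa using h⟩,
      fun c => if c then modFin b (lo e) else modFin b (hi e))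

/-- Distinct child pairs read distinct counts. A reversed match is impossible, since for distinct
parents the order of the children agrees with that of the parents, and for siblings it would
exchange the smaller and the larger leaf. -/
theorem splitIndex_injective : Function.Injective (splitIndex b) := by
  intro e e' he
  have h1 := lo_lt_hi e
  have h2 := lo_lt_hi e'
  have l1 := eq_mul_div_add_modFin (b := b) (lo e)
  have l2 := eq_mul_div_add_modFin (b := b) (hi e)
  have l1' := eq_mul_div_add_modFin (b := b) (lo e')
  have l2' := eq_mul_div_add_modFin (b := b) (hi e')
  by_cases h : lo e / b = hi e / b <;> by_cases h' : lo e' / b = hi e' / b <;>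
    simp only [splitIndex, h, h', dif_pos, dif_neg, not_false_eq_true, reduceCtorEq,
      Sum.inl.injEq, Sum.inr.injEq, Prod.mk.injEq, Subtype.mk.injEq] at he
  · obtain ⟨hq, hs⟩ := he
    rcases Sym2.eq_iff.1 hs with ⟨ha, hb⟩ | ⟨ha, hb⟩
    · exact vpair_ext (by rw [l1, l1', h, h', hq, ha]) (by rw [l2, l2', hq, hb])
    · have e1 : lo e = hi e' := by rw [l1, l2', h, hq, ha]
      have e2 : hi e = lo e' := by rw [l2, l1', h', hq, hb]
      omega
  · obtain ⟨hs, hl⟩ := he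
    have ha : modFin b (lo e) = modFin b (lo e') := by simpa using congrFun hl true
    have hb : modFin b (hi e) = modFin b (hi e') := by simpa using congrFun hl false
    have q1 : lo e / b < hi e / b := lt_of_le_of_ne (Nat.div_le_div_right h1.le) h
    have q2 : lo e' / b < hi e' / b := lt_of_le_of_ne (Nat.div_le_div_right h2.le) h'
    rcases Sym2.eq_iff.1 hs with ⟨hc, hd⟩ | ⟨hc, hd⟩
    · exact vpair_ext (by rw [l1, l1', ha, hc]) (by rw [l2, l2', hb, hd])
    · omega

theorem split_apply (G : MGraph ℕ) (half : ℕ × ℕ × ℕ → Fin b) (new : ℕ × VPair (Fin b) → ℕ)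
    (e : VPair ℕ) : split b G half new e = Sum.elim (childCount (G, half)) new (splitIndex b e) := by
  have hlt := lo_lt_hi e
  rw [apply_eq_mult (split b G half new) e]
  conv_lhs => rw [eq_mul_div_add_modFin (b := b) (lo e), eq_mul_div_add_modFin (b := b) (hi e)]
  by_cases h : lo e / b = hi e / b
  · rw [← h, mult_split_self, mult_of_ne _ (ne_modFin hlt.ne h), splitIndex, dif_pos h]
    rfl
  · have hq : lo e / b < hi e / b := lt_of_le_of_ne (Nat.div_le_div_right hlt.le) h
    rw [mult_split_of_ne _ _ _ h, splitIndex, dif_neg h, mult_of_ne _ h]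
    simp only [Sum.elim_inl, childCount, labelCount]
    congr 1
    refine Finset.filter_congr fun k _ => ?_
    simp [funext_iff, labels, halfIndex, lo_mk hq, hi_mk hq, and_comm]

/-- The thinned counts and the sibling counts form one independent Poisson family, of which the
split graph reads distinct members. Their rates are those of the canopy model by `rate_parent` and
`rate_siblings`. -/
theorem map_split_edgeMeasure (hb : 2 ≤ b) (lam : ℝ≥0) :
    ((edgeMeasure b lam).prod ((Measure.infinitePi fun _ : ℕ × ℕ × ℕ => unif b).prod
      (Measure.infinitePi fun _ : ℕ × VPair (Fin b) => poissonMeasure (lam / b)))).map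
        (fun ω => split b ω.1 ω.2.1 ω.2.2) = edgeMeasure b lam := by
  set half := Measure.infinitePi fun _ : ℕ × ℕ × ℕ => unif b
  set new := Measure.infinitePi fun _ : ℕ × VPair (Fin b) => poissonMeasure (lam / b)
  let r : (VPair ℕ × (Bool → Fin b)) ⊕ (ℕ × VPair (Fin b)) → ℝ≥0 :=
    Sum.elim (fun q => edgeRate b lam q.1 * ((b : ℝ≥0) ^ 2)⁻¹) fun _ => lam / b
  have hr : ∀ e, r (splitIndex b e) = edgeRate b lam e := by
    intro e
    rw [edgeRate_eq_rate]
    by_cases h : lo e / b = hi e / b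
    · rw [rate_siblings lam (lo_lt_hi e).ne h, splitIndex, dif_pos h]
      rfl
    · rw [rate_parent hb lam h, splitIndex, dif_neg h, div_eq_mul_inv]
      rfl
  have h1 := Measure.map_infinitePi_infinitePi_of_inj (P := fun i => poissonMeasure (r i))
    (splitIndex_injective (b := b))
  simp only [hr] at h1
  have h2 := infinitePi_prod_map_sumElim fun i => poissonMeasure (r i)
  have h3 := Measure.map_prod_map ((edgeMeasure b lam).prod half) new
    (measurable_childCount (b := b)) measurable_id
  rw [map_childCount, Measure.map_id] at h3
  have hm1 : Measurable fun (ω : (VPair ℕ × (Bool → Fin b) → ℕ) × (ℕ × VPair (Fin b) → ℕ)) =>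
      (Sum.elim ω.1 ω.2 : _ → ℕ) := by
    refine measurable_pi_lambda _ fun i => ?_
    cases i
    · exact (measurable_pi_apply _).comp measurable_fst
    · exact (measurable_pi_apply _).comp measurable_snd
  have hm2 : Measurable fun (ω : (VPair ℕ × (Bool → Fin b)) ⊕ (ℕ × VPair (Fin b)) → ℕ) e =>
      ω (splitIndex b e) := by fun_prop
  have hm3 := (measurable_childCount (b := b)).prodMap
    (measurable_id (α := ℕ × VPair (Fin b) → ℕ))
  have hm4 := (MeasurableEquiv.prodAssoc (α := MGraph ℕ) (β := ℕ × ℕ × ℕ → Fin b)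
    (γ := ℕ × VPair (Fin b) → ℕ)).measurable
  conv_rhs => rw [edgeMeasure, ← h1, ← h2]
  change _ = Measure.map _ (Measure.map _ (Measure.prod (Measure.infinitePi fun q :
    VPair ℕ × (Bool → Fin b) => poissonMeasure (edgeRate b lam q.1 * ((b : ℝ≥0) ^ 2)⁻¹)) new))
  rw [h3, Measure.map_map hm1 hm3, Measure.map_map hm2 (hm1.comp hm3),
    ← (measurePreserving_prodAssoc (edgeMeasure b lam) half new).map_eq,
    Measure.map_map (by exact measurable_split) hm4]
  congr 1
  ext ω e
  exact split_apply _ _ _ e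

end Invariance

/-! ### The Poisson edge model is an invariant random rooted multigraph -/

theorem lintegral_poissonMeasure (r : ℝ≥0) : ∫⁻ n, (n : ℝ≥0∞) ∂poissonMeasure r = r := by
  rw [lintegral_countable', tsum_eq_zero_add' ENNReal.summable]
  -- Size-biasing a Poisson variable shifts it by one.
  have h : ∀ n : ℕ, ((n + 1 : ℕ) : ℝ≥0∞) * poissonMeasure r {n + 1} = r * poissonMeasure r {n} := by
    intro n
    have hfac : (n.factorial : ℝ≥0∞) ≠ 0 := by exact_mod_cast n.factorial_pos.ne'
    rw [← ENNReal.mul_left_inj hfac (ENNReal.natCast_ne_top _), mul_assoc (r : ℝ≥0∞),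
      poissonMeasure_singleton_mul, mul_left_comm, ← pow_succ', ← poissonMeasure_singleton_mul,
      Nat.factorial_succ, Nat.cast_mul]
    ring
  rw [tsum_congr h, ENNReal.tsum_mul_left]
  have h1 : ∑' n : ℕ, poissonMeasure r {n} = 1 := by
    rw [← measure_univ (μ := poissonMeasure r), ← Set.iUnion_of_singleton ℕ,
      measure_iUnion (fun i j hij => by simpa using hij) fun i => measurableSet_singleton i]
  rw [h1]
  simp

theorem lintegral_mult_edgeMeasure (b : ℕ) (lam : ℝ≥0) {x y : ℕ} (h : x ≠ y) :
    ∫⁻ G, (mult G x y : ℝ≥0∞) ∂edgeMeasure b lam = rate b lam x y := by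
  simp only [mult_of_ne _ h]
  rw [edgeMeasure, ← edgeRate_mk b lam x y (by simpa using h), ← lintegral_poissonMeasure,
    ← Measure.infinitePi_map_eval (fun e : VPair ℕ => poissonMeasure (edgeRate b lam e)),
    lintegral_map (measurable_of_countable _) (measurable_pi_apply _)]

variable {b : ℕ} [NeZero b]

theorem lintegral_rootDegree_edgeModel_le (hb : 2 ≤ b) (lam : ℝ≥0) :
    ∫⁻ X, rootDegree X ∂edgeModel b lam ≤ lam := by
  rw [edgeModel, lintegral_map measurable_rootDegree (by fun_prop)]
  simp only [rootDegree]
  have hm : ∀ v, Measurable fun G : MGraph ℕ => (mult G 0 v : ℝ≥0∞) := fun v =>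
    (measurable_of_countable (fun n : ℕ => (n : ℝ≥0∞))).comp (measurable_mult 0 v)
  rw [lintegral_tsum fun v => (hm v).aemeasurable]
  refine le_trans (ENNReal.tsum_le_tsum fun v => ?_) (tsum_rate hb lam 0)
  split_ifs with h
  · exact (lintegral_mult_edgeMeasure b lam (Ne.symm h)).le
  · obtain rfl : v = 0 := by simpa using h
    simp

theorem iso_relabel (σ : Equiv.Perm ℕ) (G : MGraph ℕ) (r : ℕ) : Iso (relabel σ G, r) (G, σ r) := by
  refine iso_of_map σ rfl σ.injective.injOn (fun x _ x' _ => (mult_relabel σ G x x').symm) ?_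
  intro x hx y hy
  refine ⟨σ.symm y, mem_cluster_of_mult hx ?_, σ.apply_symm_apply y⟩
  simpa [mult_relabel] using hy

/-- All leaves of the canopy tree are equivalent in the Poisson edge model. -/
theorem edgeMeasure_root_eq (hb : 2 ≤ b) (lam : ℝ≥0) {A : Set RGraph} (hA : MeasurableSet A)
    (hi : ∀ X Y, Iso X Y → (X ∈ A ↔ Y ∈ A)) (v : ℕ) :
    edgeMeasure b lam {G | (G, v) ∈ A} = edgeModel b lam A := by
  obtain ⟨σ, hσ, rfl⟩ := exists_preservesBlocks hb v
  have hm : MeasurableSet {G : MGraph ℕ | (G, 0) ∈ A} := (by fun_prop :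
    Measurable fun G : MGraph ℕ => ((G, 0) : RGraph)) hA
  have h : edgeModel b lam A = edgeMeasure b lam {G | (G, 0) ∈ A} :=
    Measure.map_apply (by fun_prop) hA
  rw [h, ← map_relabel hb lam hσ, Measure.map_apply (measurable_relabel σ) hm,
    map_relabel hb lam hσ]
  congr 1
  ext G
  exact (hi _ _ (iso_relabel σ G 0)).symm

/-- The old root `0` splits into the leaves below `b`, so the new root is a uniform such leaf,
independent of the edges. -/
theorem splitLaw_edgeModel (hb : 2 ≤ b) (lam : ℝ≥0) :
    splitLaw b lam (edgeModel b lam) =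
      ((edgeMeasure b lam).prod (unif b)).map fun p => (p.1, (p.2 : ℕ)) := by
  set half := Measure.infinitePi fun _ : ℕ × ℕ × ℕ => unif b
  set new := Measure.infinitePi fun _ : ℕ × VPair (Fin b) => poissonMeasure (lam / b)
  set E := edgeMeasure b lam
  have hroot : Measurable fun G : MGraph ℕ => ((G, 0) : RGraph) := by fun_prop
  have h1 := Measure.map_prod_map E (half.prod (new.prod (unif b))) hroot measurable_id
  rw [Measure.map_id] at h1
  have h2 := ((MeasurePreserving.id E).prod (measurePreserving_prodAssoc half new (unif b))).comp
    (measurePreserving_prodAssoc E (half.prod new) (unif b))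
  have h3 := Measure.map_prod_map (E.prod (half.prod new)) (unif b) measurable_split measurable_id
  rw [map_split_edgeMeasure hb, Measure.map_id] at h3
  change Measure.map (splitRooted b) ((E.map _).prod (half.prod (new.prod (unif b)))) = _
  rw [h1, ← h2.map_eq, h3, Measure.map_map (hroot.prodMap measurable_id) h2.measurable,
    Measure.map_map measurable_splitRooted ((hroot.prodMap measurable_id).comp h2.measurable),
    Measure.map_map (by fun_prop) (measurable_split.prodMap measurable_id)]
  congr 1
  ext ω
  · rfl
  · simp only [Function.comp_apply, Prod.map_snd, id_eq, splitRooted, Prod.map_fst, mul_zero,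
      zero_add]
    rfl

theorem edgeModel_isSplitInvariant (hb : 2 ≤ b) (lam : ℝ≥0) :
    IsSplitInvariant b lam (edgeModel b lam) where
  isProbability := Measure.isProbabilityMeasure_map (by fun_prop)
  finite_degree := (lintegral_rootDegree_edgeModel_le hb lam).trans_lt ENNReal.coe_lt_top
  invariant := by
    intro A hA hi
    have hm : Measurable fun p : MGraph ℕ × Fin b => ((p.1, (p.2 : ℕ)) : RGraph) := by fun_prop
    rw [splitLaw_edgeModel hb, Measure.map_apply hm hA, Measure.prod_apply_symm (hm hA)]
    have h : ∀ i : Fin b, edgeMeasure b lam ((fun G => (G, i)) ⁻¹'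
        ((fun p : MGraph ℕ × Fin b => ((p.1, (p.2 : ℕ)) : RGraph)) ⁻¹' A)) = edgeModel b lam A :=
      fun i => edgeMeasure_root_eq hb lam hA hi i
    rw [lintegral_congr h, lintegral_const, measure_univ, mul_one]

end CanopyGraph

end

/-! ### The main theorem. -/

theorem theorem1 (b : ℕ) [NeZero b] (hb : 2 ≤ b) :
    ∃ c C : ℝ, 0 < c ∧ 0 < C ∧
      (∀ lam : ℝ≥0,
        -- the cluster of the origin in the Poisson edge model is invariant under splitting
        CanopyGraph.IsSplitInvariant b lam (CanopyGraph.edgeModel b lam) ∧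
        -- every invariant random rooted multigraph has this law, and satisfies the bounds
        ∀ μ : Measure CanopyGraph.RGraph, CanopyGraph.IsSplitInvariant b lam μ →
          CanopyGraph.SameLaw μ (CanopyGraph.edgeModel b lam) ∧
          (∀ᵐ X ∂μ, (CanopyGraph.cluster X).Finite) ∧
          (0 < lam → ENNReal.ofReal (Real.exp (c * lam)) < CanopyGraph.meanSize μ) ∧
          CanopyGraph.meanSize μ < ENNReal.ofReal (Real.exp (Real.exp (C * lam)))) ∧
      (fun lam : ℝ≥0 =>
          Real.log (CanopyGraph.meanSize (CanopyGraph.edgeModel b lam)).toReal)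
        =O[Filter.atTop] (fun lam : ℝ≥0 => Real.exp lam * Real.log lam) := by
  obtain ⟨c, hc, hlower⟩ := CanopyGraph.exists_lt_meanSize hb
  obtain ⟨C, hC, hupper⟩ := CanopyGraph.exists_meanSize_lt hb
  refine ⟨c, C, hc, hC, fun lam => ?_, CanopyGraph.isBigO_log_meanSize hb⟩
  have hinv := CanopyGraph.edgeModel_isSplitInvariant hb lam
  refine ⟨hinv, fun μ hμ => ?_⟩
  -- Finite mean size of the canopy cluster is the input to uniqueness; uniqueness then transfers
  -- all bounds to `μ`.
  have hlt := CanopyGraph.meanSize_lt_top hb lam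
  have hsame := CanopyGraph.sameLaw_of_splitInvariant hb hμ hinv hlt
  rw [← hsame.meanSize_eq] at hlt
  refine ⟨hsame, CanopyGraph.ae_finite_of_meanSize hlt, fun h => ?_, ?_⟩ <;>
    rw [hsame.meanSize_eq]
  · exact hlower lam h
  · exact hupper lam
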